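/- Let $\beta>0$, $\gamma>0$ and $c<c_*:=3(\beta^2\gamma/4)^{1/3}$ be real. Let $f\in C^2(\mathbb R;\mathbb R)$ be homogeneous of degree $p>1$, i.e. $f(ts)=t^pf(s)$ for all $t>0$, $s\in\mathbb R$. Write $\widehat g(\zeta)=\int_{\mathbb R} g(x)e^{-ix\zeta}\,dx$ (extended to $L^2(\mathbb R)$), let $\partial_x^{k}g$ for $k\in\{-2,-1\}$ be the function with Fourier transform $(i\zeta)^{k}\widehat g(\zeta)$, and let $\mathcal H v(x)=\mathrm{p.v.}\,\frac1\pi\int_{\mathbb R}\frac{v(z)}{x-z}\,dz$ be the Hilbert transform. Let $\mathcal X$ be the space of real-valued $g\in H^{1/2}(\mathbb R)$ with $\partial_x^{-1}g\in L^2(\mathbb R)$, and let $\varphi\in\mathcal X$ be a solution of $$\beta\mathcal H\varphi_x-c\varphi+f(\varphi)=\gamma\,\partial_x^{-2}\varphi \qquad\text{on }\mathbb R \tag{2.1}$$ in the weak sense, that is, $$\int_{\mathbb R}\varphi\,(\beta\mathcal H w''-c\,w')\,dx+\int_{\mathbb R}f(\varphi)\,w'\,dx=-\gamma\int_{\mathbb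 R}(\partial_x^{-1}\varphi)\,w\,dx\qquad\text{for all } w\in C_c^\infty(\mathbb R).$$ Then: (a) For $k\in\{-2,-1,0\}$ the function $\varphi^{(k)}:=\partial_x^k\varphi$ exists in $L^2(\mathbb R)$, and $$|x|^\ell\varphi^{(k)}\in L^q(\mathbb R)\qquad\text{for all }1\le q\le\infty\text{ and all real }\ell\in[0,4+k].$$ (b) If $f\in C^m(\mathbb R)$ for an integer $m\ge 0$, then for every integer $n$ with $1\le n\le m+1$ the weak derivative $\varphi^{(n)}$ exists, and $$|x|^\ell\varphi^{(n)}\in L^q(\mathbb R)\qquad\text{for all }1\le q\le\infty\text{ and all real }\ell\in[0,5].$$ In particular this holds for $n=1,2,3$ always, and for every $n\ge1$ if $f\in C^\infty(\mathbb R)$. -/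

import Mathlib

open MeasureTheory Filter Topology
open scoped ContDiff FourierTransform ENNReal SchwartzMap

namespace RGBO

noncomputable section

/-- A real-valued square integrable function, seen as an element of `L²(ℝ; ℂ)`. -/
def toL2 (g : ℝ → ℝ) (hg : MemLp g 2 volume) : Lp ℂ 2 (volume : Measure ℝ) :=
  MemLp.toLp (fun x => (g x : ℂ)) hg.ofReal

/-- `IsFourierDeriv k g u`: the square integrable function `u` is `∂ₓᵏ g` (`k ∈ ℤ`, possibly
negative), in the sense that `û(ζ) = (iζ)ᵏ ĝ(ζ)` for almost every frequency `ζ`. Mathlib's (L²)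
Fourier transform has the kernel `exp (-2πixξ)`, so that `ζ = 2πξ`. -/
def IsFourierDeriv (k : ℤ) (g u : ℝ → ℝ) : Prop :=
  ∃ (hg : MemLp g 2 volume) (hu : MemLp u 2 volume),
    (𝓕 (toL2 u hu) : Lp ℂ 2 (volume : Measure ℝ)) =ᵐ[volume]
      fun ξ : ℝ => (2 * Real.pi * Complex.I * ξ) ^ k *
        (𝓕 (toL2 g hg) : Lp ℂ 2 (volume : Measure ℝ)) ξ

/-- The energy space `𝒳`: (real-valued) functions in `H^{1/2}(ℝ)` whose antiderivative `∂ₓ⁻¹ g`,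
i.e. the function with Fourier transform `(iζ)⁻¹ ĝ(ζ)`, belongs to `L²(ℝ)`. -/
def MemX (g : ℝ → ℝ) : Prop :=
  (∃ hg : MemLp g 2 volume,
    TemperedDistribution.MemSobolev (1 / 2 : ℝ) 2 (toL2 g hg : 𝓢'(ℝ, ℂ))) ∧
  ∃ u : ℝ → ℝ, IsFourierDeriv (-1) g u

/-- The Hilbert transform `ℋ v(x) = p.v. (1/π) ∫ v(z) / (x - z) dz`. It is only applied to smooth
compactly supported `v`, for which the principal value exists at every `x`. -/
def hilbertTransform (v : ℝ → ℝ) (x : ℝ) : ℝ :=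
  limUnder (𝓝[>] (0 : ℝ)) fun ε : ℝ =>
    (1 / Real.pi) * ∫ z in {z : ℝ | ε < |x - z|}, v z / (x - z)

/-- `φ` is a solitary wave: `φ ∈ 𝒳` is a weak solution of
`β ℋ φₓ - c φ + f(φ) = γ ∂ₓ⁻² φ`.

Both sides are tested against derivatives `w'` of test functions `w` (the pairing of `∂ₓ⁻² φ` with
`w'` being `-∫ (∂ₓ⁻¹ φ) w`), and the skew-adjoint operators `ℋ` and `∂ₓ` are moved to the test
function: `⟨ℋ φₓ, w'⟩ = ∫ φ ℋ(w'')`. All integrals converge: `ℋ(w'') ∈ L²`, and `φ` is in `L^r` for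
all `2 ≤ r < ∞`. -/
def IsSolitaryWave (β c γ : ℝ) (f : ℝ → ℝ) (φ : ℝ → ℝ) : Prop :=
  MemX φ ∧ ∀ u : ℝ → ℝ, IsFourierDeriv (-1) φ u →
    ∀ w : ℝ → ℝ, ContDiff ℝ ∞ w → HasCompactSupport w →
      β * (∫ x, φ x * hilbertTransform (deriv (deriv w)) x) - c * (∫ x, φ x * deriv w x)
        + (∫ x, f (φ x) * deriv w x) = -γ * ∫ x, u x * w x

/-- `u` is the `n`-th weak derivative `g⁽ⁿ⁾` of the locally integrable function `g` on `ℝ`. -/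
def IsWeakDeriv (n : ℕ) (g u : ℝ → ℝ) : Prop :=
  LocallyIntegrable g volume ∧ LocallyIntegrable u volume ∧
    ∀ w : ℝ → ℝ, ContDiff ℝ ∞ w → HasCompactSupport w →
      ∫ x, g x * iteratedDeriv n w x = (-1) ^ n * ∫ x, u x * w x

end

end RGBO

/-! With ζ = 2πξ and D(ζ) = β|ζ|³ − cζ² + γ, the equation reads D φ̂ = −ζ² (f(φ))^ on the Fourier
side (`IsSolitaryWave.fourier_eq`). By the AM-GM inequality, c < c_* forces D ≥ κ(1+|ξ|)³
(`exists_denom_lower`), so φ = K * f(φ) with K̂ = −ζ²/D.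

Two properties of the multipliers ζ^j/D decide the result (`sym_pow_div_denom`). At infinity −ζ²/D
has order −1, so f(φ) ↦ φ gains one derivative. At the origin the only singularity is the |ζ|³ in D,
so ζ^j/D has 2 + j continuous derivatives and a bounded one of order 3 + j. Dually the kernel has 3
+ j moments in L². Cauchy–Schwarz turns this into weights 2 + j in L¹: these are the weights 4 + k
for ∂ₓᵏφ, where j = k + 2, and the weight 5 for φ', where j = 3.

Start of the argument: H^{1/2} embeds in L^{2p} (`IsFT.memLp_of_half`) and |f(s)| ≤ C|s|^p, so f(φ)
is in L², φ̂ is integrable and φ has a continuous representative vanishing at infinity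
(`exists_isWave`). Since f is C² with f(0) = f'(0) = 0, |φ| ≤ |K| * Cφ². One factor of φ² is small
far out, so the weighted supremum of φ can be absorbed (`decay_of_convolution`), which gives φ =
O(|x|⁻⁴). Then f(φ) = O(|x|⁻⁸) has six moments, and these carry over to the derivatives of φ.

Regularity is a bootstrap between φ and f(φ): first without weights (`IsDecayingWave.wl2`), then
with six moments (`IsDecayingWave.chain`). If f is C^m, the derivatives up to order m + 1 have six
moments in L². With a spare derivative of f the moments also have integrable transforms, hence are
bounded.

The endpoint n = m + 1 has no spare derivative, and an L² argument gives no sup bound. Up to a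
multiplier of order −1, φ^(m+1) is β⁻¹ times the Hilbert transform of (f∘φ)^(m), which is bounded if
that function is Hölder continuous and in L². Hölder continuity comes from homogeneity: a continuous
homogeneous function on the line is locally Hölder, so f^(m) is (`compIter_hol_of_homogeneous`).
Commuting powers of x past the multiplier costs only terms of order −1 (`IsFT.pow_mul_memLp_top`,
`IsDecayingWave.memLp_top`). Finally `memLp_weight` interpolates the L² and sup bounds. -/

namespace RGBO

/-! ### Calculus of the L² Fourier transform. -/

/-- `U` is the `L²` Fourier transform of `u`, expressed by testing with Schwartz functions. -/
structure IsFT (u U : ℝ → ℂ) : Prop where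
  left : MemLp u 2 volume
  right : MemLp U 2 volume
  eq : ∀ ψ : 𝓢(ℝ, ℂ), ∫ x, U x * ψ x = ∫ x, u x * 𝓕 ψ x

lemma toLp_eq_of_test {u v : ℝ → ℂ} (hu : LocallyIntegrable u volume)
    (hv : LocallyIntegrable v volume)
    (h : ∀ ψ : 𝓢(ℝ, ℂ), ∫ x, u x * ψ x = ∫ x, v x * ψ x) : u =ᵐ[volume] v := by
  apply ae_eq_of_integral_contDiff_smul_eq hu hv
  intro g hg hc
  have hc' : HasCompactSupport (Complex.ofRealCLM ∘ g) := hc.comp_left rfl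
  have hg' : ContDiff ℝ ∞ (Complex.ofRealCLM ∘ g) := by fun_prop
  have := h (hc'.toSchwartzMap hg')
  simpa [mul_comm] using this

/-- Links the tested form to the isometry of L², from which Plancherel's identity, inversion and
existence are imported. -/
lemma isFT_iff {u U : ℝ → ℂ} (hu : MemLp u 2 volume) (hU : MemLp U 2 volume) :
    IsFT u U ↔ (𝓕 (hu.toLp u) : Lp ℂ 2 (volume : Measure ℝ)) = hU.toLp U := by
  have key : ∀ ψ : 𝓢(ℝ, ℂ), ∫ x, (𝓕 (hu.toLp u) : Lp ℂ 2 (volume : Measure ℝ)) x * ψ x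
      = ∫ x, u x * 𝓕 ψ x := by
    intro ψ
    have h := congrArg (fun T : 𝓢'(ℝ, ℂ) => T ψ) (Lp.fourier_toTemperedDistribution_eq (hu.toLp u))
    simp only [TemperedDistribution.fourier_apply, Lp.toTemperedDistribution_apply, smul_eq_mul] at h
    simp only [mul_comm _ (ψ _)]
    rw [← h]
    apply integral_congr_ae
    filter_upwards [hu.coeFn_toLp] with x hx
    rw [hx, mul_comm]
  constructor
  · intro h
    apply Lp.ext
    refine EventuallyEq.trans ?_ hU.coeFn_toLp.symm
    apply toLp_eq_of_test
    · exact (Lp.memLp _).locallyIntegrable (by norm_num)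
    · exact hU.locallyIntegrable (by norm_num)
    · intro ψ
      rw [key, h.eq]
  · intro h
    refine ⟨hu, hU, fun ψ => ?_⟩
    rw [← key, h]
    apply integral_congr_ae
    filter_upwards [hU.coeFn_toLp] with x hx
    rw [hx]

lemma IsFT.unique {u U V : ℝ → ℂ} (h : IsFT u U) (h' : IsFT u V) : U =ᵐ[volume] V :=
  toLp_eq_of_test (h.right.locallyIntegrable (by norm_num))
    (h'.right.locallyIntegrable (by norm_num)) fun ψ => by rw [h.eq, h'.eq]

lemma IsFT.congr {u v U V : ℝ → ℂ} (h : IsFT u U) (h₁ : u =ᵐ[volume] v) (h₂ : U =ᵐ[volume] V) :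
    IsFT v V := by
  refine ⟨h.left.ae_eq h₁, h.right.ae_eq h₂, fun ψ => ?_⟩
  rw [integral_congr_ae (g := fun x => U x * ψ x), h.eq]
  · apply integral_congr_ae
    filter_upwards [h₁] with x hx
    rw [hx]
  · filter_upwards [h₂] with x hx
    rw [hx]

lemma IsFT.congr_left {u v U : ℝ → ℂ} (h : IsFT u U) (h₁ : u =ᵐ[volume] v) : IsFT v U :=
  h.congr h₁ EventuallyEq.rfl

lemma IsFT.congr_right {u U V : ℝ → ℂ} (h : IsFT u U) (h₂ : U =ᵐ[volume] V) : IsFT u V :=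
  h.congr EventuallyEq.rfl h₂

lemma exists_isFT {u : ℝ → ℂ} (hu : MemLp u 2 volume) : ∃ U, IsFT u U :=
  ⟨_, (isFT_iff hu (Lp.memLp (𝓕 (hu.toLp u) : Lp ℂ 2 (volume : Measure ℝ)))).2 (by simp)⟩

lemma exists_isFT_inv {U : ℝ → ℂ} (hU : MemLp U 2 volume) : ∃ u, IsFT u U := by
  refine ⟨_, (isFT_iff (Lp.memLp (𝓕⁻ (hU.toLp U) : Lp ℂ 2 (volume : Measure ℝ))) hU).2 ?_⟩
  simp

lemma IsFT.unique_left {u v U : ℝ → ℂ} (h : IsFT u U) (h' : IsFT v U) : u =ᵐ[volume] v := by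
  have h₁ := (isFT_iff h.left h.right).1 h
  have h₂ := (isFT_iff h'.left h.right).1 h'
  have h₃ : h.left.toLp u = h'.left.toLp v := by
    have := congrArg (fun w : Lp ℂ 2 (volume : Measure ℝ) => (𝓕⁻ w : Lp ℂ 2 (volume : Measure ℝ)))
      (h₁.trans h₂.symm)
    simpa using this
  exact (MemLp.toLp_eq_toLp_iff _ _).1 h₃

lemma integrable_mul_of_memLp {u v : ℝ → ℂ} (hu : MemLp u 2 volume) (hv : MemLp v 2 volume) :
    Integrable (fun x => u x * v x) volume := hu.integrable_mul hv

lemma schwartz_memLp (ψ : 𝓢(ℝ, ℂ)) : MemLp (fun x => ψ x) 2 volume := ψ.memLp 2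

lemma IsFT.add {u U v V : ℝ → ℂ} (h : IsFT u U) (h' : IsFT v V) :
    IsFT (fun x => u x + v x) (fun x => U x + V x) := by
  refine ⟨h.left.add h'.left, h.right.add h'.right, fun ψ => ?_⟩
  simp only [add_mul]
  rw [integral_add, integral_add, h.eq, h'.eq]
  · exact integrable_mul_of_memLp h.left (schwartz_memLp _)
  · exact integrable_mul_of_memLp h'.left (schwartz_memLp _)
  · exact integrable_mul_of_memLp h.right (schwartz_memLp _)
  · exact integrable_mul_of_memLp h'.right (schwartz_memLp _)

lemma IsFT.const_mul {u U : ℝ → ℂ} (h : IsFT u U) (c : ℂ) :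
    IsFT (fun x => c * u x) (fun x => c * U x) := by
  refine ⟨h.left.const_mul c, h.right.const_mul c, fun ψ => ?_⟩
  simp only [mul_assoc, integral_const_mul, h.eq]

lemma IsFT.sub {u U v V : ℝ → ℂ} (h : IsFT u U) (h' : IsFT v V) :
    IsFT (fun x => u x - v x) (fun x => U x - V x) := by
  simpa [sub_eq_add_neg] using h.add (h'.const_mul (-1))

/-- Plancherel's identity. -/
lemma IsFT.plancherel {u U v V : ℝ → ℂ} (h : IsFT u U) (h' : IsFT v V) :
    ∫ x, (starRingEnd ℂ) (u x) * v x = ∫ x, (starRingEnd ℂ) (U x) * V x := by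
  have h₁ := (isFT_iff h.left h.right).1 h
  have h₂ := (isFT_iff h'.left h'.right).1 h'
  have h₃ := Lp.inner_fourier_eq (h.left.toLp u) (h'.left.toLp v)
  rw [h₁, h₂, L2.inner_def, L2.inner_def] at h₃
  have aux : ∀ {a b : ℝ → ℂ} (ha : MemLp a 2 volume) (hb : MemLp b 2 volume),
      ∫ x, inner ℂ (ha.toLp a x) (hb.toLp b x) = ∫ x, (starRingEnd ℂ) (a x) * b x := by
    intro a b ha hb
    apply integral_congr_ae
    filter_upwards [ha.coeFn_toLp, hb.coeFn_toLp] with x hx hy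
    rw [hx, hy, RCLike.inner_apply, mul_comm]
  rw [aux, aux] at h₃
  exact h₃.symm

lemma IsFT.eLpNorm_eq {u U : ℝ → ℂ} (h : IsFT u U) :
    eLpNorm u 2 volume = eLpNorm U 2 volume := by
  have h₁ := (isFT_iff h.left h.right).1 h
  have h₃ := Lp.norm_fourier_eq (h.left.toLp u)
  rw [h₁, Lp.norm_toLp, Lp.norm_toLp] at h₃
  exact ((ENNReal.toReal_eq_toReal_iff' h.right.eLpNorm_ne_top h.left.eLpNorm_ne_top).1 h₃).symm

/-- Test functions for the Fourier transform may be taken to be Fourier transforms. -/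
lemma ae_eq_of_test_fourier {u v : ℝ → ℂ} (hu : LocallyIntegrable u volume)
    (hv : LocallyIntegrable v volume)
    (h : ∀ ψ : 𝓢(ℝ, ℂ), ∫ x, u x * 𝓕 ψ x = ∫ x, v x * 𝓕 ψ x) : u =ᵐ[volume] v := by
  apply toLp_eq_of_test hu hv
  intro ψ
  have := h (𝓕⁻ ψ)
  simpa using this

/-- The Fourier integral of a function in `L¹ ∩ L²` is its `L²` Fourier transform. -/
lemma isFT_fourierIntegral {u : ℝ → ℂ} (hu : Integrable u volume) (hu2 : MemLp u 2 volume) :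
    IsFT u (𝓕 u) := by
  obtain ⟨U, hU⟩ := exists_isFT hu2
  refine hU.congr_right ?_
  have hc : Continuous (𝓕 u) := by
    have := VectorFourier.fourierIntegral_continuous (μ := volume) (L := innerₗ ℝ) Real.continuous_fourierChar
      continuous_inner hu
    exact this
  apply toLp_eq_of_test (hU.right.locallyIntegrable (by norm_num)) hc.locallyIntegrable
  intro ψ
  rw [hU.eq]
  have := VectorFourier.integral_fourierIntegral_smul_eq_flip (μ := volume) (ν := volume)
    (L := innerₗ ℝ) (f := u) (g := ψ) Real.continuous_fourierChar continuous_inner hu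
    ψ.integrable
  simp only [smul_eq_mul, flip_innerₗ] at this
  have h2 : ∀ x, VectorFourier.fourierIntegral Real.fourierChar volume (innerₗ ℝ) (fun x => ψ x) x = 𝓕 ψ x := by
    intro x
    rw [SchwartzMap.fourier_coe]; rfl
  simp only [h2] at this
  exact this.symm

lemma fourier_fourier_schwartz (ψ : 𝓢(ℝ, ℂ)) (x : ℝ) : 𝓕 (𝓕 ψ) x = ψ (-x) := by
  have h : 𝓕⁻ (𝓕 ψ) (-x) = ψ (-x) := by simp
  rw [SchwartzMap.fourierInv_coe, Real.fourierInv_eq_fourier_neg, neg_neg] at h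
  rw [SchwartzMap.fourier_coe]
  exact h

lemma memLp_comp_neg {u : ℝ → ℂ} {p : ℝ≥0∞} (hu : MemLp u p volume) :
    MemLp (fun x => u (-x)) p volume :=
  hu.comp_measurePreserving (Measure.measurePreserving_neg volume)

lemma memLp_comp_add {u : ℝ → ℂ} {p : ℝ≥0∞} (hu : MemLp u p volume) (η : ℝ) :
    MemLp (fun x => u (x + η)) p volume :=
  hu.comp_measurePreserving (measurePreserving_add_right volume η)

/-- Comes from 𝓕𝓕ψ = ψ(−·) on test functions. It transfers every rule between the physical and the
Fourier side. -/
lemma IsFT.swap {u U : ℝ → ℂ} (h : IsFT u U) : IsFT U (fun x => u (-x)) := by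
  refine ⟨h.right, memLp_comp_neg h.left, fun ψ => ?_⟩
  rw [h.eq, ← integral_neg_eq_self]
  simp [fourier_fourier_schwartz]

lemma IsFT.comp_neg {u U : ℝ → ℂ} (h : IsFT u U) : IsFT (fun x => u (-x)) (fun x => U (-x)) :=
  h.swap.swap

lemma isFT_schwartz (ψ : 𝓢(ℝ, ℂ)) : IsFT (fun x => ψ x) (fun x => 𝓕 ψ x) := by
  rw [SchwartzMap.fourier_coe]
  exact isFT_fourierIntegral ψ.integrable (schwartz_memLp ψ)

lemma memLp_conj {u : ℝ → ℂ} {p : ℝ≥0∞} (hu : MemLp u p volume) :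
    MemLp (fun x => (starRingEnd ℂ) (u x)) p volume :=
  hu.star

lemma IsFT.conj {u U : ℝ → ℂ} (h : IsFT u U) :
    IsFT (fun x => (starRingEnd ℂ) (u x)) (fun x => (starRingEnd ℂ) (U (-x))) := by
  refine ⟨memLp_conj h.left, memLp_conj (memLp_comp_neg h.right), fun ψ => ?_⟩
  rw [h.plancherel (isFT_schwartz ψ).swap, ← integral_neg_eq_self]
  simp

/-- The bilinear form of Plancherel's identity. -/
lemma IsFT.integral_mul {u U v V : ℝ → ℂ} (h : IsFT u U) (h' : IsFT v V) :
    ∫ x, u x * v x = ∫ x, U (-x) * V x := by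
  have := h.conj.plancherel h'
  simpa using this

lemma IsFT.translate {u U : ℝ → ℂ} (h : IsFT u U) (η : ℝ) :
    IsFT (fun x => u (x + η)) (fun ξ => Complex.exp (2 * Real.pi * Complex.I * η * ξ) * U ξ) := by
  have hm : ∀ η : ℝ, Continuous fun ξ : ℝ => Complex.exp (2 * Real.pi * Complex.I * η * ξ) := by
    intro η; fun_prop
  have hn : ∀ η ξ : ℝ, ‖Complex.exp (2 * Real.pi * Complex.I * η * ξ)‖ = 1 := by
    intro η ξ
    rw [Complex.norm_exp]; simp
  have hmul : ∀ (η : ℝ) {V : ℝ → ℂ}, MemLp V 2 volume →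
      MemLp (fun ξ : ℝ => Complex.exp (2 * Real.pi * Complex.I * η * ξ) * V ξ) 2 volume := by
    intro η V hV
    refine hV.of_le_mul (c := 1) ((hm η).aestronglyMeasurable.mul hV.1) ?_
    filter_upwards with ξ
    rw [norm_mul, hn]
  refine ⟨memLp_comp_add h.left η, hmul η h.right, fun ψ => ?_⟩
  have h1 : IsFT (fun x => 𝓕 ψ (x + -η))
      (fun ξ => Complex.exp (2 * Real.pi * Complex.I * (-η) * ξ) * ψ (-ξ)) := by
    have hi : Integrable (fun x => 𝓕 ψ (x + -η)) volume :=
      (𝓕 ψ).integrable.comp_add_right (-η)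
    have h2 := isFT_fourierIntegral hi (memLp_comp_add (schwartz_memLp (𝓕 ψ)) (-η))
    convert h2 using 1
    have h3 := VectorFourier.fourierIntegral_comp_add_right Real.fourierChar volume (innerₗ ℝ)
      (fun x => 𝓕 ψ x) (-η)
    funext ξ
    have h4 := congrFun h3 ξ
    rw [← fourier_fourier_schwartz ψ ξ]
    refine Eq.trans ?_ h4.symm
    rw [Circle.smul_def, Real.fourierChar_apply, SchwartzMap.fourier_coe (𝓕 ψ), smul_eq_mul]
    congr 2
    simp
    ring
  have h2 : ∫ x, u (x + η) * 𝓕 ψ x = ∫ x, u x * 𝓕 ψ (x + -η) := by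
    rw [← integral_add_right_eq_self (μ := volume) (fun x => u x * 𝓕 ψ (x + -η)) η]
    simp
  rw [h2, h.integral_mul h1, ← integral_neg_eq_self]
  congr 1
  funext ξ
  simp
  ring

/-- The half-lines contribute F(0) and −F(0), which cancel because `F` is continuous at the origin.
So an undefined derivative there is harmless, whereas a jump would not be. -/
lemma integral_deriv_eq_zero {F F' : ℝ → ℂ} (hc : Continuous F)
    (hd : ∀ x ≠ 0, HasDerivAt F (F' x) x) (hF : Integrable F volume) (hF' : Integrable F' volume) :
    ∫ x, F' x = 0 := by
  have ht : Tendsto F atTop (𝓝 0) :=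
    tendsto_zero_of_hasDerivAt_of_integrableOn_Ioi (a := 0)
      (fun x hx => hd x (ne_of_gt hx)) hF'.integrableOn hF.integrableOn
  have hb : Tendsto F atBot (𝓝 0) :=
    tendsto_zero_of_hasDerivAt_of_integrableOn_Iic (a := -1)
      (fun x hx => hd x (by rintro rfl; norm_num at hx)) hF'.integrableOn hF.integrableOn
  have h1 := integral_Ioi_of_hasDerivAt_of_tendsto (a := 0) hc.continuousWithinAt
    (fun x hx => hd x (ne_of_gt hx)) hF'.integrableOn ht
  have h2 := integral_Iic_of_hasDerivAt_of_tendsto (a := 0) hc.continuousWithinAt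
    (fun x hx => hd x (ne_of_lt hx)) hF'.integrableOn hb
  have h3 := intervalIntegral.integral_Iic_add_Ioi (b := (0 : ℝ)) (μ := volume) (f := F')
    hF'.integrableOn hF'.integrableOn
  rw [← h3, h1, h2]; ring

/-- Multiplication by `x` corresponds to differentiation on the Fourier side; one exceptional
point is allowed. -/
lemma IsFT.mul_id {u U U' : ℝ → ℂ} (h : IsFT u U) (hc : Continuous U)
    (hd : ∀ x ≠ 0, HasDerivAt U (U' x) x) (hU' : MemLp U' 2 volume) :
    IsFT (fun x => x * u x) (fun ξ => Complex.I / (2 * Real.pi) * U' ξ) := by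
  obtain ⟨v, hv⟩ := exists_isFT_inv (hU'.const_mul (Complex.I / (2 * Real.pi)))
  refine hv.congr_left ?_
  have hloc : LocallyIntegrable (fun x : ℝ => (x : ℂ) * u x) volume := by
    exact (h.left.locallyIntegrable (by norm_num)).continuous_mul Complex.continuous_ofReal
  apply ae_eq_of_test_fourier (hv.left.locallyIntegrable (by norm_num)) hloc
  intro ψ
  have h0 : ∫ x, (U' x * ψ x + U x * deriv ψ x) = 0 := by
    have hF : Integrable (fun x => U x * ψ x) volume :=
      integrable_mul_of_memLp h.right (schwartz_memLp ψ)
    have hF' : Integrable (fun x => U' x * ψ x + U x * deriv ψ x) volume :=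
      (integrable_mul_of_memLp hU' (schwartz_memLp ψ)).add
        (integrable_mul_of_memLp h.right (schwartz_memLp (SchwartzMap.derivCLM ℂ ℂ ψ)))
    exact integral_deriv_eq_zero (hc.mul ψ.continuous)
      (fun x hx => (hd x hx).mul (ψ.hasDerivAt x)) hF hF'
  rw [integral_add (integrable_mul_of_memLp hU' (schwartz_memLp ψ))
    (by exact integrable_mul_of_memLp h.right (schwartz_memLp (SchwartzMap.derivCLM ℂ ℂ ψ)))] at h0
  have h1 : ∫ x, U x * deriv ψ x = ∫ x, u x * (2 * Real.pi * Complex.I * x * 𝓕 ψ x) := by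
    have := h.eq (SchwartzMap.derivCLM ℂ ℂ ψ)
    simp only [SchwartzMap.derivCLM_apply] at this
    rw [this]
    congr 1
    funext x
    rw [SchwartzMap.fourier_coe, SchwartzMap.fourier_coe]
    have h2 := Real.fourier_deriv ψ.integrable ψ.differentiable
      (SchwartzMap.derivCLM ℂ ℂ ψ).integrable
    exact congrArg (u x * ·) (congrFun h2 x)
  rw [← hv.eq]
  simp only [mul_assoc, integral_const_mul]
  rw [eq_neg_of_add_eq_zero_left h0, h1, ← integral_neg, ← integral_const_mul]
  congr 1
  funext x
  have : (Real.pi : ℂ) ≠ 0 := by exact_mod_cast Real.pi_ne_zero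
  field_simp
  simp [Complex.I_sq]

/-- Differentiation corresponds to multiplication by `2πiξ` on the Fourier side. -/
lemma IsFT.deriv {u u' U : ℝ → ℂ} (h : IsFT u U) (hc : Continuous u)
    (hd : ∀ x ≠ 0, HasDerivAt u (u' x) x) (hu' : MemLp u' 2 volume) :
    IsFT u' (fun ξ => 2 * Real.pi * Complex.I * ξ * U ξ) := by
  -- The reflection of `U` has transform `u`; the rule `mul_id` for this pair, swapped back, is the
  -- claim.
  have h1 := ((h.comp_neg.swap.congr_right
    (V := u) (by simp)).mul_id hc hd hu').swap.const_mul (-(2 * Real.pi * Complex.I))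
  have : (Real.pi : ℂ) ≠ 0 := by exact_mod_cast Real.pi_ne_zero
  refine h1.congr ?_ ?_
  · filter_upwards with x
    field_simp
    simp [Complex.I_sq]
  · filter_upwards with x
    simp [mul_assoc]

/-! ### Functions with one weak derivative in L², through their translations. -/

/-- The translations of `u` are Lipschitz continuous in `L²`. -/
def TransLip (u : ℝ → ℂ) : Prop :=
  ∃ C : ℝ, 0 ≤ C ∧ ∀ η : ℝ, eLpNorm (fun x => u (x + η) - u x) 2 volume ≤ ENNReal.ofReal (C * |η|)

lemma norm_exp_sub_one_le (η ξ : ℝ) :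
    ‖Complex.exp (2 * Real.pi * Complex.I * η * ξ) - 1‖ ≤ 2 * Real.pi * |η| * |ξ| := by
  have := Real.norm_exp_I_mul_ofReal_sub_one_le (x := 2 * Real.pi * η * ξ)
  have h2 : Complex.I * ((2 * Real.pi * η * ξ : ℝ) : ℂ) = 2 * Real.pi * Complex.I * η * ξ := by
    push_cast; ring
  rw [h2] at this
  refine this.trans (le_of_eq ?_)
  rw [Real.norm_eq_abs, abs_mul, abs_mul, abs_of_pos (by positivity)]

lemma IsFT.transLip {u U : ℝ → ℂ} (h : IsFT u U)
    (hU : MemLp (fun ξ : ℝ => (ξ : ℂ) * U ξ) 2 volume) : TransLip u := by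
  refine ⟨2 * Real.pi * (eLpNorm (fun ξ : ℝ => (ξ : ℂ) * U ξ) 2 volume).toReal, by positivity,
    fun η => ?_⟩
  rw [((h.translate η).sub h).eLpNorm_eq]
  have : eLpNorm (fun ξ : ℝ => Complex.exp (2 * Real.pi * Complex.I * η * ξ) * U ξ - U ξ) 2 volume
      ≤ ENNReal.ofReal (2 * Real.pi * |η|) * eLpNorm (fun ξ : ℝ => (ξ : ℂ) * U ξ) 2 volume := by
    apply eLpNorm_le_mul_eLpNorm_of_ae_le_mul
    filter_upwards with ξ
    rw [← sub_one_mul, norm_mul, norm_mul, Complex.norm_real, Real.norm_eq_abs, ← mul_assoc]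
    gcongr
    exact norm_exp_sub_one_le η ξ
  refine this.trans (le_of_eq ?_)
  conv_lhs => rw [← ENNReal.ofReal_toReal hU.eLpNorm_ne_top]
  rw [← ENNReal.ofReal_mul (by positivity)]
  congr 1; ring

/-- Fatou's lemma: the transforms of the difference quotients with step 1/(n+1) converge pointwise
to 2πiξU, and their L² norms are bounded by the Lipschitz constant. -/
lemma IsFT.memLp_of_transLip {u U : ℝ → ℂ} (h : IsFT u U) (hu : TransLip u) :
    MemLp (fun ξ : ℝ => (ξ : ℂ) * U ξ) 2 volume := by
  obtain ⟨C, hC, hu⟩ := hu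
  set F : ℕ → ℝ → ℂ := fun n ξ => ((n : ℂ) + 1) *
    (Complex.exp (2 * Real.pi * Complex.I * ((1 / ((n : ℝ) + 1) : ℝ) : ℂ) * ξ) * U ξ - U ξ) with hF
  have hmeas : ∀ n, AEStronglyMeasurable (F n) volume := fun n =>
    ((((h.translate (1 / ((n : ℝ) + 1))).sub h).right).const_mul _).1
  have hlim : ∀ ξ : ℝ, Tendsto (fun n => F n ξ) atTop (𝓝 (2 * Real.pi * Complex.I * ξ * U ξ)) := by
    intro ξ
    have hd : HasDerivAt (fun t : ℝ => Complex.exp (2 * Real.pi * Complex.I * t * ξ))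
        (2 * Real.pi * Complex.I * ξ) 0 := by
      have h1 : HasDerivAt (fun t : ℝ => 2 * Real.pi * Complex.I * (t : ℂ) * ξ)
          (2 * Real.pi * Complex.I * ξ) 0 := by
        have := ((Complex.ofRealCLM.hasDerivAt (x := (0 : ℝ))).const_mul
          (2 * Real.pi * Complex.I)).mul_const (ξ : ℂ)
        simpa using this
      simpa using h1.cexp
    have h2 := hd.tendsto_slope_zero.comp
      (f := fun n : ℕ => 1 / ((n : ℝ) + 1)) (x := atTop) ?_
    · have h3 := h2.mul_const (U ξ)
      refine h3.congr fun n => ?_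
      simp [hF, sub_mul, mul_sub, mul_assoc]
    · rw [tendsto_nhdsWithin_iff]
      refine ⟨tendsto_one_div_add_atTop_nhds_zero_nat, ?_⟩
      filter_upwards with n
      simp only [Set.mem_compl_iff, Set.mem_singleton_iff]
      positivity
  have hb : ∀ n, eLpNorm (F n) 2 volume ≤ ENNReal.ofReal C := by
    intro n
    have h1 := hu (1 / ((n : ℝ) + 1))
    rw [((h.translate _).sub h).eLpNorm_eq] at h1
    have h2 : eLpNorm (F n) 2 volume = ENNReal.ofReal ((n : ℝ) + 1) * eLpNorm (fun ξ : ℝ =>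
      Complex.exp (2 * Real.pi * Complex.I * ((1 / ((n : ℝ) + 1) : ℝ) : ℂ) * ξ) * U ξ - U ξ)
        2 volume := by
      have := eLpNorm_const_smul (p := 2) (μ := (volume : Measure ℝ)) ((n : ℂ) + 1) (fun ξ : ℝ =>
        Complex.exp (2 * Real.pi * Complex.I * ((1 / ((n : ℝ) + 1) : ℝ) : ℂ) * ξ) * U ξ - U ξ)
      refine Eq.trans this ?_
      congr 1
      rw [← ofReal_norm]
      congr 1
      have : ((n : ℂ) + 1) = ((n + 1 : ℝ) : ℂ) := by push_cast; rfl
      rw [this, Complex.norm_real, Real.norm_of_nonneg (by positivity)]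
    rw [h2]
    refine (mul_le_mul_right h1 _).trans ?_
    rw [← ENNReal.ofReal_mul (by positivity)]
    apply ENNReal.ofReal_le_ofReal
    rw [abs_of_pos (by positivity)]
    apply le_of_eq
    field_simp
  have hle := Lp.eLpNorm_lim_le_liminf_eLpNorm (p := 2) hmeas
    (fun ξ => 2 * Real.pi * Complex.I * ξ * U ξ) (Eventually.of_forall hlim)
  have hfin : eLpNorm (fun ξ : ℝ => 2 * Real.pi * Complex.I * ξ * U ξ) 2 volume < ⊤ := by
    refine (hle.trans ?_).trans_lt (ENNReal.ofReal_lt_top (r := C))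
    exact (liminf_le_liminf (Eventually.of_forall hb)).trans (by simp)
  have hm : MemLp (fun ξ : ℝ => 2 * Real.pi * Complex.I * ξ * U ξ) 2 volume :=
    ⟨by
      have : Continuous fun ξ : ℝ => 2 * Real.pi * Complex.I * (ξ : ℂ) := by fun_prop
      exact this.aestronglyMeasurable.mul h.right.1, hfin⟩
  have := hm.const_mul (1 / (2 * Real.pi * Complex.I))
  refine this.ae_eq ?_
  filter_upwards with ξ
  have : (Real.pi : ℂ) ≠ 0 := by exact_mod_cast Real.pi_ne_zero
  field_simp

/-! ### Symbols that are smooth away from the origin. -/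

/-- Pointwise bound of order `s` at infinity. -/
def OrderLE (s : ℤ) (a : ℝ → ℂ) : Prop := ∃ C : ℝ, 0 ≤ C ∧ ∀ ξ, ‖a ξ‖ ≤ C * (1 + |ξ|) ^ s

/-- Symbols of order `s`, smooth away from the origin: `M` derivatives are controlled, each of them
lowering the order by one, and the first `N` of them (starting with `a` itself) are continuous. -/
def Sym : ℕ → ℕ → ℤ → (ℝ → ℂ) → Prop
  | 0, N, s, a => Measurable a ∧ (N ≠ 0 → Continuous a) ∧ OrderLE s a
  | M + 1, N, s, a => (Measurable a ∧ (N ≠ 0 → Continuous a) ∧ OrderLE s a) ∧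
      ∃ a' : ℝ → ℂ, (∀ ξ ≠ 0, HasDerivAt a (a' ξ) ξ) ∧ Sym M (N - 1) (s - 1) a'

lemma one_le_one_add_abs (ξ : ℝ) : 1 ≤ 1 + |ξ| := by linarith [abs_nonneg ξ]

lemma one_add_abs_pos (ξ : ℝ) : 0 < 1 + |ξ| := by linarith [abs_nonneg ξ]

lemma OrderLE.mono {s t : ℤ} {a : ℝ → ℂ} (h : OrderLE s a) (hst : s ≤ t) : OrderLE t a := by
  obtain ⟨C, hC, h⟩ := h
  refine ⟨C, hC, fun ξ => (h ξ).trans ?_⟩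
  gcongr
  exact one_le_one_add_abs ξ

lemma OrderLE.add {s : ℤ} {a b : ℝ → ℂ} (ha : OrderLE s a) (hb : OrderLE s b) :
    OrderLE s (fun ξ => a ξ + b ξ) := by
  obtain ⟨C, hC, ha⟩ := ha
  obtain ⟨C', hC', hb⟩ := hb
  refine ⟨C + C', by positivity, fun ξ => (norm_add_le _ _).trans ?_⟩
  rw [add_mul]
  exact add_le_add (ha ξ) (hb ξ)

lemma OrderLE.mul {s t : ℤ} {a b : ℝ → ℂ} (ha : OrderLE s a) (hb : OrderLE t b) :
    OrderLE (s + t) (fun ξ => a ξ * b ξ) := by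
  obtain ⟨C, hC, ha⟩ := ha
  obtain ⟨C', hC', hb⟩ := hb
  refine ⟨C * C', by positivity, fun ξ => ?_⟩
  have := one_add_abs_pos ξ
  rw [norm_mul, zpow_add₀ this.ne', mul_mul_mul_comm]
  exact mul_le_mul (ha ξ) (hb ξ) (norm_nonneg _) (by positivity)

lemma Sym.basic {M N : ℕ} {s : ℤ} {a : ℝ → ℂ} (h : Sym M N s a) :
    Measurable a ∧ (N ≠ 0 → Continuous a) ∧ OrderLE s a := by
  cases M with
  | zero => exact h
  | succ M => exact h.1

lemma Sym.mono {M N M' N' : ℕ} {s s' : ℤ} {a : ℝ → ℂ} (h : Sym M N s a) (hM : M' ≤ M)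
    (hN : N' ≤ N) (hs : s ≤ s') : Sym M' N' s' a := by
  induction M generalizing N N' M' s s' a with
  | zero =>
    obtain rfl : M' = 0 := by omega
    exact ⟨h.1, fun h0 => h.2.1 (by omega), h.2.2.mono hs⟩
  | succ M ih =>
    have hb : Measurable a ∧ (N' ≠ 0 → Continuous a) ∧ OrderLE s' a :=
      ⟨h.1.1, fun h0 => h.1.2.1 (by omega), h.1.2.2.mono hs⟩
    cases M' with
    | zero => exact hb
    | succ M' =>
      obtain ⟨a', hd, ha'⟩ := h.2
      exact ⟨hb, a', hd, ih ha' (by omega) (by omega) (by omega)⟩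

lemma Sym.add {M N : ℕ} {s : ℤ} {a b : ℝ → ℂ} (ha : Sym M N s a) (hb : Sym M N s b) :
    Sym M N s (fun ξ => a ξ + b ξ) := by
  have h0 : Measurable (fun ξ => a ξ + b ξ) ∧ (N ≠ 0 → Continuous (fun ξ => a ξ + b ξ)) ∧
      OrderLE s (fun ξ => a ξ + b ξ) :=
    ⟨ha.basic.1.add hb.basic.1, fun h => (ha.basic.2.1 h).add (hb.basic.2.1 h),
      ha.basic.2.2.add hb.basic.2.2⟩
  induction M generalizing N s a b with
  | zero => exact h0
  | succ M ih =>
    obtain ⟨a', hda, ha'⟩ := ha.2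
    obtain ⟨b', hdb, hb'⟩ := hb.2
    refine ⟨h0, _, fun ξ hξ => (hda ξ hξ).add (hdb ξ hξ), ih ha' hb' ?_⟩
    exact ⟨ha'.basic.1.add hb'.basic.1, fun h => (ha'.basic.2.1 h).add (hb'.basic.2.1 h),
      ha'.basic.2.2.add hb'.basic.2.2⟩

lemma Sym.mul {M N : ℕ} {s t : ℤ} {a b : ℝ → ℂ} (ha : Sym M N s a) (hb : Sym M N t b) :
    Sym M N (s + t) (fun ξ => a ξ * b ξ) := by
  induction M generalizing N s t a b with
  | zero =>
    exact ⟨ha.1.mul hb.1, fun h => (ha.2.1 h).mul (hb.2.1 h), ha.2.2.mul hb.2.2⟩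
  | succ M ih =>
    have ha0 := ha.basic
    have hb0 := hb.basic
    obtain ⟨a', hda, ha'⟩ := ha.2
    obtain ⟨b', hdb, hb'⟩ := hb.2
    refine ⟨⟨ha0.1.mul hb0.1, fun h => (ha0.2.1 h).mul (hb0.2.1 h), ha0.2.2.mul hb0.2.2⟩, _,
      fun ξ hξ => (hda ξ hξ).mul (hdb ξ hξ), ?_⟩
    exact ((ih ha' (hb.mono (Nat.le_succ M) (Nat.sub_le N 1) le_rfl)).mono le_rfl le_rfl
      (by omega)).add ((ih (ha.mono (Nat.le_succ M) (Nat.sub_le N 1) le_rfl) hb').mono le_rfl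
      le_rfl (by omega))

lemma sym_zero (M N : ℕ) (s : ℤ) : Sym M N s (fun _ => 0) := by
  have h0 : ∀ N s, Measurable (fun _ : ℝ => (0 : ℂ)) ∧ (N ≠ 0 → Continuous fun _ : ℝ => (0 : ℂ)) ∧
      OrderLE s (fun _ => 0) := fun N s =>
    ⟨measurable_const, fun _ => continuous_const, 0, le_rfl, by simp⟩
  induction M generalizing N s with
  | zero => exact h0 N s
  | succ M ih => exact ⟨h0 N s, _, fun ξ _ => hasDerivAt_const ξ 0, ih _ _⟩

lemma sym_const (M N : ℕ) (c : ℂ) : Sym M N 0 (fun _ => c) := by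
  have h0 : Measurable (fun _ : ℝ => c) ∧ (N ≠ 0 → Continuous fun _ : ℝ => c) ∧
      OrderLE 0 (fun _ => c) :=
    ⟨measurable_const, fun _ => continuous_const, ‖c‖, norm_nonneg _, by simp⟩
  cases M with
  | zero => exact h0
  | succ M => exact ⟨h0, _, fun ξ _ => hasDerivAt_const ξ c, sym_zero _ _ _⟩

lemma Sym.const_mul {M N : ℕ} {s : ℤ} {a : ℝ → ℂ} (h : Sym M N s a) (c : ℂ) :
    Sym M N s (fun ξ => c * a ξ) := by
  simpa using (sym_const M N c).mul h

lemma sym_sign (M : ℕ) : Sym M 0 0 (fun ξ => ((SignType.sign ξ : ℝ) : ℂ)) := by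
  have h0 : Measurable (fun ξ : ℝ => ((SignType.sign ξ : ℝ) : ℂ)) ∧
      (0 ≠ 0 → Continuous fun ξ : ℝ => ((SignType.sign ξ : ℝ) : ℂ)) ∧
      OrderLE 0 (fun ξ => ((SignType.sign ξ : ℝ) : ℂ)) := by
    refine ⟨?_, fun h => absurd rfl h, 1, zero_le_one, fun ξ => ?_⟩
    · have : (fun ξ : ℝ => ((SignType.sign ξ : ℝ) : ℂ)) = fun ξ =>
          if 0 < ξ then 1 else if ξ < 0 then -1 else 0 := by
        funext ξ
        rw [sign_apply]
        split_ifs <;> simp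
      rw [this]
      exact Measurable.ite measurableSet_Ioi measurable_const
        (Measurable.ite measurableSet_Iio measurable_const measurable_const)
    · rcases lt_trichotomy ξ 0 with h | h | h <;> simp [h]
  cases M with
  | zero => exact h0
  | succ M =>
    refine ⟨h0, fun _ => 0, fun ξ hξ => ?_, sym_zero _ _ _⟩
    rcases lt_or_gt_of_ne hξ with h | h
    · refine (hasDerivAt_const ξ (-1 : ℂ)).congr_of_eventuallyEq ?_
      filter_upwards [Iio_mem_nhds h] with x hx
      rw [sign_neg hx]; simp
    · refine (hasDerivAt_const ξ (1 : ℂ)).congr_of_eventuallyEq ?_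
      filter_upwards [Ioi_mem_nhds h] with x hx
      rw [sign_pos hx]; simp

lemma orderLE_id : OrderLE 1 (fun ξ : ℝ => (ξ : ℂ)) :=
  ⟨1, zero_le_one, fun ξ => by simp⟩

/-- Multiplication by `ξ` gains one continuous derivative. -/
lemma Sym.id_mul {M N : ℕ} {s : ℤ} {a : ℝ → ℂ} (h : Sym (M + 1) N s a) :
    Sym M (N + 1) (s + 1) (fun ξ => (ξ : ℂ) * a ξ) := by
  have h0 : ∀ {M N : ℕ} {s : ℤ} {a : ℝ → ℂ}, Sym (M + 1) N s a →
      Measurable (fun ξ : ℝ => (ξ : ℂ) * a ξ) ∧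
      (N + 1 ≠ 0 → Continuous fun ξ : ℝ => (ξ : ℂ) * a ξ) ∧
      OrderLE (s + 1) (fun ξ => (ξ : ℂ) * a ξ) := by
    intro M N s a h
    refine ⟨Complex.measurable_ofReal.mul h.basic.1, fun _ => ?_, ?_⟩
    · obtain ⟨a', hd, -⟩ := h.2
      rw [continuous_iff_continuousAt]
      intro ξ
      -- At the origin `a` may jump, but it is bounded nearby and the factor ξ removes the jump.
      by_cases hξ : ξ = 0
      · subst hξ
        obtain ⟨C, hC, hb⟩ := h.basic.2.2
        have hc : Continuous fun ξ : ℝ => |ξ| * (C * (1 + |ξ|) ^ s) := by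
          have : Continuous fun ξ : ℝ => (1 + |ξ|) ^ s :=
            Continuous.zpow₀ (by fun_prop) s fun ξ => Or.inl (one_add_abs_pos ξ).ne'
          fun_prop
        have ht : Tendsto (fun ξ : ℝ => |ξ| * (C * (1 + |ξ|) ^ s)) (𝓝 0) (𝓝 0) := by
          have := hc.tendsto 0
          simpa using this
        rw [ContinuousAt]
        simp only [Complex.ofReal_zero, zero_mul]
        refine squeeze_zero_norm (fun ξ => ?_) ht
        rw [norm_mul, Complex.norm_real, Real.norm_eq_abs]
        exact mul_le_mul_of_nonneg_left (hb ξ) (abs_nonneg _)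
      · exact Complex.continuous_ofReal.continuousAt.mul (hd ξ hξ).continuousAt
    · have := orderLE_id.mul h.basic.2.2
      rwa [add_comm] at this
  induction M generalizing N s a with
  | zero => exact h0 h
  | succ M ih =>
    obtain ⟨a', hd, ha'⟩ := h.2
    refine ⟨h0 h, fun ξ => a ξ + ξ * a' ξ, fun ξ hξ => ?_, ?_⟩
    · have h1 : HasDerivAt (fun ξ : ℝ => (ξ : ℂ)) 1 ξ := Complex.ofRealCLM.hasDerivAt
      have h2 := h1.mul (hd ξ hξ)
      rw [one_mul] at h2
      exact h2
    · exact (h.mono (by omega) (by omega) (by omega)).add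
        ((ih ha').mono le_rfl (by omega) (by omega))

lemma sym_id (M N : ℕ) : Sym M N 1 (fun ξ => (ξ : ℂ)) := by
  have := (sym_const (M + 1) N 1).id_mul
  simpa using this.mono le_rfl (Nat.le_succ N) le_rfl

lemma Sym.id_pow_mul {N : ℕ} {s : ℤ} {a : ℝ → ℂ} (h : ∀ M, Sym M N s a) (k M : ℕ) :
    Sym M (N + k) (s + k) (fun ξ => (ξ : ℂ) ^ k * a ξ) := by
  induction k generalizing M with
  | zero => simpa using h M
  | succ k ih =>
    have := (ih (M + 1)).id_mul
    simp only [pow_succ', mul_assoc]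
    exact this.mono le_rfl (by omega) (by push_cast; omega)

/-- Induction through (1/a)' = −a'/a², whose order is (s − 1) − 2s = −s − 1. -/
lemma Sym.inv {M N : ℕ} {s : ℤ} {a : ℝ → ℂ} (h : Sym M N s a) (h0 : ∀ ξ, a ξ ≠ 0)
    (hb : OrderLE (-s) (fun ξ => (a ξ)⁻¹)) : Sym M N (-s) (fun ξ => (a ξ)⁻¹) := by
  induction M generalizing N with
  | zero => exact ⟨h.1.inv, fun hN => (h.2.1 hN).inv₀ h0, hb⟩
  | succ M ih =>
    refine ⟨⟨h.basic.1.inv, fun hN => (h.basic.2.1 hN).inv₀ h0, hb⟩, ?_⟩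
    have h1 : Sym M (N - 1) (-s) (fun ξ => (a ξ)⁻¹) :=
      ih (h.mono (Nat.le_succ M) (Nat.sub_le N 1) le_rfl)
    obtain ⟨a', hd, ha'⟩ := h.2
    refine ⟨fun ξ => (-1) * a' ξ * ((a ξ)⁻¹ * (a ξ)⁻¹), fun ξ hξ => ?_, ?_⟩
    · have h2 := (hd ξ hξ).fun_inv (h0 ξ)
      rw [show -a' ξ / a ξ ^ 2 = (-1) * a' ξ * ((a ξ)⁻¹ * (a ξ)⁻¹) by ring] at h2
      exact h2
    · exact ((ha'.const_mul (-1)).mul (h1.mul h1)).mono le_rfl le_rfl (by omega)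

/-! ### Weighted L² spaces and derivatives on the Fourier side. -/

/-- Membership in `L²` with the weight `(1 + |ξ|) ^ s`. -/
def WL2 (s : ℕ) (H : ℝ → ℂ) : Prop :=
  MemLp (fun ξ : ℝ => (((1 + |ξ|) ^ s : ℝ) : ℂ) * H ξ) 2 volume

/-- `N` derivatives of `H`, taken away from the origin, lie in the weighted space `WL2 s`, and all
of them but the last one are continuous. -/
def Chain (s : ℕ) : ℕ → (ℝ → ℂ) → Prop
  | 0, H => WL2 s H
  | N + 1, H => WL2 s H ∧ Continuous H ∧
      ∃ H' : ℝ → ℂ, (∀ ξ ≠ 0, HasDerivAt H (H' ξ) ξ) ∧ Chain s N H'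

lemma Chain.wl2 {s N : ℕ} {H : ℝ → ℂ} (h : Chain s N H) : WL2 s H := by
  cases N with
  | zero => exact h
  | succ N => exact h.1

lemma weight_ne_zero (s : ℕ) (ξ : ℝ) : (((1 + |ξ|) ^ s : ℝ) : ℂ) ≠ 0 := by
  have := one_add_abs_pos ξ
  exact_mod_cast (pow_pos this s).ne'

lemma norm_weight (s : ℕ) (ξ : ℝ) : ‖(((1 + |ξ|) ^ s : ℝ) : ℂ)‖ = (1 + |ξ|) ^ s := by
  have := one_add_abs_pos ξ
  rw [Complex.norm_real, Real.norm_of_nonneg (by positivity)]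

lemma WL2.aestronglyMeasurable {s : ℕ} {H : ℝ → ℂ} (h : WL2 s H) :
    AEStronglyMeasurable H volume := by
  have hc : Continuous fun ξ : ℝ => ((((1 + |ξ|) ^ s : ℝ) : ℂ))⁻¹ :=
    Continuous.inv₀ (by fun_prop) (weight_ne_zero s)
  refine (hc.aestronglyMeasurable.mul h.1).congr ?_
  filter_upwards with ξ
  simp only [Pi.mul_apply]
  rw [inv_mul_cancel_left₀ (weight_ne_zero s ξ)]

lemma WL2.of_le {s t : ℕ} {H G : ℝ → ℂ} (h : WL2 s H) (hG : AEStronglyMeasurable G volume) (C : ℝ)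
    (hb : ∀ᵐ ξ, (1 + |ξ|) ^ t * ‖G ξ‖ ≤ C * ((1 + |ξ|) ^ s * ‖H ξ‖)) : WL2 t G := by
  have hc : Continuous fun ξ : ℝ => ((((1 + |ξ|) ^ t : ℝ) : ℂ)) := by fun_prop
  refine h.of_le_mul (c := C) (hc.aestronglyMeasurable.mul hG) ?_
  filter_upwards [hb] with ξ hξ
  rwa [norm_mul, norm_mul, norm_weight, norm_weight]

lemma WL2.mono {s t : ℕ} {H : ℝ → ℂ} (h : WL2 s H) (hts : t ≤ s) : WL2 t H := by
  refine h.of_le h.aestronglyMeasurable 1 ?_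
  filter_upwards with ξ
  rw [one_mul]
  gcongr
  exact one_le_one_add_abs ξ

lemma WL2.memLp {s : ℕ} {H : ℝ → ℂ} (h : WL2 s H) : MemLp H 2 volume := by
  simpa [WL2] using h.mono (Nat.zero_le s)

lemma wl2_zero_iff {H : ℝ → ℂ} : WL2 0 H ↔ MemLp H 2 volume := by simp [WL2]

lemma WL2.id_mul {s : ℕ} {H : ℝ → ℂ} (h : WL2 (s + 1) H) : WL2 s (fun ξ => (ξ : ℂ) * H ξ) := by
  refine h.of_le (Complex.continuous_ofReal.aestronglyMeasurable.mul h.aestronglyMeasurable) 1 ?_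
  filter_upwards with ξ
  rw [norm_mul, Complex.norm_real, Real.norm_eq_abs, pow_succ, one_mul, mul_assoc]
  have := one_add_abs_pos ξ
  gcongr
  linarith

lemma WL2.of_id_mul {s : ℕ} {H : ℝ → ℂ} (h : WL2 s H) (h' : WL2 s (fun ξ => (ξ : ℂ) * H ξ)) :
    WL2 (s + 1) H := by
  have h1 : MemLp _ 2 volume := h.norm.add h'.norm
  have hc : Continuous fun ξ : ℝ => ((((1 + |ξ|) ^ (s + 1) : ℝ) : ℂ)) := by fun_prop
  refine h1.of_le_mul (c := 1) (hc.aestronglyMeasurable.mul h.aestronglyMeasurable) ?_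
  filter_upwards with ξ
  have := one_add_abs_pos ξ
  simp only [Pi.add_apply]
  rw [norm_mul, norm_mul, norm_mul, norm_mul, norm_weight, norm_weight, Complex.norm_real,
    one_mul, Real.norm_of_nonneg (by positivity), Real.norm_eq_abs]
  apply le_of_eq; ring

lemma WL2.add {s : ℕ} {H G : ℝ → ℂ} (h : WL2 s H) (h' : WL2 s G) :
    WL2 s (fun ξ => H ξ + G ξ) := by
  refine (MemLp.add h h').ae_eq ?_
  filter_upwards with ξ
  simp only [Pi.add_apply, mul_add]

lemma WL2.const_mul {s : ℕ} {H : ℝ → ℂ} (h : WL2 s H) (c : ℂ) : WL2 s (fun ξ => c * H ξ) := by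
  have := MemLp.const_mul h c
  refine this.ae_eq ?_
  filter_upwards with ξ
  ring

lemma memLp_one_add_abs_inv : MemLp (fun ξ : ℝ => (((1 + |ξ|)⁻¹ : ℝ) : ℂ)) 2 volume := by
  have hc : Continuous fun ξ : ℝ => (((1 + |ξ|)⁻¹ : ℝ) : ℂ) :=
    Complex.continuous_ofReal.comp (Continuous.inv₀ (by fun_prop) fun ξ => (one_add_abs_pos ξ).ne')
  rw [← memLp_norm_iff hc.aestronglyMeasurable, memLp_two_iff_integrable_sq hc.norm.aestronglyMeasurable]
  have := integrable_one_add_norm (E := ℝ) (μ := volume) (r := 2) (by simp)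
  refine this.congr ?_
  filter_upwards with ξ
  have := one_add_abs_pos ξ
  rw [Complex.norm_real, Real.norm_eq_abs, Real.norm_eq_abs,
    abs_of_pos (inv_pos.2 this), Real.rpow_neg this.le]
  simp

/-- Cauchy–Schwarz against (1+|ξ|)⁻¹. Sup bounds and continuity are obtained from this: one spare
weight makes a transform integrable. -/
lemma WL2.integrable {H : ℝ → ℂ} (h : WL2 1 H) : Integrable H volume := by
  refine (integrable_mul_of_memLp memLp_one_add_abs_inv h).congr ?_
  filter_upwards with ξ
  have : (((1 + |ξ|) : ℝ) : ℂ) ≠ 0 := by simpa using weight_ne_zero 1 ξ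
  rw [pow_one, Complex.ofReal_inv, inv_mul_cancel_left₀ this]

lemma Chain.mono {s t N N' : ℕ} {H : ℝ → ℂ} (h : Chain s N H) (ht : t ≤ s) (hN : N' ≤ N) :
    Chain t N' H := by
  induction N generalizing N' H with
  | zero =>
    obtain rfl : N' = 0 := by omega
    exact WL2.mono h ht
  | succ N ih =>
    cases N' with
    | zero => exact WL2.mono h.1 ht
    | succ N' =>
      obtain ⟨h1, h2, H', hd, hH'⟩ := h
      exact ⟨h1.mono ht, h2, H', hd, ih hH' (by omega)⟩

lemma Chain.add {s N : ℕ} {H G : ℝ → ℂ} (h : Chain s N H) (h' : Chain s N G) :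
    Chain s N (fun ξ => H ξ + G ξ) := by
  induction N generalizing H G with
  | zero => exact WL2.add h h'
  | succ N ih =>
    obtain ⟨h1, h2, H', hd, hH'⟩ := h
    obtain ⟨g1, g2, G', gd, hG'⟩ := h'
    exact ⟨h1.add g1, h2.add g2, _, fun ξ hξ => (hd ξ hξ).add (gd ξ hξ), ih hH' hG'⟩

lemma Chain.const_mul {s N : ℕ} {H : ℝ → ℂ} (h : Chain s N H) (c : ℂ) :
    Chain s N (fun ξ => c * H ξ) := by
  induction N generalizing H with
  | zero => exact WL2.const_mul h c
  | succ N ih =>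
    obtain ⟨h1, h2, H', hd, hH'⟩ := h
    exact ⟨h1.const_mul c, continuous_const.mul h2, _, fun ξ hξ => (hd ξ hξ).const_mul c, ih hH'⟩

lemma OrderLE.mul_wl2 {s t : ℕ} {σ : ℤ} {a H : ℝ → ℂ} (ha : OrderLE σ a) (hm : Measurable a)
    (h : WL2 s H) (hst : t + σ ≤ s) : WL2 t (fun ξ => a ξ * H ξ) := by
  obtain ⟨C, hC, hb⟩ := ha
  refine h.of_le (hm.aestronglyMeasurable.mul h.aestronglyMeasurable) C ?_
  filter_upwards with ξ
  have h1 := one_add_abs_pos ξ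
  have h2 : (1 + |ξ|) ^ t * (1 + |ξ|) ^ σ ≤ (1 + |ξ|) ^ s := by
    rw [← zpow_natCast, ← zpow_natCast, ← zpow_add₀ h1.ne']
    exact zpow_le_zpow_right₀ (one_le_one_add_abs ξ) hst
  rw [norm_mul]
  calc (1 + |ξ|) ^ t * (‖a ξ‖ * ‖H ξ‖) ≤ (1 + |ξ|) ^ t * ((C * (1 + |ξ|) ^ σ) * ‖H ξ‖) := by
        gcongr; exact hb ξ
    _ = C * (((1 + |ξ|) ^ t * (1 + |ξ|) ^ σ) * ‖H ξ‖) := by ring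
    _ ≤ C * ((1 + |ξ|) ^ s * ‖H ξ‖) := by gcongr

/-- Leibniz rule. A derivative falling on the symbol lowers its order, so the weight t ≤ s − σ
survives at every stage. -/
lemma Sym.mul_chain {s t N : ℕ} {σ : ℤ} {a H : ℝ → ℂ} (ha : Sym N N σ a) (h : Chain s N H)
    (hst : t + σ ≤ s) : Chain t N (fun ξ => a ξ * H ξ) := by
  induction N generalizing σ a H with
  | zero => exact ha.2.2.mul_wl2 ha.1 h hst
  | succ N ih =>
    have h0 := h.wl2
    have hN : Chain s N H := h.mono le_rfl (Nat.le_succ N)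
    obtain ⟨-, h2, H', hd, hH'⟩ := h
    have ha0 := ha.basic
    have haN : Sym N N σ a := ha.mono (Nat.le_succ N) (Nat.le_succ N) le_rfl
    obtain ⟨a', had, ha'⟩ := ha.2
    refine ⟨ha0.2.2.mul_wl2 ha0.1 h0 hst, (ha0.2.1 (by omega)).mul h2, _,
      fun ξ hξ => (had ξ hξ).mul (hd ξ hξ), ?_⟩
    exact (ih (ha'.mono le_rfl (by omega) le_rfl) hN (by omega)).add (ih haN hH' hst)

lemma OrderLE.wl2 {t : ℕ} {σ : ℤ} {a : ℝ → ℂ} (ha : OrderLE σ a) (hm : Measurable a)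
    (hst : t + σ ≤ -1) : WL2 t a := by
  obtain ⟨C, hC, hb⟩ := ha
  have hc : Continuous fun ξ : ℝ => ((((1 + |ξ|) ^ t : ℝ) : ℂ)) := by fun_prop
  refine memLp_one_add_abs_inv.of_le_mul (c := C)
    (hc.aestronglyMeasurable.mul hm.aestronglyMeasurable) ?_
  filter_upwards with ξ
  have h1 := one_add_abs_pos ξ
  rw [norm_mul, norm_weight, Complex.norm_real, Real.norm_of_nonneg (by positivity)]
  have h2 : (1 + |ξ|) ^ t * (1 + |ξ|) ^ σ ≤ (1 + |ξ|)⁻¹ := by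
    rw [← zpow_natCast, ← zpow_add₀ h1.ne', ← zpow_neg_one]
    exact zpow_le_zpow_right₀ (one_le_one_add_abs ξ) hst
  calc (1 + |ξ|) ^ t * ‖a ξ‖ ≤ (1 + |ξ|) ^ t * (C * (1 + |ξ|) ^ σ) := by gcongr; exact hb ξ
    _ = C * ((1 + |ξ|) ^ t * (1 + |ξ|) ^ σ) := by ring
    _ ≤ _ := by gcongr

/-- For symbols of order at most −1, which are themselves square integrable and hence transforms of
kernels. -/
lemma Sym.chain {t N : ℕ} {σ : ℤ} {a : ℝ → ℂ} (ha : Sym N N σ a) (hst : t + σ ≤ -1) :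
    Chain t N a := by
  induction N generalizing σ a with
  | zero => exact ha.2.2.wl2 ha.1 hst
  | succ N ih =>
    have ha0 := ha.basic
    obtain ⟨a', had, ha'⟩ := ha.2
    exact ⟨ha0.2.2.wl2 ha0.1 hst, ha0.2.1 (by omega), _, had,
      ih (ha'.mono le_rfl (by omega) le_rfl) (by omega)⟩

/-- Derivatives on the Fourier side give decay. -/
lemma Chain.isFT_pow {s N : ℕ} {u H : ℝ → ℂ} (h : Chain s N H) (hu : IsFT u H) {j : ℕ}
    (hj : j ≤ N) : ∃ V, IsFT (fun x => (x : ℂ) ^ j * u x) V ∧ Chain s (N - j) V := by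
  induction j generalizing N u H with
  | zero => exact ⟨H, by simpa using hu, h⟩
  | succ j ih =>
    cases N with
    | zero => omega
    | succ N =>
      obtain ⟨h1, h2, H', hd, hH'⟩ := h
      obtain ⟨V, hV, hc⟩ := ih (hH'.const_mul _) (hu.mul_id h2 hd hH'.wl2.memLp) (by omega)
      refine ⟨V, hV.congr_left ?_, by simpa using hc⟩
      filter_upwards with x
      ring

lemma continuous_fourier {u : ℝ → ℂ} (hu : Integrable u volume) : Continuous (𝓕 u) :=
  VectorFourier.fourierIntegral_continuous (μ := volume) (L := innerₗ ℝ)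
    Real.continuous_fourierChar continuous_inner hu

/-- Decay gives derivatives on the Fourier side. -/
lemma chain_fourier {s N : ℕ} {g : ℝ → ℂ}
    (hi : ∀ j ≤ N, Integrable (fun x : ℝ => (x : ℂ) ^ j * g x) volume)
    (h2 : ∀ j ≤ N, WL2 s (𝓕 (fun x : ℝ => (x : ℂ) ^ j * g x))) : Chain s N (𝓕 g) := by
  have h20 : WL2 s (𝓕 g) := by simpa using h2 0 (Nat.zero_le _)
  have hi0 : Integrable g volume := by simpa using hi 0 (Nat.zero_le _)
  induction N generalizing g with
  | zero => exact h20
  | succ N ih =>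
    have hi1 : Integrable (fun x : ℝ => (x : ℂ) * g x) volume := by
      simpa using hi 1 (by omega)
    refine ⟨h20, continuous_fourier hi0, fun ξ => (-2 * Real.pi * Complex.I) *
      𝓕 (fun x : ℝ => (x : ℂ) * g x) ξ, fun ξ _ => ?_, ?_⟩
    · have h3 := Real.hasDerivAt_fourier hi0 (by simpa using hi1) ξ
      have h4 : 𝓕 (fun x : ℝ => (-2 * Real.pi * Complex.I * x) • g x) ξ =
          (-2 * Real.pi * Complex.I) * 𝓕 (fun x : ℝ => (x : ℂ) * g x) ξ := by
        simp only [Real.fourier_real_eq_integral_exp_smul, smul_eq_mul]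
        rw [← integral_const_mul]
        congr 1
        funext x
        ring
      rw [h4] at h3
      exact h3
    · apply Chain.const_mul
      apply ih
      · intro j hj
        refine (hi (j + 1) (by omega)).congr ?_
        filter_upwards with x
        ring
      · intro j hj
        have := h2 (j + 1) (by omega)
        simpa only [pow_succ, mul_assoc] using this
      · simpa using h2 1 (by omega)
      · exact hi1

/-! ### Fourier inversion and the multiplier of the Hilbert transform. -/

/-- Fourier inversion for an `L²` function with integrable Fourier transform. -/
lemma IsFT.ae_eq_fourierInv {u U : ℝ → ℂ} (h : IsFT u U) (hU : Integrable U volume) :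
    u =ᵐ[volume] 𝓕⁻ U := by
  have h1 := h.swap.unique (isFT_fourierIntegral hU h.right)
  have h2 := (Measure.measurePreserving_neg (volume : Measure ℝ)).quasiMeasurePreserving.ae_eq_comp h1
  refine EventuallyEq.trans ?_ (h2.trans ?_)
  · filter_upwards with x
    simp
  · filter_upwards with x
    simp [Real.fourierInv_eq_fourier_neg]

lemma IsFT.memLp_top {u U : ℝ → ℂ} (h : IsFT u U) (hU : Integrable U volume) :
    MemLp u ∞ volume := by
  refine memLp_top_of_bound h.left.1 (∫ ξ, ‖U ξ‖) ?_
  filter_upwards [h.ae_eq_fourierInv hU] with x hx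
  rw [hx, Real.fourierInv_eq_fourier_neg]
  exact VectorFourier.norm_fourierIntegral_le_integral_norm _ _ _ _ _

lemma isFT_fourierInv {U : ℝ → ℂ} (hU : Integrable U volume) (hU2 : MemLp U 2 volume) :
    IsFT (𝓕⁻ U) U := by
  obtain ⟨u, hu⟩ := exists_isFT_inv hU2
  exact hu.congr_left (hu.ae_eq_fourierInv hU)

/-- The multiplier `-i sgn ξ` of the Hilbert transform. -/
noncomputable def hilbertSym (ξ : ℝ) : ℂ := -Complex.I * ((SignType.sign ξ : ℝ) : ℂ)

lemma measurable_hilbertSym : Measurable hilbertSym := (sym_sign 0).1.const_mul _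

lemma norm_hilbertSym_le (ξ : ℝ) : ‖hilbertSym ξ‖ ≤ 1 := by
  rcases lt_trichotomy ξ 0 with h | h | h <;> simp [hilbertSym, h]

/-- The conjugate Poisson kernel. -/
noncomputable def conjPoisson (δ x : ℝ) : ℝ := x / (Real.pi * (x ^ 2 + δ ^ 2))

/-- The Fourier transform of the conjugate Poisson kernel. -/
noncomputable def conjPoissonSym (δ ξ : ℝ) : ℂ :=
  hilbertSym ξ * (Real.exp (-(2 * Real.pi * δ) * |ξ|) : ℂ)

lemma norm_conjPoissonSym_le {δ : ℝ} (ξ : ℝ) :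
    ‖conjPoissonSym δ ξ‖ ≤ Real.exp (-(2 * Real.pi * δ) * |ξ|) := by
  rw [conjPoissonSym, norm_mul, Complex.norm_real, Real.norm_of_nonneg (Real.exp_pos _).le]
  exact mul_le_of_le_one_left (Real.exp_pos _).le (norm_hilbertSym_le ξ)

lemma measurable_conjPoissonSym (δ : ℝ) : Measurable (conjPoissonSym δ) := by
  have : Continuous fun ξ : ℝ => (Real.exp (-(2 * Real.pi * δ) * |ξ|) : ℂ) := by fun_prop
  exact measurable_hilbertSym.mul this.measurable

lemma integrable_exp_neg_mul_abs {a : ℝ} (ha : 0 < a) :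
    Integrable (fun ξ : ℝ => Real.exp (-a * |ξ|)) volume := by
  have h1 : IntegrableOn (fun ξ : ℝ => Real.exp (-a * |ξ|)) (Set.Ioi 0) volume := by
    refine (exp_neg_integrableOn_Ioi 0 ha).congr_fun (fun ξ hξ => ?_) measurableSet_Ioi
    rw [abs_of_pos hξ]
  have h2 : IntegrableOn (fun ξ : ℝ => Real.exp (-a * |ξ|)) (Set.Iic 0) volume := by
    rw [← integrableOn_Ici_iff_integrableOn_Ioi] at h1
    have := h1.comp_neg
    simpa using this
  rw [← integrableOn_univ, ← Set.Iic_union_Ioi (a := (0 : ℝ))]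
  exact h2.union h1

lemma integrable_conjPoissonSym {δ : ℝ} (hδ : 0 < δ) :
    Integrable (conjPoissonSym δ) volume := by
  refine (integrable_exp_neg_mul_abs (a := 2 * Real.pi * δ) (by positivity)).mono'
    (measurable_conjPoissonSym δ).aestronglyMeasurable ?_
  filter_upwards with ξ
  exact norm_conjPoissonSym_le ξ

lemma memLp_conjPoissonSym {δ : ℝ} (hδ : 0 < δ) : MemLp (conjPoissonSym δ) 2 volume := by
  have hm := (measurable_conjPoissonSym δ).aestronglyMeasurable (μ := volume)
  rw [← memLp_norm_iff hm, memLp_two_iff_integrable_sq hm.norm]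
  refine (integrable_conjPoissonSym hδ).norm.mono' (hm.norm.pow 2) ?_
  filter_upwards with ξ
  have h1 : ‖conjPoissonSym δ ξ‖ ≤ 1 := (norm_conjPoissonSym_le ξ).trans (by
    rw [Real.exp_le_one_iff]
    have : 0 ≤ 2 * Real.pi * δ * |ξ| := by positivity
    linarith)
  rw [Real.norm_of_nonneg (by positivity), sq]
  exact mul_le_of_le_one_left (norm_nonneg _) h1

lemma integral_eq_Ioi_add_neg {F : ℝ → ℂ} (hF : Integrable F volume) :
    ∫ x, F x = ∫ x in Set.Ioi 0, (F x + F (-x)) := by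
  rw [← intervalIntegral.integral_Iic_add_Ioi (b := (0 : ℝ)) (μ := volume) (f := F)
    hF.integrableOn hF.integrableOn, integral_add hF.integrableOn hF.comp_neg.integrableOn,
    integral_comp_neg_Ioi, neg_zero, add_comm]

lemma fourierInv_conjPoissonSym {δ : ℝ} (hδ : 0 < δ) (x : ℝ) :
    𝓕⁻ (conjPoissonSym δ) x = conjPoisson δ x := by
  -- After reflecting ξ < 0 to ξ > 0, the integrand is a combination of exp(aξ) and exp(bξ), both
  -- decaying.
  set a : ℂ := -(2 * Real.pi * δ : ℝ) + (2 * Real.pi * x : ℝ) * Complex.I with ha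
  set b : ℂ := -(2 * Real.pi * δ : ℝ) - (2 * Real.pi * x : ℝ) * Complex.I with hb
  have hpos : 0 < 2 * Real.pi * δ := by positivity
  have hare : a.re < 0 := by simp [ha]; positivity
  have hbre : b.re < 0 := by simp [hb]; positivity
  have hint : Integrable (fun ξ : ℝ => Complex.exp ((2 * Real.pi * ξ * x : ℝ) * Complex.I) •
      conjPoissonSym δ ξ) volume := by
    refine (integrable_conjPoissonSym hδ).bdd_mul (c := 1)
      (Continuous.aestronglyMeasurable (by fun_prop)) ?_
    filter_upwards with ξ
    rw [Complex.norm_exp_ofReal_mul_I]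
  rw [Real.fourierInv_eq' ]
  have h1 : ∀ ξ : ℝ, (Complex.exp (((2 * Real.pi * inner ℝ ξ x : ℝ) : ℂ) * Complex.I) •
      conjPoissonSym δ ξ) =
      Complex.exp ((2 * Real.pi * ξ * x : ℝ) * Complex.I) • conjPoissonSym δ ξ := by
    intro ξ
    congr 4
    simp; ring
  simp only [h1]
  rw [integral_eq_Ioi_add_neg hint]
  have h2 : ∫ ξ in Set.Ioi (0 : ℝ), (Complex.exp ((2 * Real.pi * ξ * x : ℝ) * Complex.I) •
      conjPoissonSym δ ξ + Complex.exp ((2 * Real.pi * (-ξ) * x : ℝ) * Complex.I) •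
      conjPoissonSym δ (-ξ)) = ∫ ξ in Set.Ioi (0 : ℝ),
        (-Complex.I * Complex.exp (a * ξ) + Complex.I * Complex.exp (b * ξ)) := by
    refine setIntegral_congr_fun measurableSet_Ioi fun ξ hξ => ?_
    have hξ' : (0 : ℝ) < ξ := hξ
    have e1 : Complex.exp (a * ξ) = Complex.exp ((2 * Real.pi * ξ * x : ℝ) * Complex.I) *
        (Real.exp (-(2 * Real.pi * δ) * |ξ|) : ℂ) := by
      rw [Complex.ofReal_exp, ← Complex.exp_add, abs_of_pos hξ']
      congr 1
      rw [ha]; push_cast; ring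
    have e2 : Complex.exp (b * ξ) = Complex.exp ((2 * Real.pi * (-ξ) * x : ℝ) * Complex.I) *
        (Real.exp (-(2 * Real.pi * δ) * |ξ|) : ℂ) := by
      rw [Complex.ofReal_exp, ← Complex.exp_add, abs_of_pos hξ']
      congr 1
      rw [hb]; push_cast; ring
    simp only [smul_eq_mul, conjPoissonSym, hilbertSym, sign_pos hξ', sign_neg (neg_neg_of_pos hξ'),
      e1, e2, abs_neg]
    simp
    ring
  rw [h2, integral_add, integral_const_mul, integral_const_mul, integral_exp_mul_complex_Ioi hare,
    integral_exp_mul_complex_Ioi hbre]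
  · have ha0 : a ≠ 0 := fun h => by rw [h] at hare; simp at hare
    have hb0 : b ≠ 0 := fun h => by rw [h] at hbre; simp at hbre
    have hpi : (Real.pi : ℂ) ≠ 0 := by exact_mod_cast Real.pi_ne_zero
    have hden : ((x ^ 2 + δ ^ 2 : ℝ) : ℂ) ≠ 0 := by
      exact_mod_cast (by positivity : x ^ 2 + δ ^ 2 ≠ 0)
    have hab : a * b = (2 * Real.pi) ^ 2 * ((x ^ 2 + δ ^ 2 : ℝ) : ℂ) := by
      rw [ha, hb]; push_cast; ring_nf; rw [Complex.I_sq]; ring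
    have hsub : b - a = -(2 * (2 * Real.pi * x) * Complex.I) := by
      rw [ha, hb]; push_cast; ring
    have : -Complex.I * (-Complex.exp (a * (0 : ℝ)) / a) + Complex.I * (-Complex.exp (b * (0 : ℝ)) / b)
        = Complex.I * (b - a) / (a * b) := by
      simp only [Complex.ofReal_zero, mul_zero, Complex.exp_zero]
      field_simp
      ring
    rw [this, hab, hsub, conjPoisson]
    push_cast at hden ⊢
    field_simp
    rw [Complex.I_sq]; ring
  · exact (integrableOn_exp_mul_complex_Ioi hare 0).const_mul _
  · exact (integrableOn_exp_mul_complex_Ioi hbre 0).const_mul _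

lemma isFT_conjPoisson {δ : ℝ} (hδ : 0 < δ) :
    IsFT (fun x => (conjPoisson δ x : ℂ)) (conjPoissonSym δ) := by
  refine (isFT_fourierInv (integrable_conjPoissonSym hδ) (memLp_conjPoissonSym hδ)).congr_left ?_
  filter_upwards with x
  exact fourierInv_conjPoissonSym hδ x

/-- The convolution theorem for two L² functions, valid at every point: it is Plancherel's identity
for u and y ↦ v(x − y). -/
lemma IsFT.integral_mul_sub {u U v V : ℝ → ℂ} (h : IsFT u U) (h' : IsFT v V) (x : ℝ) :
    ∫ y, u y * v (x - y) =
      ∫ ξ : ℝ, Complex.exp (2 * Real.pi * Complex.I * x * ξ) * (U ξ * V ξ) := by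
  have h1 := h.integral_mul (h'.translate x).comp_neg
  rw [← integral_neg_eq_self fun ξ : ℝ => Complex.exp (2 * Real.pi * Complex.I * x * ξ) *
    (U ξ * V ξ)]
  calc ∫ y, u y * v (x - y) = ∫ y, u y * v (-y + x) := by simp only [sub_eq_neg_add]
    _ = _ := h1
    _ = _ := by
      congr 1
      funext ξ
      ring

/-- Pairing y with −y leaves the difference v(x−y) − v(x+y), which cancels the singularity 1/y. The
statement covers both the truncated kernel of the principal value and the conjugate Poisson kernel,
so the two limits agree. -/
lemma tendsto_integral_odd_kernel {k : ℝ → ℝ → ℝ} {v : ℝ → ℝ} (hv : ContDiff ℝ 1 v)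
    (hc : HasCompactSupport v) (hkm : ∀ ε, Measurable (k ε)) (hodd : ∀ ε y, k ε (-y) = -k ε y)
    (hkb : ∀ ε > 0, ∃ C, ∀ y, |k ε y| ≤ C) (hle : ∀ ε > 0, ∀ y > 0, |k ε y| ≤ 1 / (Real.pi * y))
    (hlim : ∀ y > 0, Tendsto (fun ε => k ε y) (𝓝[>] 0) (𝓝 (1 / (Real.pi * y)))) (x : ℝ) :
    Tendsto (fun ε => ∫ y, k ε y * v (x - y)) (𝓝[>] 0)
      (𝓝 (∫ y in Set.Ioi 0, 1 / (Real.pi * y) * (v (x - y) - v (x + y)))) := by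
  obtain ⟨K, hK⟩ := hv.lipschitzWith_of_hasCompactSupport hc one_ne_zero
  have hvi : Integrable (fun y => v (x - y)) volume :=
    (hv.continuous.integrable_of_hasCompactSupport hc).comp_sub_left x
  have heq : ∀ ε > 0, ∫ y, k ε y * v (x - y) =
      ∫ y in Set.Ioi 0, k ε y * (v (x - y) - v (x + y)) := by
    intro ε hε
    obtain ⟨C, hC⟩ := hkb ε hε
    have hi : Integrable (fun y => k ε y * v (x - y)) volume :=
      hvi.bdd_mul (c := C) (hkm ε).aestronglyMeasurable
        (Eventually.of_forall fun y => by simpa using hC y)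
    rw [← intervalIntegral.integral_Iic_add_Ioi (b := (0 : ℝ)) (μ := volume)
      hi.integrableOn hi.integrableOn]
    have h1 : ∫ y in Set.Iic 0, k ε y * v (x - y) = ∫ y in Set.Ioi 0, -(k ε y * v (x + y)) := by
      have := integral_comp_neg_Ioi 0 fun y => k ε y * v (x - y)
      rw [neg_zero] at this
      rw [← this]
      simp [hodd]
    have hi2 : Integrable (fun y => -(k ε y * v (x + y))) volume := by
      have := hi.comp_neg
      simpa [hodd] using this
    rw [h1, ← integral_add hi2.integrableOn hi.integrableOn]
    congr 1
    funext y
    ring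
  refine Tendsto.congr' (f₁ := fun ε => ∫ y in Set.Ioi 0, k ε y * (v (x - y) - v (x + y))) ?_ ?_
  · filter_upwards [self_mem_nhdsWithin] with ε hε
    exact (heq ε hε).symm
  have hcont : Continuous fun y => v (x - y) - v (x + y) := by
    have := hv.continuous
    fun_prop
  obtain ⟨R, hR0, hR⟩ : ∃ R : ℝ, 0 < R ∧ ∀ y, R < y → v (x - y) - v (x + y) = 0 := by
    obtain ⟨R, hR⟩ := hc.isCompact.isBounded.subset_closedBall (0 : ℝ)
    refine ⟨|R| + |x| + 1, by positivity, fun y hy => ?_⟩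
    have hz : ∀ z, |R| < |z| → v z = 0 := by
      intro z hz
      by_contra h
      have := hR (subset_tsupport v h)
      rw [mem_closedBall_zero_iff, Real.norm_eq_abs] at this
      exact absurd (this.trans (le_abs_self R)) (not_le.2 hz)
    have h1 := le_abs_self x
    have h2 := neg_abs_le x
    rw [hz, hz, sub_zero]
    · exact lt_of_lt_of_le (by linarith) (le_abs_self (x + y))
    · exact lt_of_lt_of_le (by linarith) (neg_le_abs (x - y))
  -- The dominating constant is the product of the kernel bound 1/(πy) and the Lipschitz bound 2Ky.
  refine tendsto_integral_filter_of_dominated_convergence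
    (Set.indicator (Set.Ioc 0 R) fun _ => 2 * K / Real.pi) ?_ ?_ ?_ ?_
  · exact Eventually.of_forall fun ε =>
      ((hkm ε).aestronglyMeasurable.mul hcont.aestronglyMeasurable)
  · filter_upwards [self_mem_nhdsWithin] with ε hε
    filter_upwards [ae_restrict_mem measurableSet_Ioi] with y hy
    have hy' : (0 : ℝ) < y := hy
    by_cases hyR : y ≤ R
    · rw [Set.indicator_of_mem (show y ∈ Set.Ioc 0 R from ⟨hy', hyR⟩), norm_mul, Real.norm_eq_abs]
      have h1 : ‖v (x - y) - v (x + y)‖ ≤ K * (2 * y) := by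
        have := hK.norm_sub_le (x - y) (x + y)
        refine this.trans (le_of_eq ?_)
        rw [show x - y - (x + y) = -(2 * y) by ring, norm_neg, Real.norm_of_nonneg (by positivity)]
      calc |k ε y| * ‖v (x - y) - v (x + y)‖ ≤ 1 / (Real.pi * y) * (K * (2 * y)) :=
            mul_le_mul (hle ε hε y hy') h1 (norm_nonneg _) (by positivity)
        _ = 2 * K / Real.pi := by field_simp
    · rw [hR y (not_le.1 hyR)]
      simp only [mul_zero, norm_zero]
      exact Set.indicator_nonneg (fun _ _ => by positivity) _
  · refine Integrable.integrableOn ?_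
    rw [integrable_indicator_iff measurableSet_Ioc]
    exact integrableOn_const (by simp)
  · filter_upwards [ae_restrict_mem measurableSet_Ioi] with y hy
    exact (hlim y hy).mul_const _

lemma abs_conjPoisson_le (δ : ℝ) {y : ℝ} (hy : 0 < y) :
    |conjPoisson δ y| ≤ 1 / (Real.pi * y) := by
  have hpi := Real.pi_pos
  rw [conjPoisson, abs_of_nonneg (by positivity), div_le_div_iff₀ (by positivity) (by positivity)]
  nlinarith [sq_nonneg δ, mul_nonneg hpi.le (sq_nonneg δ)]

lemma conjPoisson_neg (δ y : ℝ) : conjPoisson δ (-y) = -conjPoisson δ y := by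
  simp [conjPoisson, neg_div]

lemma measurable_conjPoisson (δ : ℝ) : Measurable (conjPoisson δ) := by
  unfold conjPoisson; fun_prop

lemma hilbertTransform_eq {v : ℝ → ℝ} (hv : ContDiff ℝ 1 v) (hc : HasCompactSupport v) (x : ℝ) :
    hilbertTransform v x = ∫ y in Set.Ioi 0, 1 / (Real.pi * y) * (v (x - y) - v (x + y)) := by
  unfold hilbertTransform
  apply Tendsto.limUnder_eq
  have h := tendsto_integral_odd_kernel (k := fun ε y => if ε < |y| then 1 / (Real.pi * y) else 0)
    hv hc ?_ ?_ ?_ ?_ ?_ x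
  · refine h.congr fun ε => ?_
    rw [← integral_const_mul, ← integral_indicator (measurableSet_lt measurable_const (by fun_prop)),
      ← integral_sub_left_eq_self _ volume x]
    congr 1
    funext z
    simp only [sub_sub_cancel, Set.indicator, Set.mem_ofPred_eq]
    split_ifs
    · field_simp
    · simp
  · intro ε
    exact Measurable.ite (measurableSet_lt measurable_const (by fun_prop)) (by fun_prop)
      measurable_const
  · intro ε y
    simp only [abs_neg]
    split_ifs <;> simp
  · intro ε hε
    refine ⟨1 / (Real.pi * ε), fun y => ?_⟩
    have hpi := Real.pi_pos
    split_ifs with h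
    · rw [abs_div, abs_mul, abs_one, abs_of_pos hpi]
      gcongr
    · simp; positivity
  · intro ε hε y hy
    have hpi := Real.pi_pos
    split_ifs with h
    · rw [abs_of_pos (by positivity)]
    · simp; positivity
  · intro y hy
    refine tendsto_const_nhds.congr' ?_
    filter_upwards [Ioo_mem_nhdsGT hy] with ε hε
    rw [if_pos]
    exact hε.2.trans_le (le_abs_self y)

lemma tendsto_conjPoissonSym (ξ : ℝ) :
    Tendsto (fun δ => conjPoissonSym δ ξ) (𝓝[>] 0) (𝓝 (hilbertSym ξ)) := by
  have hc : Continuous fun δ => conjPoissonSym δ ξ := by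
    unfold conjPoissonSym; fun_prop
  have := (hc.tendsto 0).mono_left (nhdsWithin_le_nhds (s := Set.Ioi 0))
  simpa [conjPoissonSym] using this

lemma norm_exp_two_pi_mul (x ξ : ℝ) : ‖Complex.exp (2 * Real.pi * Complex.I * x * ξ)‖ = 1 := by
  rw [Complex.norm_exp]; simp

/-- The Hilbert transform of a test function has the multiplier `-i sgn ξ`. -/
lemma isFT_hilbertTransform {v : ℝ → ℝ} (hv : ContDiff ℝ ∞ v) (hc : HasCompactSupport v) :
    IsFT (fun x => (hilbertTransform v x : ℂ))
      (fun ξ => hilbertSym ξ * 𝓕 (fun x => (v x : ℂ)) ξ) := by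
  have hc' : HasCompactSupport (Complex.ofRealCLM ∘ v) := hc.comp_left rfl
  have hv' : ContDiff ℝ ∞ (Complex.ofRealCLM ∘ v) := by fun_prop
  set ψ : 𝓢(ℝ, ℂ) := hc'.toSchwartzMap hv' with hψ
  have hψv : ∀ x, ψ x = (v x : ℂ) := fun x => rfl
  have hF : IsFT (fun x => (v x : ℂ)) (𝓕 (fun x => (v x : ℂ))) :=
    isFT_fourierIntegral ψ.integrable (schwartz_memLp ψ)
  have hFi : Integrable (𝓕 (fun x => (v x : ℂ))) volume := by
    have := (𝓕 ψ).integrable (μ := volume)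
    rwa [SchwartzMap.fourier_coe] at this
  have hm : AEStronglyMeasurable (fun ξ => hilbertSym ξ * 𝓕 (fun x => (v x : ℂ)) ξ) volume :=
    measurable_hilbertSym.aestronglyMeasurable.mul hF.right.1
  have hle : ∀ ξ, ‖hilbertSym ξ * 𝓕 (fun x => (v x : ℂ)) ξ‖ ≤ 1 * ‖𝓕 (fun x => (v x : ℂ)) ξ‖ := by
    intro ξ
    rw [norm_mul]
    gcongr
    exact norm_hilbertSym_le ξ
  have hGi : Integrable (fun ξ => hilbertSym ξ * 𝓕 (fun x => (v x : ℂ)) ξ) volume :=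
    hFi.norm.mono' hm (Eventually.of_forall fun ξ => by simpa using hle ξ)
  have hG2 : MemLp (fun ξ => hilbertSym ξ * 𝓕 (fun x => (v x : ℂ)) ξ) 2 volume :=
    hF.right.of_le_mul hm (Eventually.of_forall hle)
  refine (isFT_fourierInv hGi hG2).congr_left (Eventually.of_forall fun x => ?_)
  -- The convolution with the conjugate Poisson kernel is computed twice as δ → 0: in space it tends
  -- to the principal value, in frequency to the inverse integral with multiplier −i sgn ξ.
  have h1 := tendsto_integral_odd_kernel (k := conjPoisson) (hv.of_le (by norm_num)) hc
    measurable_conjPoisson conjPoisson_neg ?_ (fun δ _ y hy => abs_conjPoisson_le δ hy) ?_ x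
  · rw [← hilbertTransform_eq (hv.of_le (by norm_num)) hc] at h1
    have h2 : Tendsto (fun δ => ∫ ξ : ℝ, Complex.exp (2 * Real.pi * Complex.I * x * ξ) *
        (conjPoissonSym δ ξ * 𝓕 (fun x => (v x : ℂ)) ξ)) (𝓝[>] 0)
        (𝓝 (∫ ξ : ℝ, Complex.exp (2 * Real.pi * Complex.I * x * ξ) *
          (hilbertSym ξ * 𝓕 (fun x => (v x : ℂ)) ξ))) := by
      refine tendsto_integral_filter_of_dominated_convergence
        (fun ξ => ‖𝓕 (fun x => (v x : ℂ)) ξ‖) ?_ ?_ hFi.norm ?_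
      · refine Eventually.of_forall fun δ => ?_
        exact (Continuous.aestronglyMeasurable (by fun_prop)).mul
          ((measurable_conjPoissonSym δ).aestronglyMeasurable.mul hF.right.1)
      · filter_upwards [self_mem_nhdsWithin] with δ hδ
        filter_upwards with ξ
        rw [norm_mul, norm_exp_two_pi_mul, one_mul, norm_mul]
        refine mul_le_of_le_one_left (norm_nonneg _) ((norm_conjPoissonSym_le ξ).trans ?_)
        rw [Real.exp_le_one_iff]
        have hδ' : (0 : ℝ) < δ := hδ
        have : 0 ≤ 2 * Real.pi * δ * |ξ| := by positivity
        linarith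
      · filter_upwards with ξ
        exact ((tendsto_conjPoissonSym ξ).mul_const _).const_mul _
    have h3 : Tendsto (fun δ => ((∫ y, conjPoisson δ y * v (x - y) : ℝ) : ℂ)) (𝓝[>] 0)
        (𝓝 (hilbertTransform v x : ℂ)) := (Complex.continuous_ofReal.tendsto _).comp h1
    have h4 := tendsto_nhds_unique (h3.congr' ?_) h2
    · refine Eq.trans ?_ h4.symm
      rw [Real.fourierInv_eq']
      congr 1
      funext ξ
      rw [smul_eq_mul]
      congr 2
      simp
      ring
    · filter_upwards [self_mem_nhdsWithin] with δ hδ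
      rw [← (isFT_conjPoisson hδ).integral_mul_sub hF x, ← integral_complex_ofReal]
      simp
  · intro δ hδ
    refine ⟨1 / (Real.pi * δ), fun y => ?_⟩
    have hpi := Real.pi_pos
    have hden : 0 < Real.pi * (y ^ 2 + δ ^ 2) := by positivity
    rw [conjPoisson, abs_div, abs_of_pos hden, div_le_div_iff₀ hden (by positivity), one_mul]
    have : |y| * δ ≤ y ^ 2 + δ ^ 2 := by
      nlinarith [sq_nonneg (|y| - δ), sq_abs y, sq_nonneg (|y| + δ)]
    nlinarith
  · intro y hy
    have hpi := Real.pi_pos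
    have hc : ContinuousAt (fun δ => conjPoisson δ y) 0 := by
      unfold conjPoisson
      exact ContinuousAt.div (by fun_prop) (by fun_prop) (by positivity)
    have := hc.tendsto.mono_left (nhdsWithin_le_nhds (s := Set.Ioi 0))
    convert this using 2
    rw [conjPoisson]
    field_simp
    simp

/-! ### The equation on the Fourier side. -/

lemma isFT_testFunction {w : ℝ → ℝ} (hw : ContDiff ℝ ∞ w) (hc : HasCompactSupport w) :
    IsFT (fun x => (w x : ℂ)) (𝓕 (fun x => (w x : ℂ))) := by
  have hc' : HasCompactSupport (Complex.ofRealCLM ∘ w) := hc.comp_left rfl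
  have hw' : ContDiff ℝ ∞ (Complex.ofRealCLM ∘ w) := by fun_prop
  exact isFT_fourierIntegral (hc'.toSchwartzMap hw').integrable (schwartz_memLp (hc'.toSchwartzMap hw'))

lemma contDiff_deriv_testFunction {w : ℝ → ℝ} (hw : ContDiff ℝ ∞ w) : ContDiff ℝ ∞ (deriv w) :=
  (contDiff_infty_iff_deriv.1 hw).2

lemma isFT_deriv_testFunction {w : ℝ → ℝ} {W : ℝ → ℂ} (hw : ContDiff ℝ ∞ w)
    (hc : HasCompactSupport w) (hW : IsFT (fun x => (w x : ℂ)) W) :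
    IsFT (fun x => ((deriv w x : ℝ) : ℂ)) (fun ξ => 2 * Real.pi * Complex.I * ξ * W ξ) := by
  have h1 := isFT_testFunction (contDiff_deriv_testFunction hw) hc.deriv
  refine hW.deriv (Complex.continuous_ofReal.comp hw.continuous) (fun x _ => ?_) h1.left
  exact ((hw.differentiable (by simp)) x).hasDerivAt.ofReal_comp

lemma integral_real_mul_eq {a b : ℝ → ℝ} {A B : ℝ → ℂ} (ha : IsFT (fun x => (a x : ℂ)) A)
    (hb : IsFT (fun x => (b x : ℂ)) B) :
    ((∫ x, a x * b x : ℝ) : ℂ) = ∫ ξ, (starRingEnd ℂ) (B ξ) * A ξ := by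
  rw [← hb.plancherel ha, ← integral_complex_ofReal]
  congr 1
  funext x
  simp [mul_comm]

/-- An integrable function with vanishing Fourier transform vanishes. -/
lemma ae_eq_zero_of_fourier_eq_zero {h : ℝ → ℂ} (hi : Integrable h volume)
    (h0 : ∀ ξ, 𝓕 h ξ = 0) : h =ᵐ[volume] 0 := by
  apply ae_eq_of_test_fourier hi.locallyIntegrable (locallyIntegrable_const (0 : ℂ))
  intro ψ
  have := VectorFourier.integral_fourierIntegral_smul_eq_flip (μ := volume) (ν := volume)
    (L := innerₗ ℝ) (f := h) (g := ψ) Real.continuous_fourierChar continuous_inner hi ψ.integrable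
  have h1 : ∀ x, VectorFourier.fourierIntegral Real.fourierChar volume (innerₗ ℝ) h x = 0 := h0
  have h2 : ∀ x, VectorFourier.fourierIntegral Real.fourierChar volume (innerₗ ℝ)
      (fun x => ψ x) x = 𝓕 ψ x := by
    intro x
    rw [SchwartzMap.fourier_coe]; rfl
  simp only [smul_eq_mul, flip_innerₗ, h1, h2] at this
  simp only [zero_mul, integral_zero] at this ⊢
  exact this.symm

/-- Test functions whose Fourier transform does not vanish on a given ball. -/
lemma exists_testFunction_fourier_ne_zero (R : ℝ) (hR : 0 < R) :
    ∃ w : ℝ → ℝ, ContDiff ℝ ∞ w ∧ HasCompactSupport w ∧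
      ∀ ξ, |ξ| ≤ R → 𝓕 (fun x => (w x : ℂ)) ξ ≠ 0 := by
  have hr : 0 < 1 / (8 * R) := by positivity
  -- The outer radius is 1/(4R), so that 2π|xξ| ≤ π/2 and the cosine below is nonnegative on the
  -- support.
  let b : ContDiffBump (0 : ℝ) := ⟨1 / (8 * R), 2 * (1 / (8 * R)), hr, by linarith⟩
  refine ⟨b, b.contDiff, b.hasCompactSupport, fun ξ hξ h => ?_⟩
  have h1 : 0 < ∫ x, b x * Real.cos (2 * Real.pi * x * ξ) := by
    have hcont : Continuous fun x => b x * Real.cos (2 * Real.pi * x * ξ) :=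
      b.continuous.mul (by fun_prop)
    refine hcont.integral_pos_of_hasCompactSupport_nonneg_nonzero
      (b.hasCompactSupport.mul_right) (fun x => ?_) (x := 0) ?_
    · by_cases hx : x ∈ Metric.ball (0 : ℝ) b.rOut
      · refine mul_nonneg b.nonneg (Real.cos_nonneg_of_mem_Icc ?_)
        rw [mem_ball_zero_iff, Real.norm_eq_abs] at hx
        have hx' : |x| < 2 * (1 / (8 * R)) := hx
        have : |x| * |ξ| ≤ 1 / 4 := by
          calc |x| * |ξ| ≤ (2 * (1 / (8 * R))) * R := by gcongr
            _ = 1 / 4 := by field_simp; norm_num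
        rw [← abs_mul] at this
        have h2 := abs_le.1 this
        have := Real.pi_pos
        constructor <;> nlinarith
      · have : b x = 0 := b.zero_of_le_dist (by
          rw [Metric.mem_ball, not_lt] at hx; exact hx)
        simp [this]
    · have : b 0 = 1 := b.one_of_mem_closedBall (Metric.mem_closedBall_self hr.le)
      simp [this]
  have h2 : (𝓕 (fun x => (b x : ℂ)) ξ).re = ∫ x, b x * Real.cos (2 * Real.pi * x * ξ) := by
    rw [Real.fourier_real_eq_integral_exp_smul]
    have hi : Integrable (fun x : ℝ => Complex.exp ((-2 * Real.pi * x * ξ : ℝ) * Complex.I) •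
        (b x : ℂ)) volume := by
      refine Integrable.bdd_mul (c := 1) (b.continuous.integrable_of_hasCompactSupport
        b.hasCompactSupport).ofReal (Continuous.aestronglyMeasurable (by fun_prop)) ?_
      filter_upwards with x
      rw [Complex.norm_exp_ofReal_mul_I]
    have := integral_re hi
    rw [← RCLike.re_eq_complex_re, ← this]
    congr 1
    funext x
    simp only [smul_eq_mul, RCLike.re_eq_complex_re, Complex.re_mul_ofReal,
      Complex.exp_ofReal_mul_I_re]
    rw [mul_comm, ← Real.cos_neg]
    congr 2
    ring
  rw [h] at h2
  simp at h2
  linarith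

/-- The denominator of the symbol of the linear part of the equation. -/
noncomputable def denom (β c γ ξ : ℝ) : ℝ :=
  β * |2 * Real.pi * ξ| ^ 3 - c * (2 * Real.pi * ξ) ^ 2 + γ

lemma isFT_toL2 {g : ℝ → ℝ} (hg : MemLp g 2 volume) :
    IsFT (fun x => (g x : ℂ)) (𝓕 (toL2 g hg) : Lp ℂ 2 (volume : Measure ℝ)) :=
  (isFT_iff hg.ofReal (Lp.memLp _)).2 (by simp [toL2])

lemma isFourierDeriv_iff {k : ℤ} {g u : ℝ → ℝ} {G : ℝ → ℂ} (hG : IsFT (fun x => (g x : ℂ)) G) :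
    IsFourierDeriv k g u ↔
      IsFT (fun x => (u x : ℂ)) (fun ξ => (2 * Real.pi * Complex.I * ξ) ^ k * G ξ) := by
  constructor
  · rintro ⟨hg, hu, h⟩
    refine (isFT_toL2 hu).congr_right (h.trans ?_)
    filter_upwards [(isFT_toL2 hg).unique hG] with ξ hξ
    rw [hξ]
  · intro h
    have hg : MemLp g 2 volume := by simpa using hG.left.re
    have hu : MemLp u 2 volume := by simpa using h.left.re
    refine ⟨hg, hu, ((isFT_toL2 hu).unique h).trans ?_⟩
    filter_upwards [(isFT_toL2 hg).unique hG] with ξ hξ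
    rw [hξ]

/-- The equation on the Fourier side. -/
lemma IsSolitaryWave.fourier_eq {β c γ : ℝ} {f φ : ℝ → ℝ} (h : IsSolitaryWave β c γ f φ)
    {Φ G : ℝ → ℂ} (hΦ : IsFT (fun x => (φ x : ℂ)) Φ) (hG : IsFT (fun x => (f (φ x) : ℂ)) G) :
    ∀ᵐ ξ : ℝ, (denom β c γ ξ : ℂ) * Φ ξ = -((2 * Real.pi * ξ) ^ 2 * G ξ) := by
  obtain ⟨⟨-, u, hu⟩, hweak⟩ := h
  have hΨ := (isFourierDeriv_iff hΦ).1 hu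
  set Ψ : ℝ → ℂ := fun ξ => (2 * Real.pi * Complex.I * ξ) ^ (-1 : ℤ) * Φ ξ with hΨdef
  -- The weak form says that `M` is orthogonal to the transforms of all test functions. `M` is not
  -- known to be square integrable; only its products with such transforms are integrable.
  set M : ℝ → ℂ := fun ξ => β * ((starRingEnd ℂ) (hilbertSym ξ * (2 * Real.pi * Complex.I * ξ) ^ 2)
    * Φ ξ) - c * ((starRingEnd ℂ) (2 * Real.pi * Complex.I * ξ) * Φ ξ)
    + (starRingEnd ℂ) (2 * Real.pi * Complex.I * ξ) * G ξ + γ * Ψ ξ with hM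
  have key : ∀ w : ℝ → ℝ, ContDiff ℝ ∞ w → HasCompactSupport w → ∀ W : ℝ → ℂ,
      IsFT (fun x => (w x : ℂ)) W →
      Integrable (fun ξ => (starRingEnd ℂ) (W ξ) * M ξ) volume ∧
      ∫ ξ, (starRingEnd ℂ) (W ξ) * M ξ = 0 := by
    intro w hw hc W hW
    have hw1 := contDiff_deriv_testFunction hw
    have hw2 := contDiff_deriv_testFunction hw1
    have hW1 := isFT_deriv_testFunction hw hc hW
    have hW2 := isFT_deriv_testFunction hw1 hc.deriv hW1
    have hH : IsFT (fun x => (hilbertTransform (deriv (deriv w)) x : ℂ)) (fun ξ =>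
        hilbertSym ξ * (2 * Real.pi * Complex.I * ξ * (2 * Real.pi * Complex.I * ξ * W ξ))) := by
      refine (isFT_hilbertTransform hw2 hc.deriv.deriv).congr_right ?_
      filter_upwards [(isFT_testFunction hw2 hc.deriv.deriv).unique hW2] with ξ hξ
      rw [hξ]
    have e1 := integral_real_mul_eq hΦ hH
    have e2 := integral_real_mul_eq hΦ hW1
    have e3 := integral_real_mul_eq hG hW1
    have e4 := integral_real_mul_eq hΨ hW
    have i1 := integrable_mul_of_memLp (memLp_conj hH.right) hΦ.right
    have i2 := integrable_mul_of_memLp (memLp_conj hW1.right) hΦ.right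
    have i3 := integrable_mul_of_memLp (memLp_conj hW1.right) hG.right
    have i4 := integrable_mul_of_memLp (memLp_conj hW.right) hΨ.right
    have hsum : (fun ξ => (starRingEnd ℂ) (W ξ) * M ξ) = fun ξ =>
        β * ((starRingEnd ℂ) (hilbertSym ξ *
          (2 * Real.pi * Complex.I * ξ * (2 * Real.pi * Complex.I * ξ * W ξ))) * Φ ξ)
        - c * ((starRingEnd ℂ) (2 * Real.pi * Complex.I * ξ * W ξ) * Φ ξ)
        + (starRingEnd ℂ) (2 * Real.pi * Complex.I * ξ * W ξ) * G ξ
        + γ * ((starRingEnd ℂ) (W ξ) * Ψ ξ) := by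
      funext ξ
      simp only [hM, map_mul, map_pow]
      ring
    have j1 := i1.const_mul (β : ℂ)
    have j2 := i2.const_mul (c : ℂ)
    have j4 := i4.const_mul (γ : ℂ)
    rw [hsum]
    refine ⟨((j1.sub j2).add i3).add j4, ?_⟩
    rw [integral_add (by exact (j1.sub j2).add i3) j4, integral_add (by exact j1.sub j2) i3,
      integral_sub j1 j2, integral_const_mul, integral_const_mul, integral_const_mul, ← e1, ← e2,
      ← e3, ← e4]
    have := hweak u hu w hw hc
    have h2 : β * (∫ x, φ x * hilbertTransform (deriv (deriv w)) x) - c * (∫ x, φ x * deriv w x)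
        + (∫ x, f (φ x) * deriv w x) + γ * ∫ x, u x * w x = 0 := by linarith
    exact_mod_cast h2
  -- Translating `w` multiplies its transform by a character. Hence the product of `M` with the
  -- conjugate transform of one fixed `w` has vanishing Fourier transform, and `M` vanishes wherever
  -- that transform does not.
  have hzero : ∀ n : ℕ, ∀ᵐ ξ : ℝ, |ξ| ≤ (n : ℝ) + 1 → M ξ = 0 := by
    intro n
    obtain ⟨w, hw, hc, hne⟩ := exists_testFunction_fourier_ne_zero ((n : ℝ) + 1) (by positivity)
    have hW := isFT_testFunction hw hc
    have hk := key w hw hc _ hW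
    have := ae_eq_zero_of_fourier_eq_zero hk.1 fun τ => by
      have hwt : ContDiff ℝ ∞ fun x => w (x + τ) := hw.comp (contDiff_id.add contDiff_const)
      have hct : HasCompactSupport fun x => w (x + τ) :=
        hc.comp_homeomorph (Homeomorph.addRight τ)
      have h3 := (key _ hwt hct _ (hW.translate τ)).2
      rw [Real.fourier_real_eq_integral_exp_smul, ← h3]
      congr 1
      funext ξ
      rw [smul_eq_mul, map_mul, ← Complex.exp_conj, ← mul_assoc]
      congr 3
      simp [map_ofNat]
      ring
    filter_upwards [this] with ξ hξ hn
    have h4 : (starRingEnd ℂ) (𝓕 (fun x => (w x : ℂ)) ξ) ≠ 0 := by simpa using hne ξ hn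
    exact (mul_eq_zero.1 hξ).resolve_left h4
  have h0 : ∀ᵐ ξ : ℝ, ξ ≠ 0 := by simp [ae_iff]
  filter_upwards [ae_all_iff.2 hzero, h0] with ξ hξ hξ0
  obtain ⟨n, hn⟩ := exists_nat_ge |ξ|
  have hMξ := hξ n (hn.trans (by linarith))
  have hpi : (Real.pi : ℂ) ≠ 0 := by exact_mod_cast Real.pi_ne_zero
  have hξc : (ξ : ℂ) ≠ 0 := by exact_mod_cast hξ0
  have habs : (|2 * Real.pi * ξ| : ℝ) = 2 * Real.pi * ξ * (SignType.sign ξ : ℝ) := by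
    rw [abs_mul, abs_of_pos (by positivity : 0 < 2 * Real.pi), mul_assoc (2 * Real.pi), self_mul_sign]
  have hs2 : ((SignType.sign ξ : ℝ) : ℂ) ^ 2 = 1 := by
    rcases lt_or_gt_of_ne hξ0 with h | h <;> simp [h]
  simp only [hM, hΨdef, hilbertSym, map_mul, map_pow, map_neg, Complex.conj_I, Complex.conj_ofReal,
    map_ofNat] at hMξ
  have h5 : (2 * Real.pi * Complex.I * ξ) * ((2 * Real.pi * Complex.I * ξ) ^ (-1 : ℤ) * Φ ξ) = Φ ξ := by
    rw [zpow_neg_one, mul_inv_cancel_left₀]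
    simp [hpi, hξ0]
  -- The factor iζ cancels the (iζ)⁻¹ in `Ψ` and turns M = 0 into DΦ + ζ²G = 0.
  have h6 := congrArg (fun z => (2 * Real.pi * Complex.I * ξ) * z) hMξ
  simp only [mul_add, mul_sub, mul_zero, mul_left_comm _ (γ : ℂ), h5] at h6
  rw [denom, habs]
  push_cast
  have hI : Complex.I ^ 2 = -1 := Complex.I_sq
  have hI4 : Complex.I ^ 4 = 1 := Complex.I_pow_four
  have hs3 : ((SignType.sign ξ : ℝ) : ℂ) ^ 3 = ((SignType.sign ξ : ℝ) : ℂ) := by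
    rw [pow_succ, hs2, one_mul]
  ring_nf at h6 ⊢
  simp only [hI, hI4, hs3] at h6 ⊢
  linear_combination h6

/-! ### Sobolev embedding of H^{1/2}. -/

lemma IsFT.ae_norm_le {u U : ℝ → ℂ} (h : IsFT u U) (hU : Integrable U volume) :
    ∀ᵐ x, ‖u x‖ ≤ ∫ ξ, ‖U ξ‖ := by
  filter_upwards [h.ae_eq_fourierInv hU] with x hx
  rw [hx, Real.fourierInv_eq_fourier_neg]
  exact VectorFourier.norm_fourierIntegral_le_integral_norm _ _ _ _ _

lemma memLp_of_memSobolev {s : ℝ} {u Φ : ℝ → ℂ} (h : IsFT u Φ)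
    (hs : TemperedDistribution.MemSobolev s 2 (h.left.toLp u : 𝓢'(ℝ, ℂ))) :
    MemLp (fun ξ : ℝ => (((1 + ξ ^ 2) ^ (s / 2) : ℝ) : ℂ) * Φ ξ) 2 volume := by
  obtain ⟨F, hF⟩ := TemperedDistribution.memSobolev_iff_exists_smulLeftCLM_fourier.1 hs
  rw [Lp.fourier_toTemperedDistribution_eq, (isFT_iff h.left h.right).1 h] at hF
  have hg : (fun x : ℝ => (((1 + ‖x‖ ^ 2) ^ (s / 2) : ℝ) : ℂ)).HasTemperateGrowth := by fun_prop
  have hc : Continuous fun ξ : ℝ => (((1 + ‖ξ‖ ^ 2) ^ (s / 2) : ℝ) : ℂ) := hg.1.continuous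
  refine (Lp.memLp F).ae_eq ?_
  have hmem : ∀ ξ : ℝ, (((1 + ξ ^ 2) ^ (s / 2) : ℝ) : ℂ) = (((1 + ‖ξ‖ ^ 2) ^ (s / 2) : ℝ) : ℂ) := by
    intro ξ; simp
  refine EventuallyEq.trans ?_ (Eventually.of_forall fun ξ => by beta_reduce; rw [hmem ξ] :
    (fun ξ : ℝ => (((1 + ‖ξ‖ ^ 2) ^ (s / 2) : ℝ) : ℂ) * Φ ξ) =ᵐ[volume] _)
  apply toLp_eq_of_test ((Lp.memLp F).locallyIntegrable (by norm_num))
    ((h.right.locallyIntegrable (by norm_num)).continuous_mul hc)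
  intro ψ
  have h1 := congrArg (fun T : 𝓢'(ℝ, ℂ) => T ψ) hF
  simp only [TemperedDistribution.smulLeftCLM_apply_apply, Lp.toTemperedDistribution_apply,
    SchwartzMap.smulLeftCLM_apply_apply hg, smul_eq_mul] at h1
  calc ∫ x, F x * ψ x = ∫ x, ψ x * F x := by simp only [mul_comm]
    _ = _ := h1.symm
    _ = _ := by
      apply integral_congr_ae
      filter_upwards [h.right.coeFn_toLp] with x hx
      rw [hx]
      ring

/-- Chebyshev's inequality in `L²`. -/
lemma meas_lt_norm_le {u : ℝ → ℂ} (hu : AEStronglyMeasurable u volume) {b : ℝ} (hb0 : 0 ≤ b)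
    (hb : eLpNorm u 2 volume ≤ ENNReal.ofReal b) {t : ℝ} (ht : 0 < t) :
    volume {x | t < ‖u x‖} ≤ ENNReal.ofReal (t⁻¹ ^ 2 * b ^ 2) := by
  have hsub : {x | t < ‖u x‖} ⊆ {x | ENNReal.ofReal t ≤ ‖u x‖ₑ} := by
    intro x hx
    have hx' : t < ‖u x‖ := hx
    change ENNReal.ofReal t ≤ ‖u x‖ₑ
    rw [← ofReal_norm]
    exact ENNReal.ofReal_le_ofReal hx'.le
  have ht0 : ENNReal.ofReal t ≠ 0 := by simpa using ht
  refine (measure_mono hsub).trans ((meas_ge_le_mul_pow_eLpNorm_enorm volume (p := 2) (by norm_num)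
    (by norm_num) hu ht0 (by simp)).trans ?_)
  rw [← ENNReal.ofReal_inv_of_pos ht]
  calc ENNReal.ofReal t⁻¹ ^ (2 : ℝ≥0∞).toReal * eLpNorm u 2 volume ^ (2 : ℝ≥0∞).toReal
      ≤ ENNReal.ofReal t⁻¹ ^ (2 : ℝ≥0∞).toReal * ENNReal.ofReal b ^ (2 : ℝ≥0∞).toReal := by gcongr
    _ = ENNReal.ofReal (t⁻¹ ^ 2 * b ^ 2) := by
        simp only [ENNReal.toReal_ofNat]
        rw [ENNReal.rpow_ofNat, ENNReal.rpow_ofNat, ENNReal.ofReal_mul (by positivity),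
          ENNReal.ofReal_pow (by positivity), ENNReal.ofReal_pow (by positivity)]

/-- Level set estimate behind the embedding of `H^{1/2}` into the Lebesgue spaces. -/
lemma IsFT.meas_lt_le {u Φ : ℝ → ℂ} (h : IsFT u Φ)
    (hs : MemLp (fun ξ : ℝ => (((1 + ξ ^ 2) ^ (1 / 4 : ℝ) : ℝ) : ℂ) * Φ ξ) 2 volume)
    {ε : ℝ} (hε : 0 < ε) :
    ∃ C : ℝ, 0 ≤ C ∧ ∀ t > 0, volume {x | t < ‖u x‖} ≤ ENNReal.ofReal (C * t ^ (-(2 + 2 / ε))) := by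
  set ρ : ℝ → ℝ := fun ξ => (1 + ξ ^ 2) ^ (1 / 4 : ℝ) with hρ
  have hρc : Continuous ρ := by
    refine Continuous.rpow_const (by fun_prop) fun ξ => Or.inl (by positivity)
  have hρ0 : ∀ ξ, 0 < ρ ξ := fun ξ => by simp only [hρ]; positivity
  set h' : ℝ → ℂ := fun ξ => (ρ ξ : ℂ) * Φ ξ with hh'
  have hΦ : ∀ ξ, ‖Φ ξ‖ = (ρ ξ)⁻¹ * ‖h' ξ‖ := by
    intro ξ
    rw [hh', norm_mul, Complex.norm_real, Real.norm_of_nonneg (hρ0 ξ).le,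
      inv_mul_cancel_left₀ (hρ0 ξ).ne']
  -- The square of this weight is (1+ξ²)^(−(1+ε)/2), which is integrable exactly because ε > 0.
  have hw : MemLp (fun ξ => ρ ξ ^ (-1 - ε)) 2 volume := by
    have hc : Continuous fun ξ => ρ ξ ^ (-1 - ε) :=
      hρc.rpow_const fun ξ => Or.inl (hρ0 ξ).ne'
    rw [memLp_two_iff_integrable_sq hc.aestronglyMeasurable]
    have := integrable_rpow_neg_one_add_norm_sq (E := ℝ) (μ := volume) (r := 1 + ε)
      (by simpa using hε)
    refine this.congr (Eventually.of_forall fun ξ => ?_)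
    simp only [hρ]
    rw [← Real.rpow_mul (by positivity), ← Real.rpow_mul_natCast (by positivity)]
    simp only [Real.norm_eq_abs, sq_abs]
    congr 1
    push_cast
    ring
  have hwi : Integrable (fun ξ => ρ ξ ^ (-1 - ε) * ‖h' ξ‖) volume :=
    hw.integrable_mul hs.norm
  set A : ℝ := (∫ ξ, ρ ξ ^ (-1 - ε) * ‖h' ξ‖) + 1 with hA
  have hA0 : 0 < A := by
    have : 0 ≤ ∫ ξ, ρ ξ ^ (-1 - ε) * ‖h' ξ‖ :=
      integral_nonneg fun ξ => mul_nonneg (Real.rpow_nonneg (hρ0 ξ).le _) (norm_nonneg _)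
    linarith
  set b : ℝ := (eLpNorm h' 2 volume).toReal with hb
  have hbE : eLpNorm h' 2 volume = ENNReal.ofReal b := (ENNReal.ofReal_toReal hs.eLpNorm_ne_top).symm
  have hb0 : 0 ≤ b := ENNReal.toReal_nonneg
  refine ⟨4 * b ^ 2 * (2 * A) ^ (2 / ε), by positivity, fun t ht => ?_⟩
  -- Threshold between low and high frequencies: the low part is at most A·T^ε = t/2 in sup norm, so
  -- |u| > t forces the high part above t/2, where Chebyshev applies.
  set T : ℝ := (t / (2 * A)) ^ (1 / ε) with hT
  have hT0 : 0 < T := by positivity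
  have hTε : A * T ^ ε = t / 2 := by
    rw [hT, ← Real.rpow_mul (by positivity), one_div_mul_cancel hε.ne', Real.rpow_one]
    field_simp
  have hS : MeasurableSet {ξ | ρ ξ < T} := measurableSet_lt hρc.measurable measurable_const
  have hU1 : MemLp (Set.indicator {ξ | ρ ξ < T} Φ) 2 volume := h.right.indicator hS
  have hU2 : MemLp (Set.indicator {ξ | ρ ξ < T}ᶜ Φ) 2 volume := h.right.indicator hS.compl
  obtain ⟨u₁, hu₁⟩ := exists_isFT_inv hU1
  obtain ⟨u₂, hu₂⟩ := exists_isFT_inv hU2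
  have hsum : u =ᵐ[volume] fun x => u₁ x + u₂ x := by
    refine h.unique_left ((hu₁.add hu₂).congr_right (Eventually.of_forall fun ξ => ?_))
    exact congrFun (Set.indicator_self_add_compl {ξ | ρ ξ < T} Φ) ξ
  have hlow : ∀ ξ, ‖Set.indicator {ξ | ρ ξ < T} Φ ξ‖ ≤ T ^ ε * (ρ ξ ^ (-1 - ε) * ‖h' ξ‖) := by
    intro ξ
    by_cases hξ : ξ ∈ {ξ | ρ ξ < T}
    · rw [Set.indicator_of_mem hξ, hΦ, ← mul_assoc]
      gcongr
      have hlt : ρ ξ ≤ T := le_of_lt hξ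
      calc (ρ ξ)⁻¹ = ρ ξ ^ ε * ρ ξ ^ (-1 - ε) := by
            rw [← Real.rpow_add (hρ0 ξ), ← Real.rpow_neg_one]; congr 1; ring
        _ ≤ T ^ ε * ρ ξ ^ (-1 - ε) := by
            have := hρ0 ξ
            gcongr
    · rw [Set.indicator_of_notMem hξ, norm_zero]
      exact mul_nonneg (by positivity) (mul_nonneg (Real.rpow_nonneg (hρ0 ξ).le _) (norm_nonneg _))
  have hU1i : Integrable (Set.indicator {ξ | ρ ξ < T} Φ) volume :=
    (hwi.const_mul (T ^ ε)).mono' hU1.1 (Eventually.of_forall hlow)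
  have hu₁le : ∀ᵐ x, ‖u₁ x‖ ≤ t / 2 := by
    filter_upwards [hu₁.ae_norm_le hU1i] with x hx
    refine hx.trans ?_
    calc ∫ ξ, ‖Set.indicator {ξ | ρ ξ < T} Φ ξ‖ ≤ ∫ ξ, T ^ ε * (ρ ξ ^ (-1 - ε) * ‖h' ξ‖) :=
          integral_mono hU1i.norm (hwi.const_mul _) hlow
      _ = T ^ ε * (A - 1) := by rw [integral_const_mul, hA]; ring
      _ ≤ A * T ^ ε := by nlinarith [Real.rpow_pos_of_pos hT0 ε]
      _ = t / 2 := hTε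
  have hu₂le : eLpNorm u₂ 2 volume ≤ ENNReal.ofReal (T⁻¹ * b) := by
    rw [hu₂.eLpNorm_eq, ENNReal.ofReal_mul (by positivity), ← hbE]
    apply eLpNorm_le_mul_eLpNorm_of_ae_le_mul
    filter_upwards with ξ
    by_cases hξ : ξ ∈ {ξ | ρ ξ < T}ᶜ
    · rw [Set.indicator_of_mem hξ, hΦ]
      have hle : T ≤ ρ ξ := not_lt.1 hξ
      gcongr
    · rw [Set.indicator_of_notMem hξ, norm_zero]
      positivity
  have hsub : {x | t < ‖u x‖} ≤ᵐ[volume] {x | t / 2 < ‖u₂ x‖} := by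
    filter_upwards [hsum, hu₁le] with x hx hx1 hlt
    have hlt' : t < ‖u x‖ := hlt
    change t / 2 < ‖u₂ x‖
    rw [hx] at hlt'
    have := norm_add_le (u₁ x) (u₂ x)
    linarith
  refine (measure_mono_ae hsub).trans ((meas_lt_norm_le hu₂.left.1 (by positivity) hu₂le
    (half_pos ht)).trans (le_of_eq ?_))
  congr 1
  have hT2 : T ^ 2 = t ^ (2 / ε) / (2 * A) ^ (2 / ε) := by
    rw [hT, ← Real.rpow_natCast, ← Real.rpow_mul (by positivity),
      Real.div_rpow ht.le (by positivity)]
    congr 2 <;> (push_cast; ring)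
  rw [mul_pow, inv_pow T, hT2, Real.rpow_neg ht.le, Real.rpow_add ht, Real.rpow_two]
  have h1 : 0 < t ^ (2 / ε) := by positivity
  have h2 : 0 < (2 * A) ^ (2 / ε) := by positivity
  field_simp
  ring

/-- The embedding of `H^{1/2}(ℝ)` into `L^r(ℝ)`, `2 < r < ∞`. -/
lemma IsFT.memLp_of_half {u Φ : ℝ → ℂ} (h : IsFT u Φ)
    (hs : MemLp (fun ξ : ℝ => (((1 + ξ ^ 2) ^ (1 / 4 : ℝ) : ℝ) : ℂ) * Φ ξ) 2 volume)
    {r : ℝ} (hr : 2 < r) : MemLp u (ENNReal.ofReal r) volume := by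
  have hr0 : 0 < r := by linarith
  -- This ε makes the level sets decay like t^(−2−r), so the layer cake integrand is at most a
  -- constant times t⁻³ at infinity.
  obtain ⟨C, hC, hb⟩ := h.meas_lt_le hs (ε := 2 / r) (by positivity)
  have hexp : ∀ t : ℝ, t ^ (-(2 + 2 / (2 / r))) = t ^ (-(2 + r)) := by
    intro t; congr 2; field_simp
  simp only [hexp] at hb
  set B := eLpNorm u 2 volume with hB
  have hb2 : ∀ t > 0, volume {x | t < ‖u x‖} ≤ ENNReal.ofReal (t⁻¹ ^ 2 * B.toReal ^ 2) :=
    fun t ht => meas_lt_norm_le h.left.1 ENNReal.toReal_nonneg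
      (ENNReal.ofReal_toReal h.left.eLpNorm_ne_top).ge ht
  refine ⟨h.left.1, ?_⟩
  rw [eLpNorm_lt_top_iff_lintegral_rpow_enorm_lt_top (by simpa using hr0) (by simp),
    ENNReal.toReal_ofReal hr0.le]
  have h1 : ∫⁻ x, ‖u x‖ₑ ^ r = ∫⁻ x, ENNReal.ofReal (‖u x‖ ^ r) := by
    congr 1
    funext x
    rw [← ofReal_norm, ENNReal.ofReal_rpow_of_nonneg (norm_nonneg _) hr0.le]
  rw [h1, lintegral_rpow_eq_lintegral_meas_lt_mul volume (Eventually.of_forall fun x => norm_nonneg _)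
    h.left.1.norm.aemeasurable hr0]
  refine ENNReal.mul_lt_top ENNReal.ofReal_lt_top ?_
  -- For t ≤ 1 Chebyshev alone leaves t^(r−3), integrable since r > 2. For t > 1 the level set
  -- estimate is used.
  rw [← Set.Ioc_union_Ioi_eq_Ioi (zero_le_one' ℝ)]
  refine (lintegral_union_le _ _ _).trans_lt (ENNReal.add_lt_top.2 ⟨?_, ?_⟩)
  · have hi : IntegrableOn (fun t : ℝ => B.toReal ^ 2 * t ^ (r - 3)) (Set.Ioc 0 1) volume := by
      have := intervalIntegral.intervalIntegrable_rpow' (a := 0) (b := 1) (r := r - 3) (by linarith)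
      rw [intervalIntegrable_iff_integrableOn_Ioc_of_le zero_le_one] at this
      exact this.const_mul _
    refine lt_of_le_of_lt ?_ hi.lintegral_lt_top
    refine setLIntegral_mono' measurableSet_Ioc fun t ht => ?_
    refine (mul_le_mul_left (hb2 t ht.1) _).trans (le_of_eq ?_)
    rw [← ENNReal.ofReal_mul (by positivity)]
    congr 1
    have : t ^ (r - 3) = t ^ (r - 1) * t⁻¹ ^ 2 := by
      rw [inv_pow, ← Real.rpow_natCast, ← Real.rpow_neg ht.1.le, ← Real.rpow_add ht.1]
      congr 1; push_cast; ring
    rw [this]; ring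
  · have hi : IntegrableOn (fun t : ℝ => C * t ^ (-3 : ℝ)) (Set.Ioi 1) volume :=
      (integrableOn_Ioi_rpow_of_lt (by norm_num) one_pos).const_mul _
    refine lt_of_le_of_lt ?_ hi.lintegral_lt_top
    refine setLIntegral_mono' measurableSet_Ioi fun t ht => ?_
    have ht0 : (0 : ℝ) < t := lt_trans one_pos ht
    refine (mul_le_mul_left (hb t ht0) _).trans (le_of_eq ?_)
    rw [← ENNReal.ofReal_mul (by positivity)]
    congr 1
    rw [mul_assoc, ← Real.rpow_add ht0]
    congr 2; ring

/-! ### Positivity and singularity of the denominator. -/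

/-- The AM-GM inequality for βz³/2, βz³/2, γ, in the form (βz − 2t)²(βz + t) ≥ 0. Equality at βz =
2t shows that 3t is the critical speed. -/
lemma mul_sq_le_of_amgm {β γ z t : ℝ} (hβ : 0 < β) (hz : 0 ≤ z) (ht : 0 ≤ t)
    (ht3 : t ^ 3 = β ^ 2 * γ / 4) : 3 * t * z ^ 2 ≤ β * z ^ 3 + γ := by
  have h1 : 0 ≤ (β * z - 2 * t) ^ 2 * (β * z + t) := by positivity
  have h2 : (β * z - 2 * t) ^ 2 * (β * z + t) = β ^ 2 * (β * z ^ 3 + γ - 3 * t * z ^ 2) := by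
    have : γ * β ^ 2 = 4 * t ^ 3 := by rw [ht3]; ring
    linear_combination -this
  rw [h2] at h1
  have := nonneg_of_mul_nonneg_right h1 (by positivity)
  linarith

/-- With θ = max(c,0)/c_* < 1, subtracting θ times the AM-GM inequality leaves (1 − θ)(βz³ + γ),
which dominates (1+|ξ|)³. -/
lemma exists_denom_lower {β γ c : ℝ} (hβ : 0 < β) (hγ : 0 < γ)
    (hc : c < 3 * (β ^ 2 * γ / 4) ^ (1 / 3 : ℝ)) :
    ∃ κ : ℝ, 0 < κ ∧ ∀ ξ, κ * (1 + |ξ|) ^ 3 ≤ denom β c γ ξ := by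
  set t : ℝ := (β ^ 2 * γ / 4) ^ (1 / 3 : ℝ) with ht
  have ht0 : 0 < t := by positivity
  have ht3 : t ^ 3 = β ^ 2 * γ / 4 := by
    rw [ht, ← Real.rpow_natCast, ← Real.rpow_mul (by positivity)]
    norm_num
  set θ : ℝ := max c 0 / (3 * t) with hθ
  have hθ1 : θ < 1 := by
    rw [hθ, div_lt_one (by positivity)]
    exact max_lt hc (by positivity)
  have hθ0 : 0 ≤ θ := div_nonneg (le_max_right _ _) (by positivity)
  have hcθ : c ≤ θ * (3 * t) := by
    rw [hθ, div_mul_cancel₀ _ (by positivity)]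
    exact le_max_left _ _
  have hm : 0 < min β γ := lt_min hβ hγ
  refine ⟨(1 - θ) * (min β γ) / 4, by have := sub_pos.2 hθ1; positivity, fun ξ => ?_⟩
  set z := |2 * Real.pi * ξ| with hz
  have hz0 : 0 ≤ z := abs_nonneg _
  have hzξ : |ξ| ≤ z := by
    rw [hz, abs_mul, abs_of_pos (by positivity : 0 < 2 * Real.pi)]
    have := Real.pi_gt_three
    nlinarith [abs_nonneg ξ]
  have hden : denom β c γ ξ = β * z ^ 3 - c * z ^ 2 + γ := by
    rw [denom, hz, sq_abs]
  have h1 := mul_sq_le_of_amgm hβ hz0 ht0.le ht3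
  have h2 : (1 - θ) * (β * z ^ 3 + γ) ≤ denom β c γ ξ := by
    rw [hden]
    have h3 : c * z ^ 2 ≤ θ * (3 * t) * z ^ 2 := by gcongr
    have h4 : θ * (3 * t * z ^ 2) ≤ θ * (β * z ^ 3 + γ) := by gcongr
    nlinarith
  refine le_trans ?_ h2
  have h5 : min β γ * (1 + z ^ 3) ≤ β * z ^ 3 + γ := by
    have h6 : min β γ * z ^ 3 ≤ β * z ^ 3 := by gcongr; exact min_le_left _ _
    have := min_le_right β γ
    nlinarith
  have h7 : (1 + |ξ|) ^ 3 ≤ 4 * (1 + z ^ 3) := by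
    have h8 : (1 + |ξ|) ^ 3 ≤ (1 + z) ^ 3 := by gcongr
    have h9 : (1 + z) ^ 3 ≤ 4 * (1 + z ^ 3) := by
      nlinarith [mul_nonneg (by linarith : 0 ≤ 1 + z) (sq_nonneg (1 - z))]
    linarith
  have h10 : 0 ≤ 1 - θ := by linarith
  calc (1 - θ) * min β γ / 4 * (1 + |ξ|) ^ 3 ≤ (1 - θ) * min β γ / 4 * (4 * (1 + z ^ 3)) := by
        gcongr
    _ = (1 - θ) * (min β γ * (1 + z ^ 3)) := by ring
    _ ≤ _ := by gcongr

/-- Since |ξ|³ = ξ³ sgn ξ, three multiplications by ξ smooth the jump of the sign: it reappears in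
the third derivative. The rest is polynomial. -/
lemma sym_denom (β c γ : ℝ) (M : ℕ) : Sym M 3 3 (fun ξ => (denom β c γ ξ : ℂ)) := by
  have h1 := (Sym.id_pow_mul (fun M => sym_sign M) 3 M).const_mul (β * (2 * Real.pi) ^ 3)
  have h2 := ((Sym.id_pow_mul (N := 3) (fun M => sym_const M 3 1) 2 M).mono le_rfl
    (by omega : 3 ≤ 3 + 2) (by norm_num : (0 : ℤ) + (2 : ℕ) ≤ 3)).const_mul (-(c * (2 * Real.pi) ^ 2))
  have h3 := (sym_const M 3 γ).mono le_rfl le_rfl (by norm_num : (0 : ℤ) ≤ 3)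
  have h := ((h1.mono le_rfl le_rfl (by norm_num : (0 : ℤ) + (3 : ℕ) ≤ 3)).add h2).add h3
  convert h using 1
  funext ξ
  rw [denom, abs_mul, abs_of_pos (by positivity : 0 < 2 * Real.pi)]
  have h4 : |ξ| ^ 3 = ξ ^ 3 * (SignType.sign ξ : ℝ) := by
    rcases lt_trichotomy ξ 0 with h | h | h
    · rw [abs_of_neg h, sign_neg h]; simp; ring
    · simp [h]
    · rw [abs_of_pos h, sign_pos h]; simp
  rw [mul_pow, h4]
  push_cast
  ring

lemma sym_denom_inv {β γ c : ℝ} (hβ : 0 < β) (hγ : 0 < γ)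
    (hc : c < 3 * (β ^ 2 * γ / 4) ^ (1 / 3 : ℝ)) (M : ℕ) :
    Sym M 3 (-3) (fun ξ => (denom β c γ ξ : ℂ)⁻¹) := by
  obtain ⟨κ, hκ, hlow⟩ := exists_denom_lower hβ hγ hc
  have hpos : ∀ ξ, 0 < denom β c γ ξ := fun ξ =>
    lt_of_lt_of_le (by have := one_add_abs_pos ξ; positivity) (hlow ξ)
  refine (sym_denom β c γ M).inv (fun ξ => by exact_mod_cast (hpos ξ).ne') ?_
  refine ⟨κ⁻¹, by positivity, fun ξ => ?_⟩
  have h1 := one_add_abs_pos ξ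
  rw [norm_inv, Complex.norm_real, Real.norm_of_nonneg (hpos ξ).le, zpow_neg, ← mul_inv]
  exact inv_anti₀ (by positivity) (by exact_mod_cast hlow ξ)

/-- The factor ξ^k postpones the possible jump at the origin to the derivative of order 3 + k. This
count becomes the number of moments in L², and so fixes the weights of the theorem. -/
lemma sym_pow_div_denom {β γ c : ℝ} (hβ : 0 < β) (hγ : 0 < γ)
    (hc : c < 3 * (β ^ 2 * γ / 4) ^ (1 / 3 : ℝ)) (k M : ℕ) :
    Sym M (3 + k) (-3 + k) (fun ξ => (ξ : ℂ) ^ k * (denom β c γ ξ : ℂ)⁻¹) :=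
  Sym.id_pow_mul (fun M => sym_denom_inv hβ hγ hc M) k M

/-! ### Homogeneous nonlinearities. -/

section nonlinearity

variable {p : ℝ} {f : ℝ → ℝ}

lemma homogeneous_zero (hp : 1 < p) (hhom : ∀ t : ℝ, 0 < t → ∀ s : ℝ, f (t * s) = t ^ p * f s) :
    f 0 = 0 := by
  have h := hhom 2 two_pos 0
  have h2 : (1 : ℝ) < 2 ^ p := Real.one_lt_rpow (by norm_num) (by linarith)
  rw [mul_zero] at h
  nlinarith

lemma homogeneous_le (hp : 1 < p) (hhom : ∀ t : ℝ, 0 < t → ∀ s : ℝ, f (t * s) = t ^ p * f s)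
    (s : ℝ) : |f s| ≤ (|f 1| + |f (-1)|) * |s| ^ p := by
  have hp0 : p ≠ 0 := by linarith
  rcases lt_trichotomy s 0 with h | h | h
  · have h1 := hhom (-s) (by linarith) (-1)
    rw [mul_neg_one, neg_neg] at h1
    rw [h1, abs_mul, abs_of_neg h, abs_of_nonneg (Real.rpow_nonneg (by linarith) _), mul_comm]
    exact mul_le_mul_of_nonneg_right (by linarith [abs_nonneg (f 1)])
      (Real.rpow_nonneg (by linarith) _)
  · rw [h, homogeneous_zero hp hhom]; simp [hp0]
  · have h1 := hhom s h 1
    rw [mul_one] at h1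
    rw [h1, abs_mul, abs_of_pos h, abs_of_nonneg (Real.rpow_nonneg h.le _), mul_comm]
    gcongr
    linarith [abs_nonneg (f (-1))]

lemma homogeneous_deriv_zero (hp : 1 < p) (hf : ContDiff ℝ 2 f)
    (hhom : ∀ t : ℝ, 0 < t → ∀ s : ℝ, f (t * s) = t ^ p * f s) : deriv f 0 = 0 := by
  have h0 := homogeneous_zero hp hhom
  have hd : HasDerivAt f (deriv f 0) 0 := (hf.differentiable (by norm_num) 0).hasDerivAt
  have h1 : Tendsto (fun t : ℝ => t⁻¹ * f t) (𝓝[>] 0) (𝓝 (deriv f 0)) := by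
    have := hd.tendsto_slope_zero_right
    simpa [h0] using this
  have h2 : Tendsto (fun t : ℝ => t ^ (p - 1) * f 1) (𝓝[>] 0) (𝓝 0) := by
    have h3 : Tendsto (fun t : ℝ => t ^ (p - 1)) (𝓝[>] 0) (𝓝 0) := by
      have := (Real.continuousAt_rpow_const 0 (p - 1) (Or.inr (by linarith))).tendsto
      rw [Real.zero_rpow (by linarith)] at this
      exact this.mono_left nhdsWithin_le_nhds
    simpa using h3.mul_const (f 1)
  refine tendsto_nhds_unique (h1.congr' ?_) h2
  filter_upwards [self_mem_nhdsWithin] with t ht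
  have ht' : (0 : ℝ) < t := ht
  have := hhom t ht' 1
  rw [mul_one] at this
  rw [this, Real.rpow_sub_one ht'.ne']
  field_simp

lemma exists_bound_Icc {h : ℝ → ℝ} (hh : Continuous h) (R : ℝ) :
    ∃ C, 0 ≤ C ∧ ∀ s, |s| ≤ R → |h s| ≤ C := by
  obtain ⟨C, hC⟩ := (isCompact_Icc (a := -R) (b := R)).exists_bound_of_continuousOn hh.continuousOn
  refine ⟨max C 0, le_max_right _ _, fun s hs => ?_⟩
  exact (hC s (abs_le.1 hs)).trans (le_max_left _ _)

lemma exists_lipschitz_Icc {h : ℝ → ℝ} (hh : ContDiff ℝ 1 h) (R : ℝ) :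
    ∃ C, 0 ≤ C ∧ ∀ s t, |s| ≤ R → |t| ≤ R → |h s - h t| ≤ C * |s - t| := by
  obtain ⟨C, hC, hb⟩ := exists_bound_Icc (hh.continuous_deriv le_rfl) R
  refine ⟨C, hC, fun s t hs ht => ?_⟩
  exact (convex_Icc (-R) R).norm_image_sub_le_of_norm_deriv_le
    (fun x _ => hh.differentiable one_ne_zero x) (fun x hx => hb x (abs_le.2 hx))
    (abs_le.1 ht) (abs_le.1 hs)

/-- Homogeneity of degree p > 1 forces f(0) = f'(0) = 0, and f' is Lipschitz on bounded sets. The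
power 2, independent of p, is what the decay argument uses. -/
lemma homogeneous_quadratic (hp : 1 < p) (hf : ContDiff ℝ 2 f)
    (hhom : ∀ t : ℝ, 0 < t → ∀ s : ℝ, f (t * s) = t ^ p * f s) (R : ℝ) :
    ∃ C, 0 ≤ C ∧ ∀ s, |s| ≤ R → |f s| ≤ C * s ^ 2 := by
  have hf' : ContDiff ℝ 1 (deriv f) := by
    have h2 : ContDiff ℝ (1 + 1) f := by rw [one_add_one_eq_two]; exact hf
    exact (contDiff_succ_iff_deriv.1 h2).2.2
  obtain ⟨C, hC, hb⟩ := exists_lipschitz_Icc hf' R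
  refine ⟨C, hC, fun s hs => ?_⟩
  have h0 := homogeneous_deriv_zero hp hf hhom
  have h1 := (convex_Icc (-|s|) |s|).norm_image_sub_le_of_norm_deriv_le (f := f) (C := C * |s|)
    (x := 0) (y := s) (fun x _ => hf.differentiable (by norm_num) x) (fun x hx => ?_) (by simp)
    (abs_le.1 le_rfl)
  · rw [homogeneous_zero hp hhom, sub_zero, sub_zero, Real.norm_eq_abs, Real.norm_eq_abs] at h1
    rw [← sq_abs s]
    linarith
  · have hx' := abs_le.2 hx
    have h2 := hb x 0 (hx'.trans hs) (by simpa using (abs_nonneg s).trans hs)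
    rw [h0, sub_zero, sub_zero] at h2
    exact h2.trans (by gcongr)

lemma memLp_homogeneous {φ : ℝ → ℝ} (hp : 1 < p) (hf : Continuous f)
    (hhom : ∀ t : ℝ, 0 < t → ∀ s : ℝ, f (t * s) = t ^ p * f s)
    (hφ : MemLp φ (ENNReal.ofReal (2 * p)) volume) : MemLp (fun x => f (φ x)) 2 volume := by
  have hp0 : 0 < p := by linarith
  have h1 := hφ.norm_rpow_div (ENNReal.ofReal p)
  rw [ENNReal.toReal_ofReal hp0.le, ← ENNReal.ofReal_div_of_pos hp0,
    mul_div_cancel_right₀ _ hp0.ne'] at h1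
  have h2 : ENNReal.ofReal 2 = 2 := by norm_num
  rw [h2] at h1
  refine h1.of_le_mul (c := |f 1| + |f (-1)|)
    (hf.comp_aestronglyMeasurable hφ.1) (Eventually.of_forall fun x => ?_)
  have := homogeneous_le hp hhom (φ x)
  rw [Real.norm_eq_abs, Real.norm_of_nonneg (Real.rpow_nonneg (norm_nonneg _) _), Real.norm_eq_abs]
  exact this

end nonlinearity

/-! ### The continuous representative of a wave. -/

/-- The Fourier multiplier `-ζ² / D(ζ)` that recovers `φ` from `f(φ)`. -/
noncomputable def waveSym (β c γ ξ : ℝ) : ℂ :=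
  -(2 * Real.pi) ^ 2 * ((ξ : ℂ) ^ 2 * (denom β c γ ξ : ℂ)⁻¹)

lemma fourierInv_eq_integral_exp (U : ℝ → ℂ) (x : ℝ) :
    𝓕⁻ U x = ∫ ξ : ℝ, Complex.exp (2 * Real.pi * Complex.I * x * ξ) * U ξ := by
  rw [Real.fourierInv_eq']
  congr 1
  funext ξ
  rw [smul_eq_mul]
  congr 2
  simp
  ring

/-- The properties of the continuous representative of a solitary wave, coming from the equation
`φ̂ = -ζ² / D(ζ) * (f(φ))^`. -/
structure IsWave (β c γ : ℝ) (f φ : ℝ → ℝ) : Prop where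
  cont : Continuous φ
  zero : Tendsto φ (cocompact ℝ) (𝓝 0)
  eq : ∃ G, IsFT (fun x => (f (φ x) : ℂ)) G ∧ WL2 1 (fun ξ => waveSym β c γ ξ * G ξ) ∧
    IsFT (fun x => (φ x : ℂ)) (fun ξ => waveSym β c γ ξ * G ξ) ∧
    ∀ x, (φ x : ℂ) = 𝓕⁻ (fun ξ => waveSym β c γ ξ * G ξ) x

lemma tendsto_fourierInv_cocompact (U : ℝ → ℂ) : Tendsto (𝓕⁻ U) (cocompact ℝ) (𝓝 0) := by
  have h := Real.zero_at_infty_fourier U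
  have h2 := h.comp (Homeomorph.neg ℝ).isClosedEmbedding.tendsto_cocompact
  refine h2.congr fun x => ?_
  rw [Real.fourierInv_eq_fourier_neg]
  rfl

lemma continuous_fourierInv {U : ℝ → ℂ} (hU : Integrable U volume) : Continuous (𝓕⁻ U) := by
  have := (continuous_fourier hU).comp continuous_neg
  refine this.congr fun x => ?_
  rw [Real.fourierInv_eq_fourier_neg]
  rfl

lemma sym_waveSym {β γ c : ℝ} (hβ : 0 < β) (hγ : 0 < γ)
    (hc : c < 3 * (β ^ 2 * γ / 4) ^ (1 / 3 : ℝ)) (M : ℕ) :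
    Sym M 5 (-1) (waveSym β c γ) := by
  have := (sym_pow_div_denom hβ hγ hc 2 M).const_mul (-(2 * Real.pi) ^ 2)
  exact this.mono le_rfl (by norm_num) (by norm_num)

/-- The embedding puts f(φ) in L², and the multiplier of order −1 then puts the transform of φ in
`WL2 1`, hence in L¹. Its inverse Fourier integral is continuous, vanishes at infinity by
Riemann–Lebesgue, and is real everywhere because it is real almost everywhere. -/
lemma exists_isWave {β γ c p : ℝ} (hβ : 0 < β) (hγ : 0 < γ)
    (hc : c < 3 * (β ^ 2 * γ / 4) ^ (1 / 3 : ℝ)) (hp : 1 < p) {f φ : ℝ → ℝ} (hf : Continuous f)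
    (hhom : ∀ t : ℝ, 0 < t → ∀ s : ℝ, f (t * s) = t ^ p * f s)
    (h : IsSolitaryWave β c γ f φ) : ∃ φ₀, φ =ᵐ[volume] φ₀ ∧ IsWave β c γ f φ₀ := by
  obtain ⟨hφ, hs⟩ := h.1.1
  obtain ⟨Φ, hΦ⟩ := exists_isFT (u := fun x => (φ x : ℂ)) hφ.ofReal
  have hφr : MemLp φ (ENNReal.ofReal (2 * p)) volume := by
    have h1 := memLp_of_memSobolev hΦ hs
    rw [show (1 / 2 / 2 : ℝ) = 1 / 4 by norm_num] at h1
    have h2 := hΦ.memLp_of_half h1 (r := 2 * p) (by linarith)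
    exact (h2.re).congr_norm hφ.1 (by simp)
  have hg := memLp_homogeneous hp hf hhom hφr
  obtain ⟨G, hG⟩ := exists_isFT (u := fun x => (f (φ x) : ℂ)) hg.ofReal
  have heq := h.fourier_eq hΦ hG
  obtain ⟨κ, hκ, hlow⟩ := exists_denom_lower hβ hγ hc
  have hΦ2 : Φ =ᵐ[volume] fun ξ => waveSym β c γ ξ * G ξ := by
    filter_upwards [heq] with ξ hξ
    have h1 := one_add_abs_pos ξ
    have h2 : (denom β c γ ξ : ℂ) ≠ 0 := by
      have : 0 < denom β c γ ξ := lt_of_lt_of_le (by positivity) (hlow ξ)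
      exact_mod_cast this.ne'
    rw [waveSym, ← mul_right_inj' h2, hξ]
    field_simp
  have hΦ3 := hΦ.congr_right hΦ2
  have hw : WL2 1 (fun ξ => waveSym β c γ ξ * G ξ) := by
    have hS := (sym_waveSym hβ hγ hc 0)
    exact hS.2.2.mul_wl2 hS.1 (wl2_zero_iff.2 hG.right) (by norm_num)
  have hae := hΦ3.ae_eq_fourierInv hw.integrable
  have hcont := continuous_fourierInv hw.integrable
  set F := 𝓕⁻ (fun ξ => waveSym β c γ ξ * G ξ) with hF
  have him : ∀ x, (F x).im = 0 := by
    have h1 : (fun x => (F x).im) =ᵐ[volume] fun _ => 0 := by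
      filter_upwards [hae] with x hx
      rw [← hx, Complex.ofReal_im]
    have h2 := (Continuous.ae_eq_iff_eq volume (Complex.continuous_im.comp hcont)
      continuous_const).1 h1
    exact fun x => congrFun h2 x
  have hre : ∀ x, ((F x).re : ℂ) = F x := fun x => Complex.ext (by simp) (by simp [him])
  have hφ0 : φ =ᵐ[volume] fun x => (F x).re := by
    filter_upwards [hae] with x hx
    rw [← hx, Complex.ofReal_re]
  refine ⟨fun x => (F x).re, hφ0, Complex.continuous_re.comp hcont, ?_,
    G, hG.congr_left ?_, hw, hΦ3.congr_left ?_, hre⟩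
  · have := (Complex.continuous_re.tendsto 0).comp
      (tendsto_fourierInv_cocompact (fun ξ => waveSym β c γ ξ * G ξ))
    rw [Complex.zero_re] at this
    exact this
  · filter_upwards [hφ0] with x hx
    rw [hx]
  · filter_upwards [hφ0] with x hx
    rw [hx]

/-! ### Decay of order four. -/

lemma wl2_of_pow {u : ℝ → ℂ} {s : ℕ}
    (h : ∀ j ≤ s, MemLp (fun x : ℝ => (x : ℂ) ^ j * u x) 2 volume) : WL2 s u := by
  induction s generalizing u with
  | zero => simpa [WL2] using h 0 le_rfl
  | succ s ih =>
    refine (ih fun j hj => h j (by omega)).of_id_mul (ih fun j hj => ?_)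
    have := h (j + 1) (by omega)
    simpa only [pow_succ, mul_assoc] using this

lemma WL2.integrable_weight {K : ℝ → ℂ} {s : ℕ} (h : WL2 (s + 1) K) :
    Integrable (fun x : ℝ => (1 + |x|) ^ s * ‖K x‖) volume := by
  have h1 : WL2 1 (fun x : ℝ => (((1 + |x|) ^ s : ℝ) : ℂ) * K x) := by
    refine h.of_le ?_ 1 ?_
    · have hc : Continuous fun ξ : ℝ => ((((1 + |ξ|) ^ s : ℝ) : ℂ)) := by fun_prop
      exact hc.aestronglyMeasurable.mul h.aestronglyMeasurable
    · filter_upwards with ξ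
      rw [norm_mul, norm_weight, pow_succ]
      exact le_of_eq (by ring)
  refine h1.integrable.norm.congr ?_
  filter_upwards with x
  rw [norm_mul, norm_weight]

/-- A bootstrap argument: a function vanishing at infinity and dominated by the convolution of its
square with a kernel having moments of order `s` decays with order `s`. -/
lemma decay_of_convolution {φ k : ℝ → ℝ} {s : ℕ} {C : ℝ} (hcont : Continuous φ)
    (hzero : Tendsto φ (cocompact ℝ) (𝓝 0)) (hk0 : ∀ y, 0 ≤ k y) (hC : 0 ≤ C)
    (hk : Integrable (fun y => (1 + |y|) ^ s * k y) volume)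
    (hle : ∀ x, |φ x| ≤ ∫ y, k y * (C * φ (x - y) ^ 2)) :
    ∃ B, ∀ x, (1 + |x|) ^ s * |φ x| ≤ B := by
  set I := ∫ y, (1 + |y|) ^ s * k y with hI
  have hI0 : 0 ≤ I := integral_nonneg fun y => by
    have := one_add_abs_pos y
    have := hk0 y
    positivity
  obtain ⟨B0, hB0⟩ : ∃ B0, ∀ x, |φ x| ≤ B0 := by
    obtain ⟨B, hB⟩ := (ZeroAtInftyContinuousMap.isBounded_range
      (⟨⟨φ, hcont⟩, hzero⟩ : ZeroAtInftyContinuousMap ℝ ℝ)).exists_norm_le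
    exact ⟨B, fun x => hB _ ⟨x, rfl⟩⟩
  have hB0' : 0 ≤ B0 := (abs_nonneg _).trans (hB0 0)
  -- Where |φ| ≤ ε, one factor of φ² is small enough for the far contribution to be absorbed: I·C·ε
  -- ≤ 1/2.
  set ε : ℝ := 1 / (2 * (I * C + 1)) with hε
  have hε0 : 0 < ε := by positivity
  have hIε : I * (C * ε) ≤ 1 / 2 := by
    rw [hε, ← mul_assoc, mul_one_div, div_le_div_iff₀ (by positivity) (by norm_num)]
    nlinarith [mul_nonneg hI0 hC]
  obtain ⟨R, hR⟩ : ∃ R, ∀ z, R < |z| → |φ z| ≤ ε := by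
    have h1 := hzero.eventually (Metric.closedBall_mem_nhds (0 : ℝ) hε0)
    obtain ⟨t, ht, hsub⟩ := mem_cocompact.1 h1
    obtain ⟨R, hR⟩ := ht.isBounded.exists_norm_le
    refine ⟨R, fun z hz => ?_⟩
    have hz' : z ∈ tᶜ := fun hzt => absurd (hR z hzt) (by rw [Real.norm_eq_abs]; linarith)
    simpa using hsub hz'
  set Q : ℝ := (1 + max R 0) ^ s * (C * B0 ^ 2) with hQ
  have hR0 : 0 ≤ max R 0 := le_max_right _ _
  have hQ0 : 0 ≤ Q := by positivity
  -- The weight is truncated at `N` to make the supremum `S` finite a priori. The resulting bound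
  -- does not depend on `N`, and N = 1 + |x| is inserted at the end.
  have key : ∀ N : ℝ, 1 ≤ N → ∀ x, min (1 + |x|) N ^ s * |φ x| ≤ 2 * (I * Q) := by
    intro N hN
    have hw0 : ∀ x, 0 < min (1 + |x|) N := fun x =>
      lt_min (one_add_abs_pos x) (by linarith)
    have hbdd : BddAbove (Set.range fun x => min (1 + |x|) N ^ s * |φ x|) := by
      refine ⟨N ^ s * B0, ?_⟩
      rintro _ ⟨x, rfl⟩
      exact mul_le_mul (pow_le_pow_left₀ (hw0 x).le (min_le_right _ _) s) (hB0 x) (abs_nonneg _)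
        (by positivity)
    set S := ⨆ x, min (1 + |x|) N ^ s * |φ x| with hS
    have hSx : ∀ x, min (1 + |x|) N ^ s * |φ x| ≤ S := fun x => le_ciSup hbdd x
    have hS0 : 0 ≤ S := le_trans (mul_nonneg (pow_nonneg (hw0 0).le s) (abs_nonneg _)) (hSx 0)
    have hpt : ∀ z, min (1 + |z|) N ^ s * (C * φ z ^ 2) ≤ C * ε * S + Q := by
      intro z
      rcases le_or_gt |z| R with hz | hz
      · have h1 : min (1 + |z|) N ^ s * (C * φ z ^ 2) ≤ Q := by
          rw [hQ]
          have h2 : min (1 + |z|) N ≤ 1 + max R 0 :=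
            (min_le_left _ _).trans (by linarith [le_max_left R 0])
          have h3 : φ z ^ 2 ≤ B0 ^ 2 := sq_le_sq' (by linarith [(abs_le.1 (hB0 z)).1])
            (abs_le.1 (hB0 z)).2
          have := (hw0 z).le
          gcongr
        have : 0 ≤ C * ε * S := by positivity
        linarith
      · have h1 := hR z hz
        calc min (1 + |z|) N ^ s * (C * φ z ^ 2)
            = C * |φ z| * (min (1 + |z|) N ^ s * |φ z|) := by rw [← sq_abs (φ z)]; ring
          _ ≤ C * ε * S := by
              refine mul_le_mul (mul_le_mul_of_nonneg_left h1 hC) (hSx z) ?_ (by positivity)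
              exact mul_nonneg (pow_nonneg (hw0 z).le s) (abs_nonneg _)
          _ ≤ _ := by linarith
    -- Submultiplicativity shares the weight between the moment of the kernel and φ².
    have hsub : ∀ x y, min (1 + |x|) N ≤ (1 + |y|) * min (1 + |x - y|) N := by
      intro x y
      have hy := abs_nonneg y
      have hxy := abs_nonneg (x - y)
      have h1 : |x| ≤ |x - y| + |y| := by simpa using abs_add_le (x - y) y
      rcases le_total (1 + |x - y|) N with h | h
      · rw [min_eq_left h]
        exact (min_le_left _ _).trans (by nlinarith)
      · rw [min_eq_right h]
        exact (min_le_right _ _).trans (by nlinarith)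
    have hbound : ∀ x, min (1 + |x|) N ^ s * |φ x| ≤ I * (C * ε * S + Q) := by
      intro x
      calc min (1 + |x|) N ^ s * |φ x|
          ≤ min (1 + |x|) N ^ s * ∫ y, k y * (C * φ (x - y) ^ 2) :=
            mul_le_mul_of_nonneg_left (hle x) (pow_nonneg (hw0 x).le s)
        _ = ∫ y, min (1 + |x|) N ^ s * (k y * (C * φ (x - y) ^ 2)) := by
            rw [integral_const_mul]
        _ ≤ ∫ y, (1 + |y|) ^ s * k y * (C * ε * S + Q) := by
            refine integral_mono_of_nonneg (Eventually.of_forall fun y => ?_) (hk.mul_const _)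
              (Eventually.of_forall fun y => ?_)
            · exact mul_nonneg (pow_nonneg (hw0 x).le s) (mul_nonneg (hk0 y) (by positivity))
            · have h1 := pow_le_pow_left₀ (hw0 x).le (hsub x y) s
              rw [mul_pow] at h1
              have h2 := hpt (x - y)
              have h3 := one_add_abs_pos y
              have h4 := hk0 y
              calc min (1 + |x|) N ^ s * (k y * (C * φ (x - y) ^ 2))
                  ≤ ((1 + |y|) ^ s * min (1 + |x - y|) N ^ s) * (k y * (C * φ (x - y) ^ 2)) := by
                    gcongr
                _ = (1 + |y|) ^ s * k y * (min (1 + |x - y|) N ^ s * (C * φ (x - y) ^ 2)) := by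
                    ring
                _ ≤ _ := by exact mul_le_mul_of_nonneg_left h2 (by positivity)
        _ = I * (C * ε * S + Q) := by rw [integral_mul_const]
    have hS2 : S ≤ I * (C * ε * S + Q) := ciSup_le hbound
    have : I * (C * ε) * S ≤ 1 / 2 * S := mul_le_mul_of_nonneg_right hIε hS0
    intro x
    refine (hSx x).trans ?_
    nlinarith
  refine ⟨2 * (I * Q), fun x => ?_⟩
  have := key (1 + |x|) (one_le_one_add_abs x) x
  rwa [min_self] at this

/-- The multiplier has a bounded fifth derivative after four continuous ones, so its kernel has five
moments in L² and, by Cauchy–Schwarz, four in L¹. The absorption argument then runs with s = 4. -/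
lemma IsWave.decay {β γ c p : ℝ} (hβ : 0 < β) (hγ : 0 < γ)
    (hc : c < 3 * (β ^ 2 * γ / 4) ^ (1 / 3 : ℝ)) (hp : 1 < p) {f φ : ℝ → ℝ} (hf : ContDiff ℝ 2 f)
    (hhom : ∀ t : ℝ, 0 < t → ∀ s : ℝ, f (t * s) = t ^ p * f s)
    (h : IsWave β c γ f φ) : ∃ B, ∀ x, (1 + |x|) ^ 4 * |φ x| ≤ B := by
  obtain ⟨G, hG, hw, hΦ, heq⟩ := h.eq
  have hch := (sym_waveSym hβ hγ hc 5).chain (t := 0) (by norm_num)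
  obtain ⟨K, hK⟩ := exists_isFT_inv hch.wl2.memLp
  have hK5 : WL2 5 K := wl2_of_pow fun j hj => by
    obtain ⟨V, hV, -⟩ := hch.isFT_pow hK hj
    exact hV.left
  obtain ⟨B0, hB0⟩ : ∃ B0, ∀ x, |φ x| ≤ B0 := by
    obtain ⟨B, hB⟩ := (ZeroAtInftyContinuousMap.isBounded_range
      (⟨⟨φ, h.cont⟩, h.zero⟩ : ZeroAtInftyContinuousMap ℝ ℝ)).exists_norm_le
    exact ⟨B, fun x => hB _ ⟨x, rfl⟩⟩
  obtain ⟨C, hC, hfC⟩ := homogeneous_quadratic hp hf hhom B0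
  refine decay_of_convolution (k := fun y => ‖K y‖) (C := C) h.cont h.zero
    (fun y => norm_nonneg _) hC hK5.integrable_weight fun x => ?_
  have h1 := hK.integral_mul_sub hG x
  rw [← fourierInv_eq_integral_exp, ← heq] at h1
  have hKi : Integrable (fun y => ‖K y‖) volume := (hK5.mono (by norm_num)).integrable.norm
  rw [← Real.norm_eq_abs, ← Complex.norm_real, ← h1]
  refine (norm_integral_le_integral_norm _).trans (integral_mono_of_nonneg
    (Eventually.of_forall fun y => norm_nonneg _) ?_ (Eventually.of_forall fun y => ?_))
  · refine hKi.mul_bdd (c := C * B0 ^ 2) ?_ (Eventually.of_forall fun y => ?_)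
    · have := h.cont
      exact Continuous.aestronglyMeasurable (by fun_prop)
    · have h3 : φ (x - y) ^ 2 ≤ B0 ^ 2 := sq_le_sq' (by linarith [(abs_le.1 (hB0 (x - y))).1])
        (abs_le.1 (hB0 (x - y))).2
      rw [Real.norm_of_nonneg (by positivity)]
      gcongr
  · simp only [norm_mul, Complex.norm_real]
    exact mul_le_mul_of_nonneg_left (hfC _ (hB0 _)) (norm_nonneg _)

/-! ### Classes of functions closed under products, compositions and derivatives. -/

/-- `h` and its first `r` derivatives satisfy `P`. -/
def Iter (P : (ℝ → ℝ) → Prop) : ℕ → (ℝ → ℝ) → Prop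
  | 0, h => P h
  | r + 1, h => P h ∧ Differentiable ℝ h ∧ Iter P r (deriv h)

/-- Composition with `F` and its first `r` derivatives preserves `P`. -/
def CompIter (P : (ℝ → ℝ) → Prop) : ℕ → (ℝ → ℝ) → Prop
  | 0, F => ∀ u, P u → P (fun x => F (u x))
  | r + 1, F => (∀ u, P u → P (fun x => F (u x))) ∧ Differentiable ℝ F ∧ CompIter P r (deriv F)

section Iter

variable {P Q S : (ℝ → ℝ) → Prop} {r : ℕ} {u v F : ℝ → ℝ}

lemma Iter.base (h : Iter P r u) : P u := by
  cases r with
  | zero => exact h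
  | succ r => exact h.1

lemma Iter.imp (hPQ : ∀ u, P u → Q u) (h : Iter P r u) : Iter Q r u := by
  induction r generalizing u with
  | zero => exact hPQ u h
  | succ r ih => exact ⟨hPQ u h.1, h.2.1, ih h.2.2⟩

lemma Iter.mono {r' : ℕ} (h : Iter P r u) (hr : r' ≤ r) : Iter P r' u := by
  induction r' generalizing r u with
  | zero => exact h.base
  | succ r' ih =>
    obtain ⟨r, rfl⟩ : ∃ t, r = t + 1 := ⟨r - 1, by omega⟩
    exact ⟨h.1, h.2.1, ih h.2.2 (by omega)⟩

lemma Iter.add (hadd : ∀ u v, P u → P v → P (fun x => u x + v x)) (hu : Iter P r u)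
    (hv : Iter P r v) : Iter P r (fun x => u x + v x) := by
  induction r generalizing u v with
  | zero => exact hadd u v hu hv
  | succ r ih =>
    refine ⟨hadd u v hu.1 hv.1, hu.2.1.add hv.2.1, ?_⟩
    have : deriv (fun x => u x + v x) = fun x => deriv u x + deriv v x := by
      funext x
      exact deriv_fun_add (hu.2.1 x) (hv.2.1 x)
    rw [this]
    exact ih hu.2.2 hv.2.2

lemma Iter.mul (hadd : ∀ u v, S u → S v → S (fun x => u x + v x))
    (hmul : ∀ u v, P u → Q v → S (fun x => u x * v x)) (hu : Iter P r u)
    (hv : Iter Q r v) : Iter S r (fun x => u x * v x) := by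
  induction r generalizing u v with
  | zero => exact hmul u v hu hv
  | succ r ih =>
    refine ⟨hmul u v hu.1 hv.1, hu.2.1.mul hv.2.1, ?_⟩
    have : deriv (fun x => u x * v x) = fun x => deriv u x * v x + u x * deriv v x := by
      funext x
      exact deriv_fun_mul (hu.2.1 x) (hv.2.1 x)
    rw [this]
    exact Iter.add hadd (ih hu.2.2 (hv.mono (Nat.le_succ r))) (ih (hu.mono (Nat.le_succ r)) hv.2.2)

lemma deriv_fun_comp' {F u : ℝ → ℝ} (hF : Differentiable ℝ F) (hu : Differentiable ℝ u) :
    deriv (fun x => F (u x)) = fun x => deriv F (u x) * deriv u x := by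
  funext x
  exact ((hF (u x)).hasDerivAt.comp x (hu x).hasDerivAt).deriv

lemma Iter.comp (hadd : ∀ u v, P u → P v → P (fun x => u x + v x))
    (hmul : ∀ u v, P u → P v → P (fun x => u x * v x)) (hF : CompIter P r F) (hu : Iter P r u) :
    Iter P r (fun x => F (u x)) := by
  induction r generalizing F with
  | zero => exact hF u hu
  | succ r ih =>
    refine ⟨hF.1 u hu.1, hF.2.1.comp hu.2.1, ?_⟩
    rw [deriv_fun_comp' hF.2.1 hu.2.1]
    exact Iter.mul hadd hmul (ih hF.2.2 (hu.mono (Nat.le_succ r))) hu.2.2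

/-- Derivatives of a composition, in a module `Q` over the algebra `P`. -/
lemma Iter.comp_succ (hadd : ∀ u v, P u → P v → P (fun x => u x + v x))
    (hmul : ∀ u v, P u → P v → P (fun x => u x * v x))
    (hadd' : ∀ u v, Q u → Q v → Q (fun x => u x + v x))
    (hmul' : ∀ u v, P u → Q v → Q (fun x => u x * v x)) (hF : Differentiable ℝ F)
    (hF' : CompIter P r (deriv F)) (hu : Iter P r u) (hd : Differentiable ℝ u)
    (hu' : Iter Q r (deriv u)) (h0 : Q (fun x => F (u x))) :
    Iter Q (r + 1) (fun x => F (u x)) := by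
  refine ⟨h0, hF.comp hd, ?_⟩
  rw [deriv_fun_comp' hF hd]
  exact Iter.mul hadd' hmul' (Iter.comp hadd hmul hF' hu) hu'

lemma Iter.prop_iteratedDeriv (h : Iter P r u) {i : ℕ} (hi : i ≤ r) : P (iteratedDeriv i u) := by
  induction i generalizing r u with
  | zero => rw [iteratedDeriv_zero]; exact h.base
  | succ i ih =>
    obtain ⟨r, rfl⟩ : ∃ t, r = t + 1 := ⟨r - 1, by omega⟩
    rw [iteratedDeriv_succ']
    exact ih h.2.2 (by omega)

lemma ContDiff.compIter {k : ℕ} (hP : ∀ F : ℝ → ℝ, ContDiff ℝ k F → ∀ u, P u → P (fun x => F (u x)))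
    (hF : ContDiff ℝ (r + k : ℕ) F) : CompIter P r F := by
  induction r generalizing F with
  | zero => exact hP F (by simpa using hF)
  | succ r ih =>
    have h1 : ContDiff ℝ ((r + k : ℕ) + 1) F := by
      refine hF.of_le ?_
      exact_mod_cast (by omega : r + k + 1 ≤ r + 1 + k)
    refine ⟨hP F (hF.of_le ?_), h1.differentiable (by simp),
      ih (contDiff_succ_iff_deriv.1 h1).2.2⟩
    exact_mod_cast (by omega : k ≤ r + 1 + k)

/-- If `P` gives `L²` control on the Fourier side, so does `Iter P r`, with `r` more powers. -/
lemma Iter.wl2 {k : ℕ} {H : ℝ → ℂ} (hP2 : ∀ h, P h → Continuous h ∧ MemLp h 2 volume)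
    (hP : ∀ h H, P h → IsFT (fun x => (h x : ℂ)) H → WL2 k H) (hu : Iter P r u)
    (hH : IsFT (fun x => (u x : ℂ)) H) : WL2 (k + r) H := by
  induction r generalizing u H with
  | zero => exact hP u H hu hH
  | succ r ih =>
    have h1 := hH.deriv (u' := fun x => ((deriv u x : ℝ) : ℂ))
      (Complex.continuous_ofReal.comp (hP2 u hu.1).1)
      (fun x _ => (hu.2.1 x).hasDerivAt.ofReal_comp) (hP2 _ hu.2.2.base).2.ofReal
    have h2 := (ih hu.2.2 h1).const_mul (2 * Real.pi * Complex.I)⁻¹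
    refine (ih (hu.mono (Nat.le_succ r)) hH).of_id_mul ?_
    convert h2 using 2 with ξ
    have : (Real.pi : ℂ) ≠ 0 := by exact_mod_cast Real.pi_ne_zero
    field_simp

end Iter

/-- Bounded continuous functions. -/
def BddCont (h : ℝ → ℝ) : Prop := Continuous h ∧ ∃ B, ∀ x, |h x| ≤ B

lemma BddCont.add {u v : ℝ → ℝ} (hu : BddCont u) (hv : BddCont v) :
    BddCont (fun x => u x + v x) := by
  obtain ⟨hu, B, hB⟩ := hu
  obtain ⟨hv, B', hB'⟩ := hv
  exact ⟨hu.add hv, B + B', fun x => (abs_add_le _ _).trans (add_le_add (hB x) (hB' x))⟩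

lemma BddCont.mul {u v : ℝ → ℝ} (hu : BddCont u) (hv : BddCont v) :
    BddCont (fun x => u x * v x) := by
  obtain ⟨hu, B, hB⟩ := hu
  obtain ⟨hv, B', hB'⟩ := hv
  refine ⟨hu.mul hv, B * B', fun x => ?_⟩
  rw [abs_mul]
  exact mul_le_mul (hB x) (hB' x) (abs_nonneg _) ((abs_nonneg _).trans (hB x))

lemma BddCont.comp {u F : ℝ → ℝ} (hF : Continuous F) (hu : BddCont u) :
    BddCont (fun x => F (u x)) := by
  obtain ⟨hu, B, hB⟩ := hu
  obtain ⟨C, -, hC⟩ := exists_bound_Icc hF B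
  exact ⟨hF.comp hu, C, fun x => hC _ (hB x)⟩

/-- Bounded continuous functions with Lipschitz translations in `L²`. -/
def BddTransLip (h : ℝ → ℝ) : Prop := BddCont h ∧ TransLip (fun x => (h x : ℂ))

/-- A pointwise bound on increments suffices; this covers sums, products of bounded functions and
composition with C¹ functions alike. -/
lemma TransLip.of_le {u v w : ℝ → ℂ} (hu : TransLip u) (hv : TransLip v) {A B : ℝ}
    (hA : 0 ≤ A) (hB : 0 ≤ B) (hm : ∀ η, AEStronglyMeasurable (fun x => u (x + η) - u x) volume)
    (hm' : ∀ η, AEStronglyMeasurable (fun x => v (x + η) - v x) volume)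
    (hle : ∀ x η, ‖w (x + η) - w x‖ ≤ A * ‖u (x + η) - u x‖ + B * ‖v (x + η) - v x‖) :
    TransLip w := by
  obtain ⟨C, hC, hu⟩ := hu
  obtain ⟨D, hD, hv⟩ := hv
  refine ⟨A * C + B * D, by positivity, fun η => ?_⟩
  calc eLpNorm (fun x => w (x + η) - w x) 2 volume
      ≤ eLpNorm ((fun x => A * ‖u (x + η) - u x‖) + fun x => B * ‖v (x + η) - v x‖) 2 volume := by
        refine eLpNorm_mono_real fun x => hle x η
    _ ≤ eLpNorm (fun x => A * ‖u (x + η) - u x‖) 2 volume +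
          eLpNorm (fun x => B * ‖v (x + η) - v x‖) 2 volume :=
        eLpNorm_add_le ((hm η).norm.const_mul _) ((hm' η).norm.const_mul _) (by norm_num)
    _ ≤ ENNReal.ofReal (A * (C * |η|)) + ENNReal.ofReal (B * (D * |η|)) := by
        refine add_le_add ?_ ?_
        · rw [show (fun x => A * ‖u (x + η) - u x‖) = A • fun x => ‖u (x + η) - u x‖ from rfl,
            eLpNorm_const_smul, eLpNorm_norm, Real.enorm_of_nonneg hA, ENNReal.ofReal_mul hA]
          gcongr
          exact hu η
        · rw [show (fun x => B * ‖v (x + η) - v x‖) = B • fun x => ‖v (x + η) - v x‖ from rfl,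
            eLpNorm_const_smul, eLpNorm_norm, Real.enorm_of_nonneg hB, ENNReal.ofReal_mul hB]
          gcongr
          exact hv η
    _ = _ := by
        rw [← ENNReal.ofReal_add (by positivity) (by positivity)]
        congr 1; ring

lemma BddTransLip.measurable_sub {u : ℝ → ℝ} (h : BddTransLip u) (η : ℝ) :
    AEStronglyMeasurable (fun x => (u (x + η) : ℂ) - u x) volume := by
  have := h.1.1
  exact Continuous.aestronglyMeasurable (by fun_prop)

lemma BddTransLip.add {u v : ℝ → ℝ} (hu : BddTransLip u) (hv : BddTransLip v) :
    BddTransLip (fun x => u x + v x) := by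
  refine ⟨hu.1.add hv.1, hu.2.of_le hv.2 zero_le_one zero_le_one hu.measurable_sub
    hv.measurable_sub fun x η => ?_⟩
  rw [one_mul, one_mul]
  refine le_trans (le_of_eq ?_) (norm_add_le _ _)
  congr 1
  push_cast
  ring

lemma BddTransLip.mul {u v : ℝ → ℝ} (hu : BddTransLip u) (hv : BddTransLip v) :
    BddTransLip (fun x => u x * v x) := by
  obtain ⟨B, hB⟩ := hu.1.2
  obtain ⟨B', hB'⟩ := hv.1.2
  refine ⟨hu.1.mul hv.1, hu.2.of_le hv.2 ((abs_nonneg _).trans (hB' 0))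
    ((abs_nonneg _).trans (hB 0)) hu.measurable_sub hv.measurable_sub fun x η => ?_⟩
  have h1 : ((u (x + η) * v (x + η) : ℝ) : ℂ) - ((u x * v x : ℝ) : ℂ) =
      v (x + η) * ((u (x + η) : ℂ) - u x) + u x * ((v (x + η) : ℂ) - v x) := by
    push_cast; ring
  rw [h1]
  refine (norm_add_le _ _).trans ?_
  rw [norm_mul, norm_mul, Complex.norm_real, Complex.norm_real]
  exact add_le_add (mul_le_mul_of_nonneg_right (hB' _) (norm_nonneg _))
    (mul_le_mul_of_nonneg_right (hB _) (norm_nonneg _))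

lemma BddTransLip.comp {u F : ℝ → ℝ} (hF : ContDiff ℝ 1 F) (hu : BddTransLip u) :
    BddTransLip (fun x => F (u x)) := by
  obtain ⟨B, hB⟩ := hu.1.2
  obtain ⟨C, hC, hL⟩ := exists_lipschitz_Icc hF B
  refine ⟨hu.1.comp hF.continuous, hu.2.of_le hu.2 hC le_rfl hu.measurable_sub
    hu.measurable_sub fun x η => ?_⟩
  rw [zero_mul, add_zero, ← Complex.ofReal_sub, ← Complex.ofReal_sub, Complex.norm_real,
    Complex.norm_real]
  exact hL _ _ (hB _) (hB _)

/-! ### Derivatives of inverse Fourier integrals. -/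

/-- The real function `u` is the inverse Fourier integral of `U`. -/
def IsInv (u : ℝ → ℝ) (U : ℝ → ℂ) : Prop := ∀ x, (u x : ℂ) = 𝓕⁻ U x

lemma IsInv.isFT {u : ℝ → ℝ} {U : ℝ → ℂ} (h : IsInv u U) (hU : WL2 1 U) :
    IsFT (fun x => (u x : ℂ)) U := by
  have := isFT_fourierInv hU.integrable hU.memLp
  rwa [show 𝓕⁻ U = fun x => (u x : ℂ) from funext fun x => (h x).symm] at this

lemma IsInv.bddCont {u : ℝ → ℝ} {U : ℝ → ℂ} (h : IsInv u U) (hU : WL2 1 U) : BddCont u := by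
  constructor
  · have h1 := Complex.continuous_re.comp (continuous_fourierInv hU.integrable)
    refine h1.congr fun x => ?_
    rw [Function.comp_apply, ← h x, Complex.ofReal_re]
  · refine ⟨∫ ξ, ‖U ξ‖, fun x => ?_⟩
    rw [← Real.norm_eq_abs, ← Complex.norm_real, h x, fourierInv_eq_integral_exp]
    refine (norm_integral_le_integral_norm _).trans (le_of_eq ?_)
    simp only [norm_mul, norm_exp_two_pi_mul, one_mul]

lemma hasDerivAt_fourierInv {U : ℝ → ℂ} (hU : WL2 2 U) (x : ℝ) :
    HasDerivAt (𝓕⁻ U) (𝓕⁻ (fun ξ => 2 * Real.pi * Complex.I * ξ * U ξ) x) x := by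
  have h1 := Real.hasDerivAt_fourier (hU.mono (by norm_num)).integrable
    (by simpa using hU.id_mul.integrable) (-x)
  have h2 := h1.scomp x (hasDerivAt_neg x)
  have h3 : 𝓕⁻ U = 𝓕 U ∘ fun y => -y := by
    funext y
    rw [Real.fourierInv_eq_fourier_neg]; rfl
  rw [h3]
  have h4 : 𝓕⁻ (fun ξ => 2 * Real.pi * Complex.I * ξ * U ξ) x =
      (-1 : ℝ) • 𝓕 (fun y : ℝ => (-2 * Real.pi * Complex.I * y) • U y) (-x) := by
    rw [Real.fourierInv_eq_fourier_neg, Real.fourier_eq, Real.fourier_eq, ← integral_smul]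
    congr 1
    funext ξ
    simp only [smul_eq_mul, Circle.smul_def, Complex.real_smul]
    push_cast
    ring
  rw [h4]
  exact h2

lemma IsInv.deriv {u : ℝ → ℝ} {U : ℝ → ℂ} (h : IsInv u U) (hU : WL2 2 U) :
    Differentiable ℝ u ∧ IsInv (deriv u) (fun ξ => 2 * Real.pi * Complex.I * ξ * U ξ) := by
  have h1 : ∀ x, HasDerivAt u (𝓕⁻ (fun ξ => 2 * Real.pi * Complex.I * ξ * U ξ) x).re x := by
    intro x
    have := (hasDerivAt_fourierInv hU x)
    rw [show 𝓕⁻ U = fun x => (u x : ℂ) from funext fun x => (h x).symm] at this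
    have h2 := Complex.reCLM.hasFDerivAt.comp_hasDerivAt x this
    exact h2
  refine ⟨fun x => (h1 x).differentiableAt, fun x => ?_⟩
  have h3 := (hasDerivAt_fourierInv hU x)
  rw [show 𝓕⁻ U = fun x => (u x : ℂ) from funext fun x => (h x).symm] at h3
  rw [(h1 x).deriv]
  exact (h1 x).ofReal_comp.unique h3

lemma WL2.deriv_sym {s : ℕ} {U : ℝ → ℂ} (hU : WL2 (s + 1) U) :
    WL2 s (fun ξ => 2 * Real.pi * Complex.I * ξ * U ξ) := by
  simpa only [mul_assoc] using hU.id_mul.const_mul (2 * Real.pi * Complex.I)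

/-- Each derivative multiplies `U` by 2πiξ and costs one weight. `D` is a side condition on `U` that
survives this, such as a `Chain` with shrinking weight. -/
lemma IsInv.iter {P : (ℝ → ℝ) → Prop} {u : ℝ → ℝ} {U : ℝ → ℂ} {r : ℕ} (D : ℕ → (ℝ → ℂ) → Prop)
    (hP : ∀ r u U, D r U → WL2 (r + 1) U → IsInv u U → P u)
    (hD : ∀ r U, D (r + 1) U → D r (fun ξ => 2 * Real.pi * Complex.I * ξ * U ξ))
    (h : IsInv u U) (hU : WL2 (r + 1) U) (hUD : D r U) : Iter P r u := by
  induction r generalizing u U with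
  | zero => exact hP 0 u U hUD hU h
  | succ r ih =>
    have h1 := h.deriv (hU.mono (by omega))
    exact ⟨hP _ u U hUD hU h, h1.1, ih h1.2 hU.deriv_sym (hD r U hUD)⟩

/-! ### Regularity with six moments. -/

/-- A wave whose nonlinear term has moments up to order six. -/
structure IsDecayingWave (β c γ : ℝ) (f φ : ℝ → ℝ) : Prop where
  cont : Continuous φ
  integrable_pow : ∀ j ≤ 6, Integrable (fun x : ℝ => (x : ℂ) ^ j * (f (φ x) : ℂ)) volume
  memLp_pow : ∀ j ≤ 6, MemLp (fun x : ℝ => (x : ℂ) ^ j * (f (φ x) : ℂ)) 2 volume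
  isInv : IsInv φ (fun ξ => waveSym β c γ ξ * 𝓕 (fun x => (f (φ x) : ℂ)) ξ)

/-- Decay of order 8 leaves (1+|x|)⁻² after six powers, enough for L¹ and L². -/
lemma pow_mul_moments {g : ℝ → ℝ} {B : ℝ} (hg : Continuous g)
    (hB : ∀ x, (1 + |x|) ^ 8 * |g x| ≤ B) {j : ℕ} (hj : j ≤ 6) :
    Integrable (fun x : ℝ => (x : ℂ) ^ j * (g x : ℂ)) volume ∧
      MemLp (fun x : ℝ => (x : ℂ) ^ j * (g x : ℂ)) 2 volume := by
  have hm : AEStronglyMeasurable (fun x : ℝ => (x : ℂ) ^ j * (g x : ℂ)) volume :=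
    Continuous.aestronglyMeasurable (by fun_prop)
  have hle : ∀ x : ℝ, (1 + |x|) ^ 2 * ‖(x : ℂ) ^ j * (g x : ℂ)‖ ≤ B := by
    intro x
    rw [norm_mul, norm_pow, Complex.norm_real, Complex.norm_real, Real.norm_eq_abs,
      Real.norm_eq_abs]
    refine le_trans ?_ (hB x)
    rw [← mul_assoc]
    refine mul_le_mul_of_nonneg_right ?_ (abs_nonneg _)
    calc (1 + |x|) ^ 2 * |x| ^ j ≤ (1 + |x|) ^ 2 * (1 + |x|) ^ j := by
          gcongr
          linarith
      _ ≤ _ := by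
          rw [← pow_add]
          exact pow_le_pow_right₀ (one_le_one_add_abs x) (by omega)
  constructor
  · have h1 := integrable_one_add_norm (E := ℝ) (μ := volume) (r := 2) (by simp)
    refine (h1.const_mul B).mono' hm ?_
    filter_upwards with x
    have h2 := one_add_abs_pos x
    rw [Real.rpow_neg (by positivity), Real.rpow_two, Real.norm_eq_abs x, ← div_eq_mul_inv,
      le_div_iff₀ (by positivity), mul_comm]
    exact hle x
  · refine memLp_one_add_abs_inv.of_le_mul (c := B) hm ?_
    filter_upwards with x
    have h2 := one_add_abs_pos x
    rw [Complex.norm_real, Real.norm_of_nonneg (by positivity), ← div_eq_mul_inv,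
      le_div_iff₀ h2, mul_comm]
    refine le_trans ?_ (hle x)
    refine mul_le_mul_of_nonneg_right ?_ (norm_nonneg _)
    nlinarith [abs_nonneg x]

/-- The quadratic bound on f doubles the decay order of φ from 4 to 8. -/
lemma IsWave.isDecayingWave {β γ c p : ℝ} (hβ : 0 < β) (hγ : 0 < γ)
    (hc : c < 3 * (β ^ 2 * γ / 4) ^ (1 / 3 : ℝ)) (hp : 1 < p) {f φ : ℝ → ℝ} (hf : ContDiff ℝ 2 f)
    (hhom : ∀ t : ℝ, 0 < t → ∀ s : ℝ, f (t * s) = t ^ p * f s)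
    (h : IsWave β c γ f φ) : IsDecayingWave β c γ f φ := by
  obtain ⟨B, hB⟩ := h.decay hβ hγ hc hp hf hhom
  have hB1 : ∀ x, |φ x| ≤ B := fun x => le_trans
    (le_mul_of_one_le_left (abs_nonneg _) (one_le_pow₀ (one_le_one_add_abs x))) (hB x)
  obtain ⟨C, hC, hfC⟩ := homogeneous_quadratic hp hf hhom B
  have hg : Continuous fun x => f (φ x) := hf.continuous.comp h.cont
  have hgB : ∀ x, (1 + |x|) ^ 8 * |f (φ x)| ≤ C * B ^ 2 := by
    intro x
    have h1 := one_add_abs_pos x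
    calc (1 + |x|) ^ 8 * |f (φ x)| ≤ (1 + |x|) ^ 8 * (C * φ x ^ 2) := by
          gcongr
          exact hfC _ (hB1 x)
      _ = C * ((1 + |x|) ^ 4 * |φ x|) ^ 2 := by rw [mul_pow, sq_abs]; ring
      _ ≤ C * B ^ 2 := by
          gcongr
          exact hB x
  refine ⟨h.cont, fun j hj => (pow_mul_moments hg hgB hj).1,
    fun j hj => (pow_mul_moments hg hgB hj).2, fun x => ?_⟩
  obtain ⟨G, hG, hw, hΦ, heq⟩ := h.eq
  have h0 := pow_mul_moments hg hgB (Nat.zero_le 6)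
  simp only [pow_zero, one_mul] at h0
  rw [heq x, fourierInv_eq_integral_exp, fourierInv_eq_integral_exp]
  refine integral_congr_ae ?_
  filter_upwards [hG.unique (isFT_fourierIntegral h0.1 h0.2)] with ξ hξ
  rw [hξ]

/-- Continuous functions with six moments in `L²`. -/
def Mom (h : ℝ → ℝ) : Prop :=
  Continuous h ∧ ∀ j ≤ 6, MemLp (fun x : ℝ => (x : ℂ) ^ j * (h x : ℂ)) 2 volume

lemma Mom.add {u v : ℝ → ℝ} (hu : Mom u) (hv : Mom v) : Mom (fun x => u x + v x) := by
  refine ⟨hu.1.add hv.1, fun j hj => (MemLp.add (hu.2 j hj) (hv.2 j hj)).ae_eq ?_⟩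
  filter_upwards with x
  simp only [Pi.add_apply]
  push_cast
  ring

lemma BddCont.mul_mom {u v : ℝ → ℝ} (hu : BddCont u) (hv : Mom v) : Mom (fun x => u x * v x) := by
  obtain ⟨hu, B, hB⟩ := hu
  have hv1 := hv.1
  refine ⟨hu.mul hv1, fun j hj => (hv.2 j hj).of_le_mul (c := B)
    (Continuous.aestronglyMeasurable (by fun_prop)) (Eventually.of_forall fun x => ?_)⟩
  have h1 : (x : ℂ) ^ j * ((u x * v x : ℝ) : ℂ) = u x * ((x : ℂ) ^ j * v x) := by
    push_cast; ring
  rw [h1, norm_mul, Complex.norm_real]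
  exact mul_le_mul_of_nonneg_right (hB x) (norm_nonneg _)

/-- Continuous square integrable functions. -/
def ContL2 (h : ℝ → ℝ) : Prop := Continuous h ∧ MemLp h 2 volume

lemma ContL2.add {u v : ℝ → ℝ} (hu : ContL2 u) (hv : ContL2 v) : ContL2 (fun x => u x + v x) :=
  ⟨hu.1.add hv.1, MemLp.add hu.2 hv.2⟩

lemma ContL2.const_mul {u : ℝ → ℝ} (hu : ContL2 u) (a : ℝ) : ContL2 (fun x => a * u x) :=
  ⟨continuous_const.mul hu.1, hu.2.const_mul a⟩

lemma Iter.const_mul {P : (ℝ → ℝ) → Prop} (hP : ∀ u a, P u → P (fun x => a * u x)) {r : ℕ}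
    {u : ℝ → ℝ} (h : Iter P r u) (a : ℝ) : Iter P r (fun x => a * u x) := by
  induction r generalizing u with
  | zero => exact hP u a h
  | succ r ih =>
    refine ⟨hP u a h.1, h.2.1.const_mul a, ?_⟩
    have : deriv (fun x => a * u x) = fun x => a * deriv u x := by
      funext x
      exact deriv_const_mul a (h.2.1 x)
    rw [this]
    exact ih h.2.2

lemma Iter.pow_mul {P Q : (ℝ → ℝ) → Prop} {n r : ℕ} {u : ℝ → ℝ}
    (hadd : ∀ u v, Q u → Q v → Q (fun x => u x + v x)) (hQ : ∀ u a, Q u → Q (fun x => a * u x))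
    (hPQ : ∀ j ≤ n, ∀ u, P u → Q (fun x => x ^ j * u x)) (h : Iter P r u) {j : ℕ} (hj : j ≤ n) :
    Iter Q r (fun x => x ^ j * u x) := by
  induction r generalizing u j with
  | zero => exact hPQ j hj u h
  | succ r ih =>
    refine ⟨hPQ j hj u h.1, (differentiable_id.pow j).mul h.2.1, ?_⟩
    -- At j = 0 the truncated exponent j − 1 is harmless, since its coefficient vanishes.
    have : deriv (fun x => x ^ j * u x) =
        fun x => (j : ℝ) * (x ^ (j - 1) * u x) + x ^ j * deriv u x := by
      funext x
      rw [deriv_fun_mul (by fun_prop) (h.2.1 x), deriv_pow_field]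
      ring
    rw [this]
    exact Iter.add hadd ((ih (h.mono (Nat.le_succ r)) (by omega)).const_mul hQ _) (ih h.2.2 hj)

section

variable {β γ c : ℝ} {f φ : ℝ → ℝ}

lemma IsDecayingWave.memLp_comp (h : IsDecayingWave β c γ f φ) :
    MemLp (fun x => (f (φ x) : ℂ)) 2 volume := by
  simpa using h.memLp_pow 0 (Nat.zero_le 6)

lemma IsDecayingWave.isFT (h : IsDecayingWave β c γ f φ) :
    IsFT (fun x => (f (φ x) : ℂ)) (𝓕 (fun x => (f (φ x) : ℂ))) :=
  isFT_fourierIntegral (by simpa using h.integrable_pow 0 (Nat.zero_le 6)) h.memLp_comp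

lemma WL2.waveSym_mul (hβ : 0 < β) (hγ : 0 < γ) (hc : c < 3 * (β ^ 2 * γ / 4) ^ (1 / 3 : ℝ))
    {s : ℕ} {G : ℝ → ℂ} (hG : WL2 s G) : WL2 (s + 1) (fun ξ => waveSym β c γ ξ * G ξ) := by
  have hS := sym_waveSym hβ hγ hc 0
  exact hS.2.2.mul_wl2 hS.1 hG (by push_cast; omega)

/-- One more factor ξ allows six derivatives instead of five: φ' has a sixth moment although φ is
only given five. -/
lemma sym_deriv_waveSym (hβ : 0 < β) (hγ : 0 < γ)
    (hc : c < 3 * (β ^ 2 * γ / 4) ^ (1 / 3 : ℝ)) (M : ℕ) :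
    Sym M 6 0 (fun ξ => 2 * Real.pi * Complex.I * ξ * waveSym β c γ ξ) := by
  have h1 : Sym M 6 0 (fun ξ => (ξ : ℂ) * waveSym β c γ ξ) := (sym_waveSym hβ hγ hc (M + 1)).id_mul
  simpa only [mul_assoc] using h1.const_mul (2 * Real.pi * Complex.I)

lemma Chain.deriv_sym {s N : ℕ} {U : ℝ → ℂ} (h : Chain (s + 1) N U) :
    Chain s N (fun ξ => 2 * Real.pi * Complex.I * ξ * U ξ) := by
  have := ((sym_id N N).mul_chain h (t := s) (by push_cast; omega)).const_mul
    (2 * Real.pi * Complex.I)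
  simpa only [mul_assoc] using this

/-- Regularity, without weights. -/
lemma IsDecayingWave.wl2 (hβ : 0 < β) (hγ : 0 < γ)
    (hc : c < 3 * (β ^ 2 * γ / 4) ^ (1 / 3 : ℝ)) (h : IsDecayingWave β c γ f φ) {m : ℕ}
    (hf : ContDiff ℝ m f) : WL2 m (𝓕 (fun x => (f (φ x) : ℂ))) := by
  induction m with
  | zero => exact wl2_zero_iff.2 h.isFT.right
  | succ s ih =>
    have hG := ih (hf.of_le (by exact_mod_cast Nat.le_succ s))
    have hΦ := hG.waveSym_mul hβ hγ hc
    -- φ and its derivatives up to order s are in H¹. The last one need not be classically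
    -- differentiable, hence the formulation by translations.
    have hφ : Iter (fun h => BddTransLip h ∧ MemLp h 2 volume) s φ := by
      refine h.isInv.iter (fun _ _ => True) (fun r u U _ hU hu => ?_) (fun _ _ _ => trivial) hΦ
        trivial
      have hU1 := hU.mono (by omega : 1 ≤ r + 1)
      have hFT := hu.isFT hU1
      refine ⟨⟨hu.bddCont hU1, hFT.transLip hU1.id_mul.memLp⟩, ?_⟩
      exact (hFT.left.re).congr_norm (hu.bddCont hU1).1.aestronglyMeasurable (by simp)
    have hf1 : ContDiff ℝ 1 f := hf.of_le (by exact_mod_cast Nat.le_add_left 1 s)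
    have hg0 : BddTransLip (fun x => f (φ x)) ∧ MemLp (fun x => f (φ x)) 2 volume := by
      refine ⟨hφ.base.1.comp hf1, ?_⟩
      exact (h.memLp_comp.re).congr_norm
        (hf1.continuous.comp h.cont).aestronglyMeasurable (by simp)
    have hg : Iter (fun h => BddTransLip h ∧ MemLp h 2 volume) s (fun x => f (φ x)) := by
      cases s with
      | zero => exact hg0
      | succ t =>
        have hf' : ContDiff ℝ ((t + 1 : ℕ) + 1) f := by exact_mod_cast hf
        -- The highest factor produced by the chain rule is f^(s)∘φ with f^(s) of class C¹;
        -- composition preserves Lipschitz translations without a weak chain rule.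
        refine Iter.comp_succ (P := BddTransLip) (fun u v => BddTransLip.add)
          (fun u v => BddTransLip.mul)
          (fun u v hu hv => ⟨hu.1.add hv.1, MemLp.add hu.2 hv.2⟩) (fun u v hu hv => ?_)
          (hf1.differentiable one_ne_zero)
          (ContDiff.compIter (k := 1) (fun F hF u hu => hu.comp (by exact_mod_cast hF))
            (contDiff_succ_iff_deriv.1 hf').2.2)
          ((hφ.mono (Nat.le_succ t)).imp fun u hu => hu.1) hφ.2.1 hφ.2.2 hg0
        obtain ⟨B, hB⟩ := hu.1.2
        exact ⟨hu.mul hv.1, hv.2.of_le_mul (c := B) (hu.mul hv.1).1.1.aestronglyMeasurable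
          (Eventually.of_forall fun x => by
            rw [norm_mul]
            exact mul_le_mul_of_nonneg_right (hB x) (norm_nonneg _))⟩
    rw [add_comm]
    refine hg.wl2 (fun u hu => ⟨hu.1.1.1, hu.2⟩) (fun u U hu hU => ?_) h.isFT
    exact (wl2_zero_iff.2 hU.right).of_id_mul (wl2_zero_iff.2 (hU.memLp_of_transLip hu.1.2))

/-- Starts at φ' because six derivatives on the Fourier side require the extra factor ξ in the
multiplier. -/
lemma IsDecayingWave.iter_mom_deriv (hβ : 0 < β) (hγ : 0 < γ)
    (hc : c < 3 * (β ^ 2 * γ / 4) ^ (1 / 3 : ℝ)) (h : IsDecayingWave β c γ f φ) {s : ℕ}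
    (hG : WL2 (s + 1) (𝓕 (fun x => (f (φ x) : ℂ))))
    (hch : Chain s 6 (𝓕 (fun x => (f (φ x) : ℂ)))) :
    Differentiable ℝ φ ∧ Iter Mom s (deriv φ) := by
  have hΦ := hG.waveSym_mul hβ hγ hc
  have hd := h.isInv.deriv (hΦ.mono (by omega))
  refine ⟨hd.1, hd.2.iter (fun r U => Chain r 6 U) (fun r u U hch hU hu => ?_)
    (fun r U hU => hU.deriv_sym) hΦ.deriv_sym ?_⟩
  · have hU1 := hU.mono (by omega : 1 ≤ r + 1)
    refine ⟨(hu.bddCont hU1).1, fun j hj => ?_⟩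
    obtain ⟨V, hV, -⟩ := hch.isFT_pow (hu.isFT hU1) hj
    exact hV.left
  · have := ((sym_deriv_waveSym hβ hγ hc 6).mul_chain hch (t := s) (by omega))
    simpa only [mul_assoc] using this

/-- f(φ) owes its own moments to decay. Its derivatives are sums of bounded functions times
derivatives of φ, and inherit the moments of the latter. -/
lemma IsDecayingWave.iter_mom (hβ : 0 < β) (hγ : 0 < γ)
    (hc : c < 3 * (β ^ 2 * γ / 4) ^ (1 / 3 : ℝ)) (h : IsDecayingWave β c γ f φ) {s : ℕ}
    (hf : ContDiff ℝ (s + 1 : ℕ) f) (hch : Chain s 6 (𝓕 (fun x => (f (φ x) : ℂ)))) :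
    Iter Mom (s + 1) (fun x => f (φ x)) := by
  have hG := h.wl2 hβ hγ hc hf
  obtain ⟨hd, hφ'⟩ := h.iter_mom_deriv hβ hγ hc hG hch
  have hφ : Iter BddCont s φ :=
    h.isInv.iter (fun _ _ => True) (fun r u U _ hU hu => hu.bddCont (hU.mono (by omega)))
      (fun _ _ _ => trivial) ((hG.waveSym_mul hβ hγ hc).mono (by omega)) trivial
  have hf' : ContDiff ℝ ((s : ℕ) + 1) f := by exact_mod_cast hf
  exact Iter.comp_succ (P := BddCont) (fun u v => BddCont.add) (fun u v => BddCont.mul)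
    (fun u v => Mom.add) (fun u v => BddCont.mul_mom) (hf'.differentiable (by simp))
    (ContDiff.compIter (k := 0) (fun F hF u hu => hu.comp hF.continuous)
      (contDiff_succ_iff_deriv.1 hf').2.2) hφ hd hφ' ⟨hf.continuous.comp h.cont, h.memLp_pow⟩

/-- Regularity with weights. -/
lemma IsDecayingWave.chain (hβ : 0 < β) (hγ : 0 < γ)
    (hc : c < 3 * (β ^ 2 * γ / 4) ^ (1 / 3 : ℝ)) (h : IsDecayingWave β c γ f φ) {m : ℕ}
    (hf : ContDiff ℝ m f) : Chain m 6 (𝓕 (fun x => (f (φ x) : ℂ))) := by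
  induction m with
  | zero =>
    exact chain_fourier h.integrable_pow fun j hj => wl2_zero_iff.2
      (isFT_fourierIntegral (h.integrable_pow j hj) (h.memLp_pow j hj)).right
  | succ s ih =>
    have hg := h.iter_mom hβ hγ hc hf (ih (hf.of_le (by exact_mod_cast Nat.le_succ s)))
    refine chain_fourier h.integrable_pow fun j hj => ?_
    -- The Leibniz rule puts s + 1 derivatives of each xʲf(φ) in L², so each transform gains s + 1
    -- weights; `chain_fourier` reads these transforms as the successive derivatives of a single
    -- one.
    have h1 : Iter ContL2 (s + 1) (fun x => x ^ j * f (φ x)) :=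
      Iter.pow_mul (n := 6) (fun u v => ContL2.add) (fun u a hu => hu.const_mul a)
        (fun i hi u hu => ⟨(continuous_pow i).mul hu.1, (hu.2 i hi).re.congr_norm
          ((continuous_pow i).mul hu.1).aestronglyMeasurable (Eventually.of_forall fun x => by
            simp [← Complex.ofReal_pow])⟩) hg hj
    have h2 := h1.wl2 (k := 0) (fun u hu => hu) (fun u U hu hU => wl2_zero_iff.2 hU.right)
      (H := 𝓕 (fun x : ℝ => (x : ℂ) ^ j * (f (φ x) : ℂ))) ?_
    · rwa [zero_add] at h2
    · refine (isFT_fourierIntegral (h.integrable_pow j hj) (h.memLp_pow j hj)).congr_left ?_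
      filter_upwards with x
      push_cast
      rfl

end

/-! ### Hölder continuity from homogeneity. -/

/-- Local Hölder continuity. -/
def LocHolder (F : ℝ → ℝ) : Prop :=
  ∀ R, ∃ α C : ℝ, 0 < α ∧ 0 ≤ C ∧ ∀ s t, |s| ≤ R → |t| ≤ R → |F s - F t| ≤ C * |s - t| ^ α

/-- Bounded Hölder continuous functions. -/
def Hol (h : ℝ → ℝ) : Prop :=
  (∃ B, ∀ x, |h x| ≤ B) ∧ ∃ α C : ℝ, 0 < α ∧ 0 ≤ C ∧ ∀ x y, |h x - h y| ≤ C * |x - y| ^ α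

/-- A smaller exponent weakens the bound for d ≤ 1; for d ≥ 1 the uniform bound `B` takes over. -/
lemma holder_lower {α α' C B d e : ℝ} (hα : α' ≤ α) (hα' : 0 < α') (hC : 0 ≤ C)
    (hd : 0 ≤ d) (h1 : e ≤ B) (h2 : e ≤ C * d ^ α) : e ≤ max B C * d ^ α' := by
  have hm : C ≤ max B C := le_max_right _ _
  rcases le_total d 1 with h | h
  · rcases hd.eq_or_lt with rfl | hd'
    · rw [Real.zero_rpow (by linarith)] at h2
      rw [Real.zero_rpow hα'.ne']
      linarith
    · have := Real.rpow_le_rpow_of_exponent_ge hd' h hα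
      exact h2.trans (mul_le_mul hm this (by positivity) (hC.trans hm))
  · have := Real.one_le_rpow h hα'.le
    exact h1.trans ((le_max_left B C).trans (le_mul_of_one_le_right (hC.trans hm) this))

lemma Hol.lower {h : ℝ → ℝ} (hh : Hol h) : ∃ α : ℝ, 0 < α ∧ ∀ α', 0 < α' → α' ≤ α →
    ∃ C, 0 ≤ C ∧ ∀ x y, |h x - h y| ≤ C * |x - y| ^ α' := by
  obtain ⟨⟨B, hB⟩, α, C, hα, hC, hh⟩ := hh
  refine ⟨α, hα, fun α' h0 h1 => ⟨max (B + B) C, hC.trans (le_max_right _ _), fun x y => ?_⟩⟩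
  exact holder_lower h1 h0 hC (abs_nonneg _)
    ((abs_sub _ _).trans (add_le_add (hB x) (hB y))) (hh x y)

lemma Hol.exists_common {u v : ℝ → ℝ} (hu : Hol u) (hv : Hol v) : ∃ α C D : ℝ, 0 < α ∧ 0 ≤ C ∧
    0 ≤ D ∧ (∀ x y, |u x - u y| ≤ C * |x - y| ^ α) ∧ ∀ x y, |v x - v y| ≤ D * |x - y| ^ α := by
  obtain ⟨α, hα, hu⟩ := hu.lower
  obtain ⟨α', hα', hv⟩ := hv.lower
  have h0 : 0 < min α α' := lt_min hα hα'
  obtain ⟨C, hC, hu⟩ := hu _ h0 (min_le_left _ _)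
  obtain ⟨D, hD, hv⟩ := hv _ h0 (min_le_right _ _)
  exact ⟨_, C, D, h0, hC, hD, hu, hv⟩

lemma Hol.add {u v : ℝ → ℝ} (hu : Hol u) (hv : Hol v) : Hol (fun x => u x + v x) := by
  obtain ⟨α, C, D, hα, hC, hD, h1, h2⟩ := hu.exists_common hv
  obtain ⟨B, hB⟩ := hu.1
  obtain ⟨B', hB'⟩ := hv.1
  refine ⟨⟨B + B', fun x => (abs_add_le _ _).trans (add_le_add (hB x) (hB' x))⟩, α, C + D, hα,
    by positivity, fun x y => ?_⟩
  rw [show u x + v x - (u y + v y) = (u x - u y) + (v x - v y) by ring, add_mul]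
  exact (abs_add_le _ _).trans (add_le_add (h1 x y) (h2 x y))

lemma Hol.mul {u v : ℝ → ℝ} (hu : Hol u) (hv : Hol v) : Hol (fun x => u x * v x) := by
  obtain ⟨α, C, D, hα, hC, hD, h1, h2⟩ := hu.exists_common hv
  obtain ⟨B, hB⟩ := hu.1
  obtain ⟨B', hB'⟩ := hv.1
  have hB0 := (abs_nonneg _).trans (hB 0)
  have hB0' := (abs_nonneg _).trans (hB' 0)
  refine ⟨⟨B * B', fun x => ?_⟩, α, C * B' + B * D, hα, by positivity, fun x y => ?_⟩
  · rw [abs_mul]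
    exact mul_le_mul (hB x) (hB' x) (abs_nonneg _) hB0
  · rw [show u x * v x - u y * v y = (u x - u y) * v x + u y * (v x - v y) by ring]
    refine (abs_add_le _ _).trans ?_
    rw [abs_mul, abs_mul]
    have h3 : |u x - u y| * |v x| ≤ C * |x - y| ^ α * B' :=
      mul_le_mul (h1 x y) (hB' x) (abs_nonneg _) (by positivity)
    have h4 : |u y| * |v x - v y| ≤ B * (D * |x - y| ^ α) :=
      mul_le_mul (hB y) (h2 x y) (abs_nonneg _) hB0
    linarith

lemma Hol.comp {u F : ℝ → ℝ} (hF : LocHolder F) (hu : Hol u) : Hol (fun x => F (u x)) := by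
  obtain ⟨⟨B, hB⟩, α, C, hα, hC, h1⟩ := hu
  obtain ⟨α', C', hα', hC', hF⟩ := hF B
  have hB0 := (abs_nonneg _).trans (hB 0)
  refine ⟨⟨C' * (2 * B) ^ α' + |F 0|, fun x => ?_⟩, α * α', C' * C ^ α', by positivity,
    by positivity, fun x y => ?_⟩
  · have h2 := hF (u x) 0 (hB x) (by simpa using hB0)
    rw [sub_zero] at h2
    have h3 : |F (u x)| ≤ |F (u x) - F 0| + |F 0| := by
      simpa using abs_add_le (F (u x) - F 0) (F 0)
    have h4 : |u x| ^ α' ≤ (2 * B) ^ α' :=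
      Real.rpow_le_rpow (abs_nonneg _) (by linarith [hB x]) hα'.le
    have := mul_le_mul_of_nonneg_left h4 hC'
    linarith
  · refine (hF _ _ (hB x) (hB y)).trans ?_
    rw [mul_assoc]
    refine mul_le_mul_of_nonneg_left ?_ hC'
    calc |u x - u y| ^ α' ≤ (C * |x - y| ^ α) ^ α' :=
          Real.rpow_le_rpow (abs_nonneg _) (h1 x y) hα'.le
      _ = _ := by
          rw [Real.mul_rpow hC (by positivity), ← Real.rpow_mul (abs_nonneg _)]

lemma LocHolder.comp {F G : ℝ → ℝ} (hF : LocHolder F) (hG : LocHolder G) :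
    LocHolder (fun s => F (G s)) := by
  intro R
  obtain ⟨α, C, hα, hC, hG⟩ := hG R
  set B := |G 0| + C * (|R| + |R|) ^ α
  obtain ⟨α', C', hα', hC', hF⟩ := hF B
  have hB : ∀ s, |s| ≤ R → |G s| ≤ B := by
    intro s hs
    have hR : 0 ≤ R := (abs_nonneg s).trans hs
    have h2 := hG s 0 hs (by simpa using hR)
    rw [sub_zero] at h2
    have h3 : |G s| ≤ |G s - G 0| + |G 0| := by simpa using abs_add_le (G s - G 0) (G 0)
    have h4 : |s| ^ α ≤ (|R| + |R|) ^ α :=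
      Real.rpow_le_rpow (abs_nonneg _) (by rw [abs_of_nonneg hR]; linarith) hα.le
    have := mul_le_mul_of_nonneg_left h4 hC
    show |G s| ≤ |G 0| + _
    linarith
  refine ⟨α * α', C' * C ^ α', by positivity, by positivity, fun s t hs ht => ?_⟩
  refine (hF _ _ (hB s hs) (hB t ht)).trans ?_
  rw [mul_assoc]
  refine mul_le_mul_of_nonneg_left ?_ hC'
  calc |G s - G t| ^ α' ≤ (C * |s - t| ^ α) ^ α' :=
        Real.rpow_le_rpow (abs_nonneg _) (hG s t hs ht) hα'.le
    _ = _ := by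
        rw [Real.mul_rpow hC (by positivity), ← Real.rpow_mul (abs_nonneg _)]

lemma LocHolder.add {F G : ℝ → ℝ} (hF : LocHolder F) (hG : LocHolder G) :
    LocHolder (fun s => F s + G s) := by
  intro R
  obtain ⟨α, C, hα, hC, hF⟩ := hF R
  obtain ⟨α', C', hα', hC', hG⟩ := hG R
  have h0 : 0 < min α α' := lt_min hα hα'
  refine ⟨min α α', max (C * (R + R) ^ α) C + max (C' * (R + R) ^ α') C', h0, by positivity,
    fun s t hs ht => ?_⟩
  have hst : |s - t| ≤ R + R := (abs_sub _ _).trans (add_le_add hs ht)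
  rw [show F s + G s - (F t + G t) = (F s - F t) + (G s - G t) by ring, add_mul]
  refine (abs_add_le _ _).trans (add_le_add ?_ ?_)
  · exact holder_lower (min_le_left _ _) h0 hC (abs_nonneg _) ((hF s t hs ht).trans
      (mul_le_mul_of_nonneg_left (Real.rpow_le_rpow (abs_nonneg _) hst hα.le) hC)) (hF s t hs ht)
  · exact holder_lower (min_le_right _ _) h0 hC' (abs_nonneg _) ((hG s t hs ht).trans
      (mul_le_mul_of_nonneg_left (Real.rpow_le_rpow (abs_nonneg _) hst hα'.le) hC')) (hG s t hs ht)

lemma ContDiff.locHolder {F : ℝ → ℝ} (hF : ContDiff ℝ 1 F) : LocHolder F := by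
  intro R
  obtain ⟨C, hC, h⟩ := exists_lipschitz_Icc hF R
  exact ⟨1, C, one_pos, hC, fun s t hs ht => by simpa using h s t hs ht⟩

/-- For q ≤ 1 by subadditivity of the power; for q ≥ 1 the power is C¹ and is composed with the
positive part, the case q = 1. -/
lemma locHolder_posPart_rpow {q : ℝ} (hq : 0 < q) : LocHolder (fun s => max s 0 ^ q) := by
  have h1 : ∀ q : ℝ, 0 < q → q ≤ 1 → LocHolder (fun s => max s 0 ^ q) := by
    intro q hq hq1 R
    have key : ∀ a b : ℝ, 0 ≤ b → b ≤ a → a ^ q - b ^ q ≤ (a - b) ^ q := by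
      intro a b hb hab
      have := Real.rpow_add_le_add_rpow (sub_nonneg.2 hab) hb hq.le hq1
      rw [sub_add_cancel] at this
      linarith
    have habs : ∀ a b : ℝ, 0 ≤ a → 0 ≤ b → |a ^ q - b ^ q| ≤ |a - b| ^ q := by
      intro a b ha hb
      rcases le_total b a with h | h
      · rw [abs_of_nonneg (sub_nonneg.2 h),
          abs_of_nonneg (sub_nonneg.2 (Real.rpow_le_rpow hb h hq.le))]
        exact key a b hb h
      · rw [abs_sub_comm, abs_sub_comm a, abs_of_nonneg (sub_nonneg.2 h),
          abs_of_nonneg (sub_nonneg.2 (Real.rpow_le_rpow ha h hq.le))]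
        exact key b a ha h
    refine ⟨q, 1, hq, zero_le_one, fun s t _ _ => ?_⟩
    rw [one_mul]
    refine (habs _ _ (le_max_right _ _) (le_max_right _ _)).trans ?_
    exact Real.rpow_le_rpow (abs_nonneg _) (abs_max_sub_max_le_abs s t 0) hq.le
  rcases le_total q 1 with h | h
  · exact h1 q hq h
  · have h2 : ContDiff ℝ 1 (fun s : ℝ => s ^ q) :=
      Real.contDiff_rpow_const_of_le (by exact_mod_cast h)
    have h3 := (ContDiff.locHolder h2).comp (h1 1 one_pos le_rfl)
    simpa using h3

/-- A continuous function which is homogeneous, of any degree, is locally Hölder continuous. -/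
lemma locHolder_of_homogeneous {q : ℝ} {h : ℝ → ℝ} (hc : Continuous h)
    (hhom : ∀ t : ℝ, 0 < t → ∀ s : ℝ, h (t * s) = t ^ q * h s) : LocHolder h := by
  rcases le_or_gt q 0 with hq | hq
  -- As t → 0⁺, h(s) = t^(−q) h(ts) tends to 0^(−q) h(0), which does not depend on s; the convention
  -- 0⁰ = 1 covers q = 0.
  · have hconst : ∃ a, ∀ s, h s = a := by
      have h1 : ∀ s, Tendsto (fun t : ℝ => t ^ (-q) * h (t * s)) (𝓝[>] 0)
          (𝓝 ((0 : ℝ) ^ (-q) * h 0)) := by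
        intro s
        have h2 : Tendsto (fun t : ℝ => h (t * s)) (𝓝 0) (𝓝 (h (0 * s))) :=
          (hc.comp (continuous_id.mul continuous_const)).tendsto 0
        rw [zero_mul] at h2
        exact ((Real.continuousAt_rpow_const 0 (-q)
          (Or.inr (by linarith))).tendsto.mul h2).mono_left nhdsWithin_le_nhds
      refine ⟨(0 : ℝ) ^ (-q) * h 0, fun s => tendsto_nhds_unique (tendsto_const_nhds.congr' ?_)
        (h1 s)⟩
      filter_upwards [self_mem_nhdsWithin] with t ht
      have ht' : (0 : ℝ) < t := ht
      rw [hhom t ht' s, ← mul_assoc, ← Real.rpow_add ht']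
      simp
    obtain ⟨a, ha⟩ := hconst
    exact fun R => ⟨1, 0, one_pos, le_rfl, fun s t _ _ => by simp [ha]⟩
  · have h0 : h 0 = 0 := by
      have h1 := hhom 2 two_pos 0
      have h2 : (1 : ℝ) < 2 ^ q := Real.one_lt_rpow (by norm_num) hq
      rw [mul_zero] at h1
      nlinarith
    have heq : h = fun s => h 1 * max s 0 ^ q + h (-1) * max (-s) 0 ^ q := by
      funext s
      rcases lt_trichotomy s 0 with hs | hs | hs
      · have h1 := hhom (-s) (by linarith) (-1)
        rw [mul_neg_one, neg_neg] at h1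
        rw [h1, max_eq_right hs.le, max_eq_left (by linarith), Real.zero_rpow hq.ne']
        ring
      · simp [hs, h0, hq.ne']
      · have h1 := hhom s hs 1
        rw [mul_one] at h1
        rw [h1, max_eq_left hs.le, max_eq_right (by linarith), Real.zero_rpow hq.ne']
        ring
    rw [heq]
    have hp := locHolder_posPart_rpow hq
    have hlin : ∀ a : ℝ, LocHolder (fun s => a * s) := fun a =>
      ContDiff.locHolder (contDiff_const.mul contDiff_id)
    refine ((hlin _).comp hp).add ((hlin _).comp (hp.comp ?_))
    exact ContDiff.locHolder contDiff_neg

lemma homogeneous_deriv {q : ℝ} {h : ℝ → ℝ}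
    (hhom : ∀ t : ℝ, 0 < t → ∀ s : ℝ, h (t * s) = t ^ q * h s) :
    ∀ t : ℝ, 0 < t → ∀ s : ℝ, deriv h (t * s) = t ^ (q - 1) * deriv h s := by
  intro t ht s
  have h1 := deriv_comp_mul_left t h s
  have h2 : (fun x => h (t * x)) = fun x => t ^ q * h x := funext fun x => hhom t ht x
  rw [h2, deriv_const_mul_field, smul_eq_mul] at h1
  rw [Real.rpow_sub_one ht.ne', div_mul_eq_mul_div, h1, mul_div_cancel_left₀ _ ht.ne']

/-- Each derivative is again homogeneous, of degree one less. So the last, merely continuous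
derivative is Hölder for free, and no further derivative of the nonlinearity is spent. -/
lemma compIter_hol_of_homogeneous {q : ℝ} {h : ℝ → ℝ} {r : ℕ} (hc : ContDiff ℝ r h)
    (hhom : ∀ t : ℝ, 0 < t → ∀ s : ℝ, h (t * s) = t ^ q * h s) : CompIter Hol r h := by
  induction r generalizing q h with
  | zero => exact fun u hu => hu.comp (locHolder_of_homogeneous hc.continuous hhom)
  | succ r ih =>
    have hc' : ContDiff ℝ ((r : ℕ) + 1) h := by exact_mod_cast hc
    exact ⟨fun u hu => hu.comp (locHolder_of_homogeneous hc.continuous hhom),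
      hc'.differentiable (by simp), ih (contDiff_succ_iff_deriv.1 hc').2.2
        (homogeneous_deriv hhom)⟩

/-- Interpolates between the bound 2 and the Lipschitz bound. The exponent 1/4 is one choice below
1/2, which keeps |ξ|^(1/4)(1+|ξ|)⁻¹ in L² and gives the Hölder embedding `IsInv.hol`. -/
lemma norm_exp_sub_one_le_rpow (η ξ : ℝ) :
    ‖Complex.exp (2 * Real.pi * Complex.I * η * ξ) - 1‖ ≤
      (2 * Real.pi + 2) * (|η| * |ξ|) ^ (1 / 4 : ℝ) := by
  have hpi := Real.pi_pos
  have h1 := norm_exp_sub_one_le η ξ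
  have h2 : ‖Complex.exp (2 * Real.pi * Complex.I * η * ξ) - 1‖ ≤ 2 := by
    refine (norm_sub_le _ _).trans ?_
    rw [norm_exp_two_pi_mul]; norm_num
  rw [mul_assoc (2 * Real.pi) |η| |ξ|] at h1
  set d := |η| * |ξ|
  have hd : 0 ≤ d := by positivity
  have h3 := holder_lower (α := 1) (α' := 1 / 4) (C := 2 * Real.pi) (by norm_num) (by norm_num)
    (by positivity) hd h2 (by rw [Real.rpow_one]; exact h1)
  refine h3.trans (mul_le_mul_of_nonneg_right (max_le ?_ ?_) (by positivity)) <;> linarith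

lemma WL2.integrable_rpow {U : ℝ → ℂ} (h : WL2 1 U) :
    Integrable (fun ξ : ℝ => |ξ| ^ (1 / 4 : ℝ) * ‖U ξ‖) volume := by
  have hc : Continuous fun ξ : ℝ => (1 + |ξ|) ^ (-(3 / 4) : ℝ) :=
    Continuous.rpow_const (by fun_prop) fun ξ => Or.inl (one_add_abs_pos ξ).ne'
  have h1 : MemLp (fun ξ : ℝ => (1 + |ξ|) ^ (-(3 / 4) : ℝ)) 2 volume := by
    rw [memLp_two_iff_integrable_sq hc.aestronglyMeasurable]
    have := integrable_one_add_norm (E := ℝ) (μ := volume) (r := 3 / 2) (by norm_num)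
    refine this.congr ?_
    filter_upwards with ξ
    rw [← Real.rpow_natCast, ← Real.rpow_mul (one_add_abs_pos ξ).le]
    norm_num
  have h2 := h1.integrable_mul h.norm
  refine h2.mono' ?_ ?_
  · exact (Continuous.aestronglyMeasurable (continuous_abs.rpow_const
      (by norm_num))).mul h.aestronglyMeasurable.norm
  · filter_upwards with ξ
    have h3 := one_add_abs_pos ξ
    rw [Real.norm_of_nonneg (by positivity), Pi.mul_apply, norm_mul, norm_weight, pow_one,
      ← mul_assoc]
    refine mul_le_mul_of_nonneg_right ?_ (norm_nonneg _)
    rw [← Real.rpow_add_one h3.ne']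
    norm_num
    exact Real.rpow_le_rpow (abs_nonneg _) (by linarith) (by norm_num)

lemma IsInv.hol {u : ℝ → ℝ} {U : ℝ → ℂ} (h : IsInv u U) (hU : WL2 1 U) : Hol u := by
  refine ⟨(h.bddCont hU).2, 1 / 4,
    (2 * Real.pi + 2) * ∫ ξ : ℝ, |ξ| ^ (1 / 4 : ℝ) * ‖U ξ‖, by norm_num, ?_, fun x y => ?_⟩
  · have := Real.pi_pos
    exact mul_nonneg (by positivity) (integral_nonneg fun ξ => by positivity)
  · have hi : ∀ z : ℝ, Integrable
        (fun ξ : ℝ => Complex.exp (2 * Real.pi * Complex.I * z * ξ) * U ξ) volume := by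
      intro z
      refine hU.integrable.bdd_mul (c := 1) ?_ ?_
      · exact Continuous.aestronglyMeasurable (by fun_prop)
      · exact Eventually.of_forall fun ξ => (norm_exp_two_pi_mul z ξ).le
    rw [← Real.norm_eq_abs, ← Complex.norm_real, Complex.ofReal_sub, h x, h y,
      fourierInv_eq_integral_exp, fourierInv_eq_integral_exp, ← integral_sub (hi x) (hi y)]
    have hle : ∀ ξ : ℝ, ‖Complex.exp (2 * Real.pi * Complex.I * x * ξ) * U ξ -
        Complex.exp (2 * Real.pi * Complex.I * y * ξ) * U ξ‖ ≤
        (2 * Real.pi + 2) * |x - y| ^ (1 / 4 : ℝ) * (|ξ| ^ (1 / 4 : ℝ) * ‖U ξ‖) := by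
      intro ξ
      have h1 : Complex.exp (2 * Real.pi * Complex.I * x * ξ) * U ξ -
          Complex.exp (2 * Real.pi * Complex.I * y * ξ) * U ξ =
          Complex.exp (2 * Real.pi * Complex.I * y * ξ) *
            ((Complex.exp (2 * Real.pi * Complex.I * (x - y : ℝ) * ξ) - 1) * U ξ) := by
        rw [sub_one_mul, mul_sub, ← mul_assoc, ← Complex.exp_add]
        congr 3
        push_cast; ring
      rw [h1, norm_mul, norm_exp_two_pi_mul, one_mul, norm_mul, ← mul_assoc]
      refine mul_le_mul_of_nonneg_right ?_ (norm_nonneg _)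
      have := norm_exp_sub_one_le_rpow (x - y) ξ
      rwa [Real.mul_rpow (abs_nonneg _) (abs_nonneg _), ← mul_assoc] at this
    refine (norm_integral_le_of_norm_le (hU.integrable_rpow.const_mul _)
      (Eventually.of_forall hle)).trans (le_of_eq ?_)
    rw [integral_const_mul]
    ring

lemma IsFT.isInv {u : ℝ → ℝ} {U : ℝ → ℂ} (h : IsFT (fun x => (u x : ℂ)) U) (hu : Continuous u)
    (hU : WL2 1 U) : IsInv u U := by
  have h1 := h.ae_eq_fourierInv hU.integrable
  have h2 := (Continuous.ae_eq_iff_eq volume (Complex.continuous_ofReal.comp hu)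
    (continuous_fourierInv hU.integrable)).1 h1
  exact fun x => congrFun h2 x

/-! ### The Hilbert transform of Hölder functions. -/

lemma tendsto_eLpNorm_two {F : ℕ → ℝ → ℂ} {b : ℝ → ℂ} (hF : ∀ n, AEStronglyMeasurable (F n) volume)
    (hb : MemLp b 2 volume) (hle : ∀ n, ∀ ξ, ‖F n ξ‖ ≤ ‖b ξ‖)
    (hlim : ∀ ξ, Tendsto (fun n => F n ξ) atTop (𝓝 0)) :
    Tendsto (fun n => eLpNorm (F n) 2 volume) atTop (𝓝 0) := by
  have h1 : Tendsto (fun n => ∫⁻ ξ, ‖F n ξ‖ₑ ^ (2 : ℝ)) atTop (𝓝 (∫⁻ _ : ℝ, 0)) := by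
    refine tendsto_lintegral_of_dominated_convergence' (fun ξ => ‖b ξ‖ₑ ^ (2 : ℝ))
      (fun n => (hF n).enorm.pow_const _) (fun n => Eventually.of_forall fun ξ => ?_) ?_
      (Eventually.of_forall fun ξ => ?_)
    · exact ENNReal.rpow_le_rpow (enorm_le_iff_norm_le.2 (hle n ξ)) (by norm_num)
    · have := lintegral_rpow_enorm_lt_top_of_eLpNorm_lt_top (by norm_num) (by norm_num) hb.2
      simpa using this.ne
    · have h2 := ((hlim ξ).enorm).ennrpow_const 2
      simpa using h2
  have h3 := h1.ennrpow_const (1 / 2)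
  rw [lintegral_zero, ENNReal.zero_rpow_of_pos (by norm_num)] at h3
  refine h3.congr fun n => ?_
  rw [eLpNorm_eq_lintegral_rpow_enorm_toReal (by norm_num) (by norm_num)]
  norm_num

/-- Convolutions with the conjugate Poisson kernels are bounded, uniformly in `δ`. -/
lemma exists_bound_conjPoisson_conv {v : ℝ → ℂ} {α C : ℝ} (hv : MemLp v 2 volume) (hα : 0 < α)
    (hC : 0 ≤ C) (hH : ∀ x y, ‖v x - v y‖ ≤ C * |x - y| ^ α) :
    ∃ B, ∀ δ > 0, ∀ x, ‖∫ y, (conjPoisson δ y : ℂ) * v (x - y)‖ ≤ B := by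
  have hpi := Real.pi_pos
  have hsq : Integrable (fun y => ‖v y‖ ^ 2) volume :=
    (memLp_two_iff_integrable_sq hv.1.norm).1 hv.norm
  have hker : Integrable (fun y : ℝ => ((1 + |y|)⁻¹) ^ 2) volume := by
    have := (memLp_two_iff_integrable_sq memLp_one_add_abs_inv.1.norm).1 memLp_one_add_abs_inv.norm
    refine this.congr ?_
    filter_upwards with y
    rw [Complex.norm_real, Real.norm_eq_abs, sq_abs]
  -- Majorant for y ≤ 1: the kernel is odd, so Hölder continuity improves 1/y to the integrable
  -- y^(α−1).
  set A : ℝ → ℝ := Set.indicator (Set.Ioc 0 1) fun y => C * 2 ^ α * y ^ (α - 1) with hA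
  have hAi : Integrable A volume := by
    refine (IntegrableOn.integrable_indicator ?_ measurableSet_Ioc)
    have := intervalIntegral.intervalIntegrable_rpow' (a := 0) (b := 1) (r := α - 1) (by linarith)
    exact (((intervalIntegrable_iff_integrableOn_Ioc_of_le zero_le_one).1 this).const_mul _)
  -- Majorant for y > 1, from 2ab ≤ a² + b² applied to kernel and function. Its integral is
  -- independent of x by translation invariance.
  set E : ℝ → ℝ → ℝ := fun x y => 2 * ((1 + |y|)⁻¹) ^ 2 + ‖v (x - y)‖ ^ 2 + ‖v (x + y)‖ ^ 2 with hE
  have hEi : ∀ x, Integrable (E x) volume := fun x =>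
    ((hker.const_mul 2).add (hsq.comp_sub_left x)).add (hsq.comp_add_left x)
  have hEint : ∀ x, ∫ y, E x y = 2 * (∫ y : ℝ, ((1 + |y|)⁻¹) ^ 2) + 2 * ∫ y, ‖v y‖ ^ 2 := by
    intro x
    have h1 := integral_add ((hker.const_mul 2).add (hsq.comp_sub_left x)) (hsq.comp_add_left x)
    have h2 := integral_add (hker.const_mul 2) (hsq.comp_sub_left x)
    simp only [Pi.add_apply] at h1 h2
    rw [hE]
    simp only
    rw [h1, h2, integral_sub_left_eq_self (fun y => ‖v y‖ ^ 2) volume x,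
      integral_add_left_eq_self (fun y => ‖v y‖ ^ 2) x, integral_const_mul]
    ring
  have hA0 : ∀ y, 0 ≤ A y := fun y => Set.indicator_nonneg (fun y hy => by
    have := hy.1
    positivity) y
  have hE0 : ∀ x y, 0 ≤ E x y := fun x y => by positivity
  refine ⟨(∫ y, A y) + (2 * (∫ y : ℝ, ((1 + |y|)⁻¹) ^ 2) + 2 * ∫ y, ‖v y‖ ^ 2), fun δ hδ x => ?_⟩
  have hQ : MemLp (fun y => (conjPoisson δ y : ℂ)) 2 volume := (isFT_conjPoisson hδ).left
  have hvx : MemLp (fun y => v (x - y)) 2 volume :=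
    hv.comp_measurePreserving (Measure.measurePreserving_sub_left volume x)
  have hint := integrable_mul_of_memLp hQ hvx
  rw [integral_eq_Ioi_add_neg hint]
  have hpt : ∀ y ∈ Set.Ioi (0 : ℝ), ‖(conjPoisson δ y : ℂ) * v (x - y) +
      (conjPoisson δ (-y) : ℂ) * v (x - -y)‖ ≤ A y + E x y := by
    intro y hy
    have hy' : (0 : ℝ) < y := hy
    have hk := abs_conjPoisson_le δ hy'
    have hk2 : 1 / (Real.pi * y) ≤ 1 / y := by
      apply one_div_le_one_div_of_le hy'
      nlinarith [Real.pi_gt_three]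
    have h0 : (conjPoisson δ y : ℂ) * v (x - y) + (conjPoisson δ (-y) : ℂ) * v (x - -y) =
        (conjPoisson δ y : ℂ) * (v (x - y) - v (x + y)) := by
      rw [conjPoisson_neg, sub_neg_eq_add]
      push_cast; ring
    rw [h0, norm_mul, Complex.norm_real, Real.norm_eq_abs]
    rcases le_or_gt y 1 with h1 | h1
    · have h2 : A y = C * 2 ^ α * y ^ (α - 1) := Set.indicator_of_mem (show y ∈ Set.Ioc 0 1 from
        ⟨hy', h1⟩) _
      have h3 := hH (x - y) (x + y)
      rw [show x - y - (x + y) = -(2 * y) by ring, abs_neg, abs_of_pos (by positivity),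
        Real.mul_rpow (by norm_num) hy'.le] at h3
      calc |conjPoisson δ y| * ‖v (x - y) - v (x + y)‖ ≤ 1 / y * (C * (2 ^ α * y ^ α)) :=
            mul_le_mul (hk.trans hk2) h3 (norm_nonneg _) (by positivity)
        _ = A y := by rw [h2, Real.rpow_sub_one hy'.ne']; ring
        _ ≤ A y + E x y := by linarith [hE0 x y]
    · have h2 : |conjPoisson δ y| ≤ (1 + |y|)⁻¹ := by
        refine hk.trans ?_
        rw [← one_div, abs_of_pos hy']
        apply one_div_le_one_div_of_le (by linarith)
        nlinarith [Real.pi_gt_three]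
      have h3 : ‖v (x - y) - v (x + y)‖ ≤ ‖v (x - y)‖ + ‖v (x + y)‖ := norm_sub_le _ _
      have h4 := mul_le_mul h2 h3 (norm_nonneg _) (inv_nonneg.2 (one_add_abs_pos y).le)
      refine h4.trans ?_
      have h5 := hA0 y
      show _ ≤ A y + (2 * ((1 + |y|)⁻¹) ^ 2 + ‖v (x - y)‖ ^ 2 + ‖v (x + y)‖ ^ 2)
      nlinarith [sq_nonneg ((1 + |y|)⁻¹ - ‖v (x - y)‖), sq_nonneg ((1 + |y|)⁻¹ - ‖v (x + y)‖),
        sq_nonneg ‖v (x - y)‖, sq_nonneg ‖v (x + y)‖, sq_nonneg ((1 + |y|)⁻¹)]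
  have hAE : Integrable (fun y => A y + E x y) volume := hAi.add (hEi x)
  calc _ ≤ ∫ y in Set.Ioi 0, (A y + E x y) := by
        refine norm_integral_le_of_norm_le hAE.integrableOn ?_
        exact (ae_restrict_iff' measurableSet_Ioi).2 (Eventually.of_forall hpt)
    _ ≤ ∫ y, (A y + E x y) := setIntegral_le_integral hAE
        (Eventually.of_forall fun y => add_nonneg (hA0 y) (hE0 x y))
    _ = _ := by
        rw [integral_add hAi (hEi x), hEint x]

/-- The Hilbert transform of a square integrable Hölder continuous function is bounded. -/
lemma IsFT.hilbert_memLp_top {v V u : ℝ → ℂ} {α C : ℝ} (h : IsFT v V) (hα : 0 < α)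
    (hC : 0 ≤ C) (hH : ∀ x y, ‖v x - v y‖ ≤ C * |x - y| ^ α)
    (hu : IsFT u (fun ξ => hilbertSym ξ * V ξ)) : MemLp u ⊤ volume := by
  obtain ⟨B, hB⟩ := exists_bound_conjPoisson_conv h.left hα hC hH
  set δ : ℕ → ℝ := fun n => 1 / ((n : ℝ) + 1) with hδ
  have hδ0 : ∀ n, 0 < δ n := fun n => by rw [hδ]; positivity
  have hδlim : Tendsto δ atTop (𝓝[>] 0) := tendsto_nhdsWithin_iff.2
    ⟨tendsto_one_div_add_atTop_nhds_zero_nat, Eventually.of_forall hδ0⟩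
  have hn1 : ∀ n ξ, ‖conjPoissonSym (δ n) ξ‖ ≤ 1 := fun n ξ => by
    refine (norm_conjPoissonSym_le ξ).trans (Real.exp_le_one_iff.2 ?_)
    have := Real.pi_pos
    have := hδ0 n
    have : 0 ≤ 2 * Real.pi * δ n * |ξ| := by positivity
    linarith
  have hU2 : ∀ n, MemLp (fun ξ => conjPoissonSym (δ n) ξ * V ξ) 2 volume := fun n =>
    h.right.of_le_mul (c := 1) ((measurable_conjPoissonSym _).aestronglyMeasurable.mul h.right.1)
      (Eventually.of_forall fun ξ => by
        rw [norm_mul]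
        exact mul_le_mul_of_nonneg_right (hn1 n ξ) (norm_nonneg _))
  have hU1 : ∀ n, Integrable (fun ξ => conjPoissonSym (δ n) ξ * V ξ) volume := fun n =>
    integrable_mul_of_memLp (memLp_conjPoissonSym (hδ0 n)) h.right
  set w : ℕ → ℝ → ℂ := fun n => 𝓕⁻ (fun ξ => conjPoissonSym (δ n) ξ * V ξ) with hw
  have hwFT : ∀ n, IsFT (w n) (fun ξ => conjPoissonSym (δ n) ξ * V ξ) := fun n =>
    isFT_fourierInv (hU1 n) (hU2 n)
  have hwB : ∀ n x, ‖w n x‖ ≤ B := fun n x => by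
    have h1 := (isFT_conjPoisson (hδ0 n)).integral_mul_sub h x
    rw [hw]
    simp only
    rw [fourierInv_eq_integral_exp, ← h1]
    exact hB _ (hδ0 n) x
  -- The conjugate Poisson averages converge to `u` in L² by dominated convergence of their symbols;
  -- an almost everywhere convergent subsequence carries the uniform bound to `u`.
  have hconv : Tendsto (fun n => eLpNorm (w n - u) 2 volume) atTop (𝓝 0) := by
    have h1 : Tendsto (fun n => eLpNorm (fun ξ => conjPoissonSym (δ n) ξ * V ξ -
        hilbertSym ξ * V ξ) 2 volume) atTop (𝓝 0) := by
      refine tendsto_eLpNorm_two (b := fun ξ => 2 * V ξ) (fun n => ((hwFT n).sub hu).right.1)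
        (h.right.const_mul 2) (fun n ξ => ?_) (fun ξ => ?_)
      · rw [← sub_mul, norm_mul, norm_mul]
        refine mul_le_mul_of_nonneg_right ((norm_sub_le _ _).trans ?_) (norm_nonneg _)
        have h2 := hn1 n ξ
        have h3 := norm_hilbertSym_le ξ
        norm_num
        linarith
      · have h2 := ((tendsto_conjPoissonSym ξ).comp hδlim).mul_const (V ξ)
        have h3 := h2.sub_const (hilbertSym ξ * V ξ)
        rw [sub_self] at h3
        exact h3
    refine h1.congr fun n => ?_
    rw [← ((hwFT n).sub hu).eLpNorm_eq]
    rfl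
  obtain ⟨ns, -, hns⟩ := (tendstoInMeasure_of_tendsto_eLpNorm (by norm_num)
    (fun n => (hwFT n).left.1) hu.left.1 hconv).exists_seq_tendsto_ae
  refine memLp_top_of_bound hu.left.1 B ?_
  filter_upwards [hns] with x hx
  exact le_of_tendsto hx.norm (Eventually.of_forall fun n => hwB _ _)

/-- If `a` is a symbol of order zero, and the multiplier `a` maps `xʲ v` to bounded functions, then
it maps `v` to a function which is bounded with the weight `x ^ N`. -/
lemma IsFT.pow_mul_memLp_top {N : ℕ} {a v Γ u : ℝ → ℂ} (ha : Sym N N 0 a) (hv : IsFT v Γ)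
    (hΓ : Chain 0 N Γ)
    (hb : ∀ j ≤ N, ∀ V w, IsFT (fun x : ℝ => (x : ℂ) ^ j * v x) V → IsFT w (fun ξ => a ξ * V ξ) →
      MemLp w ⊤ volume)
    (hu : IsFT u (fun ξ => a ξ * Γ ξ)) : MemLp (fun x : ℝ => (x : ℂ) ^ N * u x) ⊤ volume := by
  induction N generalizing v Γ u with
  | zero => simpa using hb 0 le_rfl Γ u (by simpa using hv) hu
  | succ N ih =>
    obtain ⟨a', hda, ha'⟩ := ha.2
    obtain ⟨Γ', hdΓ, hΓ'⟩ := hΓ.2.2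
    have ha0 : Sym N N 0 a := ha.mono (Nat.le_succ N) (Nat.le_succ N) le_rfl
    have hΓ0 : Chain 0 N Γ := hΓ.mono le_rfl (Nat.le_succ N)
    -- One factor x turns aΓ into a'Γ + aΓ'. The commutator term a'Γ has one spare weight, so its
    -- moments are bounded directly; aΓ' is the same multiplier applied to xv, handled by induction.
    have h1 : Chain 1 N (fun ξ => a' ξ * Γ ξ) := ha'.mul_chain hΓ0 (by simp)
    have h2 : Chain 0 N (fun ξ => a ξ * Γ' ξ) := ha0.mul_chain hΓ' (by simp)
    have hxv := hv.mul_id hΓ.2.1 hdΓ hΓ'.wl2.memLp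
    have hxu := hu.mul_id ((ha.1.2.1 (by omega)).mul hΓ.2.1)
      (fun ξ hξ => (hda ξ hξ).mul (hdΓ ξ hξ)) (h1.wl2.memLp.add h2.wl2.memLp)
    obtain ⟨w1, hw1⟩ := exists_isFT_inv ((h1.const_mul (Complex.I / (2 * Real.pi))).wl2.memLp)
    have h2' := h2.const_mul (Complex.I / (2 * Real.pi))
    obtain ⟨w2, hw2⟩ := exists_isFT_inv h2'.wl2.memLp
    have hsum : (fun x : ℝ => (x : ℂ) * u x) =ᵐ[volume] fun x => w1 x + w2 x := by
      refine hxu.unique_left ((hw1.add hw2).congr_right ?_)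
      filter_upwards with ξ
      ring
    have hb1 : MemLp (fun x : ℝ => (x : ℂ) ^ N * w1 x) ⊤ volume := by
      obtain ⟨V, hV, hVc⟩ := (h1.const_mul (Complex.I / (2 * Real.pi))).isFT_pow hw1 le_rfl
      exact hV.memLp_top hVc.wl2.integrable
    have hb2 : MemLp (fun x : ℝ => (x : ℂ) ^ N * w2 x) ⊤ volume := by
      refine ih ha0 hxv (hΓ'.const_mul _) (fun j hj V w hV hw => hb (j + 1) (by omega) V w ?_ hw) ?_
      · refine hV.congr_left ?_
        filter_upwards with x
        ring
      · refine hw2.congr_right ?_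
        filter_upwards with ξ
        ring
    refine (MemLp.add hb1 hb2).ae_eq ?_
    filter_upwards [hsum] with x hx
    rw [pow_succ, mul_assoc, hx, Pi.add_apply]
    ring

/-! ### The sup bound on the highest derivative. -/

lemma Iter.isFT {P : (ℝ → ℝ) → Prop} {r : ℕ} {u : ℝ → ℝ} {U : ℝ → ℂ}
    (hP : ∀ h, P h → Continuous h ∧ MemLp h 2 volume) (hu : Iter P r u)
    (hU : IsFT (fun x => (u x : ℂ)) U) :
    IsFT (fun x => ((iteratedDeriv r u x : ℝ) : ℂ)) (fun ξ => (2 * Real.pi * Complex.I * ξ) ^ r * U ξ) := by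
  induction r generalizing u U with
  | zero => simpa using hU
  | succ r ih =>
    have h1 := hU.deriv (u' := fun x => ((deriv u x : ℝ) : ℂ))
      (Complex.continuous_ofReal.comp (hP u hu.1).1)
      (fun x _ => (hu.2.1 x).hasDerivAt.ofReal_comp) (hP _ hu.2.2.base).2.ofReal
    rw [iteratedDeriv_succ']
    refine (ih hu.2.2 h1).congr_right ?_
    filter_upwards with ξ
    ring

lemma Chain.deriv_sym_pow {s k N : ℕ} {U : ℝ → ℂ} (h : Chain (s + k) N U) :
    Chain s N (fun ξ => (2 * Real.pi * Complex.I * ξ) ^ k * U ξ) := by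
  induction k generalizing U with
  | zero => simpa using h
  | succ k ih =>
    have := ih (Chain.deriv_sym (s := s + k) h)
    convert this using 2
    ring

/-- The symbol of `∂ₓ` times the multiplier of the equation is, up to lower order terms, that of
the Hilbert transform. -/
lemma exists_deriv_waveSym_eq {β γ c : ℝ} (hβ : 0 < β) (hγ : 0 < γ)
    (hc : c < 3 * (β ^ 2 * γ / 4) ^ (1 / 3 : ℝ)) :
    ∃ b : ℝ → ℂ, Measurable b ∧ OrderLE (-1) b ∧ ∀ ξ : ℝ,
      2 * Real.pi * Complex.I * ξ * waveSym β c γ ξ = (β : ℂ)⁻¹ * hilbertSym ξ + b ξ := by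
  have h2 := (sym_pow_div_denom hβ hγ hc 2 0).mono (M' := 0) (N' := 0) (s' := -1) le_rfl
    (by omega) (by norm_num)
  have h0 := (sym_pow_div_denom hβ hγ hc 0 0).mono (M' := 0) (N' := 0) (s' := -1) le_rfl
    (by omega) (by norm_num)
  have h1 := ((sym_sign 0).const_mul (-Complex.I * (β : ℂ)⁻¹)).mul
    ((h2.const_mul (c * (2 * Real.pi) ^ 2)).add (h0.const_mul (-γ)))
  obtain ⟨κ, hκ, hlow⟩ := exists_denom_lower hβ hγ hc
  refine ⟨_, h1.1, h1.2.2, fun ξ => ?_⟩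
  have hpos : 0 < denom β c γ ξ := lt_of_lt_of_le
    (by have := one_add_abs_pos ξ; positivity) (hlow ξ)
  have hne : (denom β c γ ξ : ℂ) ≠ 0 := by exact_mod_cast hpos.ne'
  have hβ' : (β : ℂ) ≠ 0 := by exact_mod_cast hβ.ne'
  have hd : (denom β c γ ξ : ℂ) = β * ((2 * Real.pi) ^ 3 * ((|ξ| : ℝ) : ℂ) ^ 3) -
      c * (2 * Real.pi * ξ) ^ 2 + γ := by
    rw [denom, abs_mul, abs_of_pos (by positivity : 0 < 2 * Real.pi), mul_pow]
    push_cast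
    ring
  have hs : (ξ : ℂ) ^ 3 = ((SignType.sign ξ : ℝ) : ℂ) * ((|ξ| : ℝ) : ℂ) ^ 3 := by
    rcases lt_trichotomy ξ 0 with h | h | h
    · rw [sign_neg h, abs_of_neg h]; simp; ring
    · simp [h]
    · rw [sign_pos h, abs_of_pos h]; simp
  have h3 : (β : ℂ) * ((2 * Real.pi) ^ 3 * ((|ξ| : ℝ) : ℂ) ^ 3) =
      denom β c γ ξ + c * (2 * Real.pi * ξ) ^ 2 - γ := by rw [hd]; ring
  have h4 : 2 * Real.pi * Complex.I * ξ * waveSym β c γ ξ =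
      -Complex.I * (β : ℂ)⁻¹ * ((SignType.sign ξ : ℝ) : ℂ) *
        (β * ((2 * Real.pi) ^ 3 * ((|ξ| : ℝ) : ℂ) ^ 3)) * (denom β c γ ξ : ℂ)⁻¹ := by
    rw [waveSym]
    calc _ = -Complex.I * (2 * Real.pi) ^ 3 * (ξ : ℂ) ^ 3 * (denom β c γ ξ : ℂ)⁻¹ := by ring
      _ = _ := by rw [hs]; field_simp
  rw [h4, h3, hilbertSym]
  field_simp
  ring

/-- All `xʲ h` with `j ≤ 5` are bounded and Hölder continuous. -/
def HolMom (h : ℝ → ℝ) : Prop := ∀ j ≤ 5, Hol (fun x => x ^ j * h x)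

lemma HolMom.add {u v : ℝ → ℝ} (hu : HolMom u) (hv : HolMom v) :
    HolMom (fun x => u x + v x) := by
  intro j hj
  simpa only [mul_add] using (hu j hj).add (hv j hj)

lemma Hol.mul_holMom {u v : ℝ → ℝ} (hu : Hol u) (hv : HolMom v) :
    HolMom (fun x => u x * v x) := by
  intro j hj
  simpa only [mul_left_comm] using hu.mul (hv j hj)

/-- One weight on the transform of each moment suffices for its Hölder continuity. -/
lemma IsFT.holMom {u : ℝ → ℝ} {U : ℝ → ℂ} {s : ℕ} (h : IsFT (fun x => (u x : ℂ)) U)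
    (hu : Continuous u) (hU : Chain (s + 1) 6 U) : HolMom u := by
  intro j hj
  obtain ⟨V, hV, hVc⟩ := hU.isFT_pow h (by omega : j ≤ 6)
  have h1 : IsFT (fun x => ((x ^ j * u x : ℝ) : ℂ)) V := hV.congr_left (by
    filter_upwards with x
    push_cast; rfl)
  have h2 : WL2 1 V := hVc.wl2.mono (by omega)
  exact (h1.isInv (by fun_prop) h2).hol h2

section

variable {β γ c p : ℝ} {f φ : ℝ → ℝ}

/-- The chain rule over the algebra of bounded Hölder functions. At the top order, where f^(r+1) is
only continuous, homogeneity supplies the Hölder bound. -/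
lemma IsDecayingWave.iter_holMom (hβ : 0 < β) (hγ : 0 < γ)
    (hc : c < 3 * (β ^ 2 * γ / 4) ^ (1 / 3 : ℝ)) (h : IsDecayingWave β c γ f φ) {r : ℕ}
    (hf : ContDiff ℝ (r + 1 : ℕ) f)
    (hhom : ∀ t : ℝ, 0 < t → ∀ s : ℝ, f (t * s) = t ^ p * f s) :
    Iter HolMom (r + 1) (fun x => f (φ x)) := by
  have hG := h.chain hβ hγ hc hf
  have hΦ := hG.wl2.waveSym_mul hβ hγ hc
  have hd := h.isInv.deriv (hΦ.mono (by omega))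
  have hf' : ContDiff ℝ ((r : ℕ) + 1) f := by exact_mod_cast hf
  have hφ : Iter Hol r φ :=
    h.isInv.iter (fun _ _ => True) (fun r u U _ hU hu => hu.hol (hU.mono (by omega)))
      (fun _ _ _ => trivial) (hΦ.mono (by omega)) trivial
  have hH : Chain (r + 1) 6 (fun ξ : ℝ => 2 * Real.pi * Complex.I * ξ *
      (waveSym β c γ ξ * 𝓕 (fun x => (f (φ x) : ℂ)) ξ)) := by
    have := ((sym_deriv_waveSym hβ hγ hc 6).mul_chain hG (t := r + 1) (by omega))
    simpa only [mul_assoc] using this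
  have hφ' : Iter HolMom r (deriv φ) := by
    refine hd.2.iter (fun r U => Chain (r + 1) 6 U) (fun r u U hch hU hu => ?_)
      (fun r U hU => hU.deriv_sym) hH.wl2 hH
    have hU1 := hU.mono (by omega : 1 ≤ r + 1)
    exact (hu.isFT hU1).holMom (hu.bddCont hU1).1 hch
  exact Iter.comp_succ (P := Hol) (fun u v => Hol.add) (fun u v => Hol.mul)
    (fun u v => HolMom.add) (fun u v => Hol.mul_holMom) (hf'.differentiable (by simp))
    (compIter_hol_of_homogeneous (contDiff_succ_iff_deriv.1 hf').2.2 (homogeneous_deriv hhom))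
    hφ hd.1 hφ' (h.isFT.holMom (hf.continuous.comp h.cont) hG)

/-- The highest derivative of the wave is bounded, also with the weight `x ^ 5`. -/
lemma IsDecayingWave.memLp_top (hβ : 0 < β) (hγ : 0 < γ)
    (hc : c < 3 * (β ^ 2 * γ / 4) ^ (1 / 3 : ℝ)) (h : IsDecayingWave β c γ f φ) {r : ℕ}
    (hf : ContDiff ℝ (r + 1 : ℕ) f)
    (hhom : ∀ t : ℝ, 0 < t → ∀ s : ℝ, f (t * s) = t ^ p * f s) {u : ℝ → ℂ}
    (hu : IsFT u (fun ξ : ℝ => (2 * Real.pi * Complex.I * ξ) ^ (r + 2) *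
      (waveSym β c γ ξ * 𝓕 (fun x => (f (φ x) : ℂ)) ξ))) {N : ℕ} (hN : N ≤ 5) :
    MemLp (fun x : ℝ => (x : ℂ) ^ N * u x) ⊤ volume := by
  have hG := h.chain hβ hγ hc hf
  have hmom := h.iter_mom hβ hγ hc hf (hG.mono (Nat.le_succ r) le_rfl)
  have hhol := (h.iter_holMom hβ hγ hc hf hhom).prop_iteratedDeriv le_rfl
  have hv := Iter.isFT (P := Mom) (r := r + 1) (fun u hu => ⟨hu.1, (hu.2 0 (by omega)).re.congr_norm
    hu.1.aestronglyMeasurable (by simp)⟩) hmom h.isFT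
  have hΓ : Chain 0 N (fun ξ : ℝ => (2 * Real.pi * Complex.I * ξ) ^ (r + 1) *
      𝓕 (fun x => (f (φ x) : ℂ)) ξ) :=
    (Chain.deriv_sym_pow (s := 0) (by rwa [zero_add])).mono le_rfl (by omega)
  -- The Hilbert part is bounded on each xʲv by its Hölder continuity, and the remainder of order −1
  -- by its spare weight.
  obtain ⟨b, hbm, hb, heq⟩ := exists_deriv_waveSym_eq hβ hγ hc
  refine hv.pow_mul_memLp_top ((sym_deriv_waveSym hβ hγ hc N).mono le_rfl (by omega) le_rfl) hΓ
    (fun j hj V w hV hw => ?_) (hu.congr_right ?_)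
  · obtain ⟨-, α, C, hα, hC, hH⟩ := hhol j (by omega)
    have h1 : MemLp (fun ξ => hilbertSym ξ * V ξ) 2 volume :=
      hV.right.of_le_mul (c := 1) (measurable_hilbertSym.aestronglyMeasurable.mul hV.right.1)
        (Eventually.of_forall fun ξ => by
          rw [norm_mul]
          exact mul_le_mul_of_nonneg_right (norm_hilbertSym_le ξ) (norm_nonneg _))
    obtain ⟨w1, hw1⟩ := exists_isFT_inv h1
    have hb1 := hV.hilbert_memLp_top hα hC (fun x y => by
      have := hH x y
      rw [← Real.norm_eq_abs, ← Complex.norm_real] at this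
      push_cast at this
      exact this) hw1
    have h2 : WL2 1 (fun ξ => b ξ * V ξ) := hb.mul_wl2 hbm (wl2_zero_iff.2 hV.right) (by simp)
    obtain ⟨w2, hw2⟩ := exists_isFT_inv h2.memLp
    have hsum := hw.unique_left (((hw1.const_mul (β : ℂ)⁻¹).add hw2).congr_right (by
      filter_upwards with ξ
      rw [heq]; ring))
    exact (MemLp.add (hb1.const_mul (β : ℂ)⁻¹) (hw2.memLp_top h2.integrable)).ae_eq hsum.symm
  · filter_upwards with ξ
    ring

end

/-! ### Weighted L^q bounds and real representatives. -/

lemma memLp_of_one_of_top {w : ℝ → ℝ} (h1 : MemLp w 1 volume) (h : MemLp w ⊤ volume) {q : ℝ≥0∞}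
    (hq : 1 ≤ q) : MemLp w q volume := by
  rcases eq_or_ne q ⊤ with rfl | hq'
  · exact h
  have hq0 : q ≠ 0 := (zero_lt_one.trans_le hq).ne'
  have hqr : 1 ≤ q.toReal := by
    have := ENNReal.toReal_mono hq' hq
    simpa using this
  obtain ⟨B, hB⟩ : ∃ B : ℝ, ∀ᵐ x, ‖w x‖ ≤ B := by
    refine ⟨(eLpNormEssSup w volume).toReal, ?_⟩
    have h2 : eLpNormEssSup w volume ≠ ⊤ := by
      have := h.2.ne
      rwa [eLpNorm_exponent_top] at this
    filter_upwards [ae_le_eLpNormEssSup (f := w) (μ := volume)] with x hx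
    have := ENNReal.toReal_mono h2 hx
    simpa using this
  refine (integrable_norm_rpow_iff h1.1 hq0 hq').1 ?_
  have hi := (memLp_one_iff_integrable.1 h1).norm
  refine (hi.const_mul (max B 0 ^ (q.toReal - 1))).mono'
    (h1.1.norm.aemeasurable.pow_const _).aestronglyMeasurable ?_
  filter_upwards [hB] with x hx
  rw [Real.norm_of_nonneg (by positivity)]
  rcases (norm_nonneg (w x)).eq_or_lt with h0 | h0
  · rw [← h0, Real.zero_rpow (by linarith), mul_zero]
  · calc ‖w x‖ ^ q.toReal = ‖w x‖ ^ (q.toReal - 1) * ‖w x‖ := by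
          rw [Real.rpow_sub_one h0.ne', div_mul_cancel₀ _ h0.ne']
      _ ≤ max B 0 ^ (q.toReal - 1) * ‖w x‖ := by
          refine mul_le_mul_of_nonneg_right ?_ h0.le
          exact Real.rpow_le_rpow h0.le (hx.trans (le_max_left _ _)) (by linarith)

/-- Weighted `L²` and `L^∞` bounds give all the weighted `L^q` bounds. -/
lemma memLp_weight {u : ℝ → ℝ} {L : ℕ} (h2 : MemLp (fun x => (u x : ℂ)) 2 volume)
    (h2' : MemLp (fun x : ℝ => (x : ℂ) ^ (L + 1) * u x) 2 volume)
    (ht : MemLp (fun x => (u x : ℂ)) ⊤ volume)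
    (ht' : MemLp (fun x : ℝ => (x : ℂ) ^ L * u x) ⊤ volume) {q : ℝ≥0∞} (hq : 1 ≤ q) {l : ℝ}
    (hl : l ∈ Set.Icc (0 : ℝ) L) : MemLp (fun x : ℝ => |x| ^ l * u x) q volume := by
  have hum : AEStronglyMeasurable u volume := by
    have := Complex.continuous_re.comp_aestronglyMeasurable h2.1
    simpa using this
  have hw : Continuous fun x : ℝ => (1 + |x|) ^ L := by fun_prop
  have hpow : ∀ (k : ℕ) (x : ℝ), (1 + |x|) ^ k ≤ 2 ^ k * (1 + |x| ^ k) := by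
    intro k x
    have h0 := abs_nonneg x
    rcases le_total |x| 1 with h | h
    · calc (1 + |x|) ^ k ≤ 2 ^ k := pow_le_pow_left₀ (by linarith) (by linarith) k
        _ ≤ _ := le_mul_of_one_le_right (by positivity) (by linarith [pow_nonneg h0 k])
    · calc (1 + |x|) ^ k ≤ (2 * |x|) ^ k := pow_le_pow_left₀ (by linarith) (by linarith) k
        _ = 2 ^ k * |x| ^ k := mul_pow _ _ _
        _ ≤ _ := by gcongr; linarith
  have hkey : ∀ (k : ℕ) (r : ℝ≥0∞), MemLp (fun x => (u x : ℂ)) r volume →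
      MemLp (fun x : ℝ => (x : ℂ) ^ k * u x) r volume →
      MemLp (fun x : ℝ => (1 + |x|) ^ k * u x) r volume := by
    intro k r hr hr'
    have hc : Continuous fun x : ℝ => (1 + |x|) ^ k := by fun_prop
    have h3 : MemLp _ r volume := hr.norm.add hr'.norm
    refine h3.of_le_mul (c := 2 ^ k) (hc.aestronglyMeasurable.mul hum)
      (Eventually.of_forall fun x => ?_)
    have h4 := one_add_abs_pos x
    have h5 : (0 : ℝ) ≤ (1 + |x|) ^ k := by positivity
    have h6 : 0 ≤ ‖(u x : ℂ)‖ + ‖(x : ℂ) ^ k * u x‖ := by positivity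
    rw [norm_mul, Real.norm_of_nonneg h5, Pi.add_apply, Real.norm_of_nonneg h6, norm_mul, norm_pow, Complex.norm_real,
      Complex.norm_real, Real.norm_eq_abs x, ← one_add_mul, ← mul_assoc]
    exact mul_le_mul_of_nonneg_right (hpow k x) (norm_nonneg _)
  have htop := hkey L ⊤ ht ht'
  -- The weight L + 1 in L² gives the weight L in L¹, by Cauchy–Schwarz.
  have hone : MemLp (fun x : ℝ => (1 + |x|) ^ L * u x) 1 volume := by
    have h3 : WL2 (L + 1) (fun x => (u x : ℂ)) := by
      refine (hkey (L + 1) 2 h2 h2').ofReal.ae_eq ?_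
      filter_upwards with x
      push_cast; rfl
    have h4 := h3.integrable_weight
    have hm : AEStronglyMeasurable (fun x : ℝ => (1 + |x|) ^ L * u x) volume :=
      hw.aestronglyMeasurable.mul hum
    rw [memLp_one_iff_integrable, ← integrable_norm_iff hm]
    refine h4.congr ?_
    filter_upwards with x
    have h5 := one_add_abs_pos x
    have h6 : (0 : ℝ) ≤ (1 + |x|) ^ L := by positivity
    rw [norm_mul, Real.norm_of_nonneg h6, Complex.norm_real]
  refine (memLp_of_one_of_top hone htop hq).of_le_mul (c := 1)
    ((Continuous.aestronglyMeasurable (continuous_abs.rpow_const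
      fun x => Or.inr hl.1)).mul hum) (Eventually.of_forall fun x => ?_)
  have h5 := one_add_abs_pos x
  have h6 : (0 : ℝ) ≤ |x| ^ l := by positivity
  have h7 : (0 : ℝ) ≤ (1 + |x|) ^ L := by positivity
  rw [one_mul, norm_mul, norm_mul, Real.norm_of_nonneg h6, Real.norm_of_nonneg h7]
  refine mul_le_mul_of_nonneg_right ?_ (norm_nonneg _)
  calc |x| ^ l ≤ (1 + |x|) ^ l := Real.rpow_le_rpow (abs_nonneg _) (by linarith) hl.1
    _ ≤ (1 + |x|) ^ (L : ℝ) := Real.rpow_le_rpow_of_exponent_le (one_le_one_add_abs x) hl.2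
    _ = _ := Real.rpow_natCast _ _

/-- Real symbols map real functions to real functions. -/
lemma IsFT.exists_real {φ : ℝ → ℝ} {Φ a : ℝ → ℂ} (h : IsFT (fun x => (φ x : ℂ)) Φ)
    (ha : ∀ ξ, (starRingEnd ℂ) (a (-ξ)) = a ξ) (hU : MemLp (fun ξ => a ξ * Φ ξ) 2 volume) :
    ∃ u : ℝ → ℝ, IsFT (fun x => (u x : ℂ)) (fun ξ => a ξ * Φ ξ) := by
  obtain ⟨w, hw⟩ := exists_isFT_inv hU
  have h1 := (h.conj.congr_left (v := fun x => (φ x : ℂ)) (by simp)).unique h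
  have h2 := hw.conj.congr_right (V := fun ξ => a ξ * Φ ξ) (by
    filter_upwards [h1] with ξ hξ
    rw [map_mul, ha, hξ])
  have h3 := h2.unique_left hw
  refine ⟨fun x => (w x).re, hw.congr_left ?_⟩
  filter_upwards [h3] with x hx
  exact (Complex.conj_eq_iff_re.1 hx).symm

lemma conj_deriv_sym (k : ℤ) (ξ : ℝ) :
    (starRingEnd ℂ) ((2 * Real.pi * Complex.I * ((-ξ : ℝ) : ℂ)) ^ k) =
      (2 * Real.pi * Complex.I * ξ) ^ k := by
  rw [map_zpow₀]
  congr 1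
  simp [Complex.conj_ofNat]

lemma isFT_iteratedDeriv_testFunction {w : ℝ → ℝ} (hw : ContDiff ℝ ∞ w) (hc : HasCompactSupport w)
    (n : ℕ) : IsFT (fun x => ((iteratedDeriv n w x : ℝ) : ℂ))
      (fun ξ => (2 * Real.pi * Complex.I * ξ) ^ n * 𝓕 (fun x => (w x : ℂ)) ξ) := by
  have hd : ∀ n, ContDiff ℝ ∞ (iteratedDeriv n w) ∧ HasCompactSupport (iteratedDeriv n w) := by
    intro n
    induction n with
    | zero => simpa using ⟨hw, hc⟩
    | succ n ih =>
      rw [iteratedDeriv_succ]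
      exact ⟨contDiff_deriv_testFunction ih.1, ih.2.deriv⟩
  induction n with
  | zero => simpa using isFT_testFunction hw hc
  | succ n ih =>
    have h1 := (hd n).1
    have h2 := ih.deriv (u' := fun x => ((deriv (iteratedDeriv n w) x : ℝ) : ℂ))
      (Complex.continuous_ofReal.comp h1.continuous)
      (fun x _ => ((h1.differentiable (by simp)) x).hasDerivAt.ofReal_comp)
      (isFT_testFunction (contDiff_deriv_testFunction h1) (hd n).2.deriv).left
    rw [iteratedDeriv_succ]
    refine h2.congr_right ?_
    filter_upwards with ξ
    ring

lemma IsFT.isWeakDeriv {φ u : ℝ → ℝ} {Φ : ℝ → ℂ} {n : ℕ} (h : IsFT (fun x => (φ x : ℂ)) Φ)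
    (hu : IsFT (fun x => (u x : ℂ)) (fun ξ => (2 * Real.pi * Complex.I * ξ) ^ n * Φ ξ)) :
    IsWeakDeriv n φ u := by
  have hloc : ∀ {v : ℝ → ℝ} {V : ℝ → ℂ}, IsFT (fun x => (v x : ℂ)) V →
      LocallyIntegrable v volume := by
    intro v V hv
    have h1 : MemLp v 2 volume := by
      have := hv.left.re
      simpa using this
    exact h1.locallyIntegrable (by norm_num)
  refine ⟨hloc h, hloc hu, fun w hw hc => ?_⟩
  have h1 := h.integral_mul (isFT_iteratedDeriv_testFunction hw hc n)
  have h2 := hu.integral_mul (isFT_testFunction hw hc)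
  have h3 : ∫ x, (φ x : ℂ) * ((iteratedDeriv n w x : ℝ) : ℂ) =
      (-1) ^ n * ∫ x, (u x : ℂ) * (w x : ℂ) := by
    rw [h1, h2, ← integral_const_mul]
    congr 1
    funext ξ
    push_cast
    have h4 : ((-1 : ℂ)) ^ n * (-1) ^ n = 1 := by rw [← mul_pow]; norm_num
    rw [mul_neg, neg_pow (2 * Real.pi * Complex.I * (ξ : ℂ)), ← mul_assoc, ← mul_assoc, ← mul_assoc,
      ← mul_assoc, h4, one_mul]
    ring
  simp only [← Complex.ofReal_mul] at h3
  rw [integral_complex_ofReal, integral_complex_ofReal] at h3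
  exact_mod_cast h3

/-! ### Assembly of the two claims. -/

section

variable {β γ c p : ℝ} {f φ φ₀ : ℝ → ℝ}

/-- The negative powers of ζ cancel against the ζ² of the multiplier, leaving (iζ)^j/D with j = k +
2. It yields 3 + j moments in L², hence weights up to 2 + j = 4 + k, and its order j − 3 ≤ −1 yields
the spare weight for the sup bounds. -/
lemma exists_fourierDeriv (hβ : 0 < β) (hγ : 0 < γ)
    (hc : c < 3 * (β ^ 2 * γ / 4) ^ (1 / 3 : ℝ)) (h : IsDecayingWave β c γ f φ₀)
    (hφ : φ =ᵐ[volume] φ₀) (hf : ContDiff ℝ 2 f) (j : ℕ) (hj : j ≤ 2) :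
    ∃ u : ℝ → ℝ, IsFourierDeriv ((j : ℤ) - 2) φ u ∧ ∀ q : ℝ≥0∞, 1 ≤ q →
      ∀ l ∈ Set.Icc (0 : ℝ) ((2 + j : ℕ) : ℝ), MemLp (fun x : ℝ => |x| ^ l * u x) q volume := by
  have hG := h.chain (m := 0) hβ hγ hc (hf.of_le (by simp))
  have hΦ : IsFT (fun x => (φ x : ℂ)) (fun ξ => waveSym β c γ ξ * 𝓕 (fun x => (f (φ₀ x) : ℂ)) ξ) :=
    (h.isInv.isFT ((hG.wl2.waveSym_mul hβ hγ hc))).congr_left (by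
      filter_upwards [hφ] with x hx
      rw [hx])
  have hch : Chain 1 (3 + j) (fun ξ : ℝ => ((2 * Real.pi * Complex.I) ^ j *
      ((ξ : ℂ) ^ j * (denom β c γ ξ : ℂ)⁻¹)) * 𝓕 (fun x => (f (φ₀ x) : ℂ)) ξ) :=
    ((sym_pow_div_denom hβ hγ hc j (3 + j)).const_mul _).mul_chain (hG.mono le_rfl (by omega))
      (by push_cast; omega)
  have hae : (fun ξ : ℝ => (2 * Real.pi * Complex.I * ξ) ^ ((j : ℤ) - 2) *
      (waveSym β c γ ξ * 𝓕 (fun x => (f (φ₀ x) : ℂ)) ξ)) =ᵐ[volume]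
      fun ξ : ℝ => ((2 * Real.pi * Complex.I) ^ j *
      ((ξ : ℂ) ^ j * (denom β c γ ξ : ℂ)⁻¹)) * 𝓕 (fun x => (f (φ₀ x) : ℂ)) ξ := by
    filter_upwards [Measure.ae_ne volume 0] with ξ hξ
    have hpi : (Real.pi : ℂ) ≠ 0 := by exact_mod_cast Real.pi_ne_zero
    have hξ' : (ξ : ℂ) ≠ 0 := by exact_mod_cast hξ
    have hne : 2 * Real.pi * Complex.I * (ξ : ℂ) ≠ 0 := by simp [hpi, hξ']
    have hw : waveSym β c γ ξ = (2 * Real.pi * Complex.I * ξ) ^ 2 * (denom β c γ ξ : ℂ)⁻¹ := by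
      rw [waveSym, mul_pow, mul_pow, mul_pow, Complex.I_sq]; ring
    rw [hw, zpow_sub₀ hne, zpow_natCast, mul_pow (2 * Real.pi * Complex.I)]
    have h2 : (2 * Real.pi * Complex.I * (ξ : ℂ)) ^ (2 : ℤ) =
      (2 * Real.pi * Complex.I * (ξ : ℂ)) ^ 2 := by norm_cast
    rw [h2]
    field_simp
  obtain ⟨u, hu⟩ := hΦ.exists_real (a := fun ξ : ℝ => (2 * Real.pi * Complex.I * ξ) ^ ((j : ℤ) - 2))
    (fun ξ => conj_deriv_sym _ ξ) (hch.wl2.memLp.ae_eq hae.symm)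
  refine ⟨u, (isFourierDeriv_iff hΦ).2 hu, fun q hq l hl => ?_⟩
  have hu2 := hu.congr_right hae
  obtain ⟨V, hV, -⟩ := hch.isFT_pow hu2 le_rfl
  obtain ⟨V', hV', hVc⟩ := hch.isFT_pow hu2 (by omega : 2 + j ≤ 3 + j)
  have h3 : 2 + j + 1 = 3 + j := by omega
  exact memLp_weight (L := 2 + j) hu2.left (by rw [h3]; exact hV.left)
    (hu2.memLp_top hch.wl2.integrable) (hV'.memLp_top hVc.wl2.integrable) hq hl

/-- As the multiplier gains one derivative, f of class C^(s+r) leaves s weights after r + 1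
derivatives: s = 1 gives sup bounds at once, s = 0 only L² moments. -/
lemma IsDecayingWave.chain_deriv (hβ : 0 < β) (hγ : 0 < γ)
    (hc : c < 3 * (β ^ 2 * γ / 4) ^ (1 / 3 : ℝ)) (h : IsDecayingWave β c γ f φ) {s r : ℕ}
    (hf : ContDiff ℝ (s + r : ℕ) f) : Chain s 6 (fun ξ : ℝ =>
      (2 * Real.pi * Complex.I * ξ) ^ (r + 1) *
        (waveSym β c γ ξ * 𝓕 (fun x => (f (φ x) : ℂ)) ξ)) := by
  have h1 := Chain.deriv_sym_pow ((sym_deriv_waveSym hβ hγ hc 6).mul_chain (h.chain hβ hγ hc hf)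
    (t := s + r) (by omega))
  convert h1 using 2
  ring

/-- The sup bound enters as the hypothesis `hb` because it has two sources: a spare derivative of f,
or homogeneity. -/
lemma exists_weakDeriv (hβ : 0 < β) (hγ : 0 < γ)
    (hc : c < 3 * (β ^ 2 * γ / 4) ^ (1 / 3 : ℝ)) (h : IsDecayingWave β c γ f φ₀)
    (hφ : φ =ᵐ[volume] φ₀) {r : ℕ} (hf : ContDiff ℝ r f)
    (hb : ∀ u, IsFT u (fun ξ : ℝ => (2 * Real.pi * Complex.I * ξ) ^ (r + 1) *
      (waveSym β c γ ξ * 𝓕 (fun x => (f (φ₀ x) : ℂ)) ξ)) → ∀ N ≤ 5,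
      MemLp (fun x : ℝ => (x : ℂ) ^ N * u x) ⊤ volume) :
    ∃ u : ℝ → ℝ, IsWeakDeriv (r + 1) φ u ∧ ∀ q : ℝ≥0∞, 1 ≤ q → ∀ l ∈ Set.Icc (0 : ℝ) 5,
      MemLp (fun x : ℝ => |x| ^ l * u x) q volume := by
  have hG := h.chain hβ hγ hc hf
  have hΦ : IsFT (fun x => (φ x : ℂ)) (fun ξ => waveSym β c γ ξ * 𝓕 (fun x => (f (φ₀ x) : ℂ)) ξ) :=
    (h.isInv.isFT ((hG.wl2.waveSym_mul hβ hγ hc).mono (by omega))).congr_left (by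
      filter_upwards [hφ] with x hx
      rw [hx])
  have hch := h.chain_deriv hβ hγ hc (s := 0) (r := r) (by rwa [zero_add])
  obtain ⟨u, hu⟩ := hΦ.exists_real (a := fun ξ : ℝ => (2 * Real.pi * Complex.I * ξ) ^ (r + 1))
    (fun ξ => by exact_mod_cast conj_deriv_sym (r + 1 : ℕ) ξ) hch.wl2.memLp
  refine ⟨u, hΦ.isWeakDeriv hu, fun q hq l hl => ?_⟩
  obtain ⟨V, hV, -⟩ := hch.isFT_pow hu (le_refl 6)
  have h0 := hb _ hu 0 (by norm_num)
  simp only [pow_zero, one_mul] at h0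
  exact memLp_weight (L := 5) hu.left hV.left h0 (hb _ hu 5 le_rfl) hq (by exact_mod_cast hl)

end

end RGBO

theorem theorem2p4
    (β γ c p : ℝ) (hβ : 0 < β) (hγ : 0 < γ)
    (hc : c < 3 * (β ^ 2 * γ / 4) ^ (1 / 3 : ℝ)) (hp : 1 < p)
    (f : ℝ → ℝ) (hf : ContDiff ℝ 2 f)
    (hhom : ∀ t : ℝ, 0 < t → ∀ s : ℝ, f (t * s) = t ^ p * f s)
    (φ : ℝ → ℝ) (hφ : RGBO.IsSolitaryWave β c γ f φ) :
    (∀ k : ℤ, k ∈ ({-2, -1, 0} : Set ℤ) →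
      ∃ u : ℝ → ℝ, RGBO.IsFourierDeriv k φ u ∧
        ∀ q : ℝ≥0∞, 1 ≤ q → ∀ l ∈ Set.Icc (0 : ℝ) (4 + k),
          MemLp (fun x : ℝ => |x| ^ l * u x) q volume) ∧
    (∀ m : ℕ, ContDiff ℝ m f → ∀ n : ℕ, 1 ≤ n → n ≤ m + 1 →
      ∃ u : ℝ → ℝ, RGBO.IsWeakDeriv n φ u ∧
        ∀ q : ℝ≥0∞, 1 ≤ q → ∀ l ∈ Set.Icc (0 : ℝ) 5,
          MemLp (fun x : ℝ => |x| ^ l * u x) q volume) := by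
  obtain ⟨φ₀, hφ₀, hw⟩ := RGBO.exists_isWave hβ hγ hc hp hf.continuous hhom hφ
  have hd := hw.isDecayingWave hβ hγ hc hp hf hhom
  constructor
  · intro k hk
    obtain ⟨j, hj, rfl⟩ : ∃ j : ℕ, j ≤ 2 ∧ k = (j : ℤ) - 2 := by
      rcases hk with rfl | rfl | rfl
      · exact ⟨0, by norm_num, by norm_num⟩
      · exact ⟨1, by norm_num, by norm_num⟩
      · exact ⟨2, by norm_num, by norm_num⟩
    obtain ⟨u, hu, h⟩ := RGBO.exists_fourierDeriv hβ hγ hc hd hφ₀ hf j hj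
    refine ⟨u, hu, fun q hq l hl => h q hq l ⟨hl.1, hl.2.trans (le_of_eq ?_)⟩⟩
    push_cast
    ring
  · intro m hm n hn hnm
    obtain ⟨r, rfl⟩ : ∃ r, n = r + 1 := ⟨n - 1, by omega⟩
    -- For n ≤ 2 the assumption f ∈ C² leaves a spare derivative. For n ≥ 3 there may be none, and
    -- the Hölder argument supplies the sup bound.
    rcases le_or_gt r 1 with hr | hr
    · have hfr : ContDiff ℝ (1 + r : ℕ) f := hf.of_le (by exact_mod_cast (by omega : 1 + r ≤ 2))
      refine RGBO.exists_weakDeriv hβ hγ hc hd hφ₀ (hfr.of_le (by exact_mod_cast Nat.le_add_left r 1))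
        fun u hu N hN => ?_
      obtain ⟨V, hV, hVc⟩ := (hd.chain_deriv hβ hγ hc hfr).isFT_pow hu (by omega : N ≤ 6)
      exact hV.memLp_top hVc.wl2.integrable
    · obtain ⟨t, rfl⟩ : ∃ t, r = t + 1 := ⟨r - 1, by omega⟩
      have hfr : ContDiff ℝ (t + 1 : ℕ) f := hm.of_le (by exact_mod_cast (by omega : t + 1 ≤ m))
      exact RGBO.exists_weakDeriv hβ hγ hc hd hφ₀ hfr
        fun u hu N hN => hd.memLp_top hβ hγ hc hfr hhom hu hN
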